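/- **Setting.** Identify $\mathbb R^4$ with $\mathbb C^2$, let $S^3\subset\mathbb R^4$ be the unit sphere, oriented as the boundary of the ball, and for $A\subset S^3$ let $C(A)=\{t\sigma: t\ge 0,\ \sigma\in A\}$. Let $K\subset S^3$ be a trivial knot, i.e. smoothly ambient isotopic to a great circle. *Band.* Let $F\subset S^3$ be a characteristic band of $K$: a smoothly embedded annulus with coordinates $(\rho,l)\in(\mathbb R/2\pi\mathbb Z)\times[-1,1]$ whose two boundary curves $l=\pm1$ are smoothly ambient isotopic to $K$ and, oriented by $\rho$, have linking number $0$. Let $Q=\{|\rho-\rho_0|\le\varepsilon\}\subset F$, with $0<\varepsilon<\pi$, be a slice of $F$. *Twist.* Let $E:(\mathbb R/2\pi\mathbb Z)\times\{v\in\mathbb C:|v|\le1\}\to S^3$ be a smooth orientation-preserving embedding with $E(\rho,l)=(\rho,l)\in F$ for real $l\in[-1,1]$. For $n\in\mathbb Z$ let $\theta:\mathbb R\to\mathbb R$ be a $C^1$ function with $\theta(\rho+2\pi)=\theta(\rho)+2\pi n$ and $\theta(\rho)=0$ for $|\rho-\rho_0|\le\varepsilon$. The band twisted by $n$ full turns ($2\pi$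 each) is $F'=\{E(\rho,l\,e^{i\theta(\rho)}): \rho\in\mathbb R,\ |l|\le 1\}$; it contains $Q$. *Germ.* Let $1<\beta_1\le\beta_2$. For $t\ge0$ put, in the $(x,y)$-plane, $$p_1=(-t,t),\quad p_2=(-t^{\beta_1},t^{\beta_2}),\quad p_3=(t^{\beta_1},t^{\beta_2}),\quad p_4=(t,t),$$ and let $p_j'$ be the mirror image of $p_j$ in the $x$-axis. Let $\bar J_t$ be the union of the polygonal arcs $p_1p_2p_3p_4$ and $p_1'p_2'p_3'p_4'$, and let $\hat J_t$ be obtained from $\bar J_t$ by replacing the segments $[p_2,p_3]$ and $[p_2',p_3']$ with $[p_2,p_2']$ and $[p_3,p_3']$. Let $B=\bigcup_{t\ge0}\bar J_t\times\{t\}$ (a $(\beta_1,\beta_2)$-bridge) and $\hat B=\bigcup_{t\ge0}\hat J_t\times\{t\}$ in $\mathbb R^3$. Let $\Theta$ be the homeomorphism from $\{|x|\le z,\ |y|\le z\}$ onto $C(Q)$ that sends $(tx,ty,t)$ to $t$ times the point of $Q$ with $l=x$, $\rho=\rho_0+\varepsilon y$. The twisted one-bridge surface germ $X'$ and the germ $S(X')$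 obtained from it by the saddle move are the germs at the origin of $$X'=\bigl(C(\partial F')\setminus C(Q)\bigr)\cup\Theta(B),\qquad S(X')=\bigl(X'\setminus\Theta(B)\bigr)\cup\Theta(\hat B).$$ **Proposition.** The link at the origin of $S(X')$ is a torus link. More precisely, for all sufficiently small $t>0$, the set $L_t=\{\sigma\in S^3: t\sigma\in S(X')\}$ is ambient isotopic to the torus link of type $(2,2n)$, that is, to $\{(z,w)\in S^3: |z|=|w|,\ w=\pm z^n/|z|^{n-1}\}$. It consists of two disjoint simple closed curves which lie on an unknotted torus in $S^3$; oriented so that they are freely homotopic on this torus, they have linking number $n$. In particular, when the band is twisted by $n=2i$ full turns, the linking number is $2i$. -/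

import Mathlib

open scoped Manifold ContDiff Topology

noncomputable section

namespace MetricKnots

/-- Euclidean four-space. -/
abbrev R4 : Type := EuclideanSpace ℝ (Fin 4)

/-- The unit sphere of `R4`. -/
abbrev S3 : Type := Metric.sphere (0 : R4) 1

instance finrank_R4 : Fact (Module.finrank ℝ R4 = 3 + 1) := ⟨by simp⟩

/-! ### Isotopies of the three-sphere -/

/-- There is a smooth ambient isotopy of the three-sphere, starting at the identity, whose time-one
map carries `A` onto `B`. This is the equivalence of smooth knots. -/
def SmoothlyIsotopic (A B : Set S3) : Prop :=
  ∃ H : ℝ → Diffeomorph (𝓡 3) (𝓡 3) S3 S3 ∞,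
    ContMDiff (𝓘(ℝ, ℝ).prod (𝓡 3)) (𝓡 3) ∞ (fun p : ℝ × S3 => H p.1 p.2) ∧
    (∀ σ, H 0 σ = σ) ∧ H 1 '' A = B

/-- There is an ambient isotopy of the three-sphere (in the topological category), starting at the
identity, whose time-one map carries `A` onto `B`. -/
def AmbientIsotopic (A B : Set S3) : Prop :=
  ∃ H : unitInterval → (S3 ≃ₜ S3),
    Continuous (fun p : unitInterval × S3 => H p.1 p.2) ∧
    (∀ σ, H 0 σ = σ) ∧ H 1 '' A = B

/-- A great circle. -/
def greatCircle : Set S3 := {σ | (σ : R4) 2 = 0 ∧ (σ : R4) 3 = 0}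

/-- A trivial (smooth) knot. -/
def IsTrivialKnot (K : Set S3) : Prop := SmoothlyIsotopic K greatCircle

/-! ### Closed curves and linking numbers

Closed curves are `2π`-periodic maps from the real line to the three-sphere. -/

/-- The determinant of four vectors, taken as the rows of a matrix. -/
def det4 (a b c d : R4) : ℝ := Matrix.det (Matrix.of fun i j => (![a, b, c, d] i) j)

/-- The velocity in `R4` of a curve on the three-sphere. -/
def velocity (γ : ℝ → S3) (s : ℝ) : R4 := deriv (fun r => (γ r : R4)) s

/-- The linking number of two disjoint closed Lipschitz curves in the three-sphere, oriented as the
boundary of the unit ball: the Gauss linking integral of the sphere. It is the degree of the linking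
map `(s, t, u) ↦ ((1 - u) x(s) - u y(t)) / ‖(1 - u) x(s) - u y(t)‖` from the join of two circles to
the three-sphere (of volume `2π²`); the partial derivatives have been expanded in the determinant.
The sign is such that two fibres of the Hopf map `ℂ² ⊃ S³ → ℂP¹` have linking number `+1`. -/
def linkingNumber (x y : ℝ → S3) : ℝ :=
  1 / (2 * Real.pi ^ 2) *
    ∫ s in (0 : ℝ)..(2 * Real.pi), ∫ t in (0 : ℝ)..(2 * Real.pi), ∫ u in (0 : ℝ)..1,
      u * (1 - u) * det4 (x s) (velocity x s) (y t) (velocity y t) /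
        ‖(1 - u) • (x s : R4) - u • (y t : R4)‖ ^ 4

/-- A simple closed Lipschitz curve in the three-sphere. -/
structure IsSimpleClosedCurve (γ : ℝ → S3) : Prop where
  periodic : ∀ s, γ (s + 2 * Real.pi) = γ s
  injective : ∀ s s', γ s = γ s' → ∃ k : ℤ, s' = s + 2 * Real.pi * k
  lipschitz : ∃ C, LipschitzWith C γ

/-- Two closed curves in `T` are freely homotopic in `T` (as oriented curves). -/
def FreelyHomotopicIn (T : Set S3) (γ₁ γ₂ : ℝ → S3) : Prop :=
  ∃ G : unitInterval × ℝ → S3, Continuous G ∧ (∀ p, G p ∈ T) ∧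
    (∀ r s, G (r, s + 2 * Real.pi) = G (r, s)) ∧
    (∀ s, G (0, s) = γ₁ s) ∧ (∀ s, G (1, s) = γ₂ s)

/-! ### Tori and torus links -/

/-- The point of `R4 = ℂ²` with coordinates `(exp(iα), exp(iβ)) / √2`. -/
def torusPoint (α β : ℝ) : R4 :=
  (1 / √2) • !₂[Real.cos α, Real.sin α, Real.cos β, Real.sin β]

/-- The Clifford torus: the standard unknotted torus. -/
def cliffordTorus : Set S3 := {σ | ∃ α β : ℝ, (σ : R4) = torusPoint α β}

/-- An unknotted torus in the three-sphere. -/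
def IsUnknottedTorus (T : Set S3) : Prop := AmbientIsotopic T cliffordTorus

/-- The standard torus link of type `(p, q)`: the points of the Clifford torus whose angles satisfy
`p β = q α` modulo `2π`. -/
def torusLink (p q : ℤ) : Set S3 :=
  {σ | ∃ α β : ℝ, (∃ k : ℤ, p * β - q * α = 2 * Real.pi * k) ∧ (σ : R4) = torusPoint α β}

/-- A torus link of type `(p, q)`, as an unoriented link up to isotopy. -/
def IsTorusLink (L : Set S3) (p q : ℤ) : Prop := AmbientIsotopic L (torusLink p q)

/-! ### Characteristic bands, slices and twisted bands -/

/-- A characteristic band of the knot `K`: a smooth embedded closed annulus in the three-sphere,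
given in coordinates `(ρ, l)`, with `ρ` an angle and `l ∈ [-1, 1]`, whose two boundary components
are isotopic to `K` and have linking number zero. Smoothness up to the boundary is expressed through
a smooth extension to all real `l`; only the values with `l ∈ [-1, 1]` matter. -/
structure CharacteristicBand (K : Set S3) where
  coord : ℝ → ℝ → S3
  smooth : ContDiff ℝ ∞ (fun p : ℝ × ℝ => (coord p.1 p.2 : R4))
  periodic : ∀ ρ, ∀ l ∈ Set.Icc (-1 : ℝ) 1, coord (ρ + 2 * Real.pi) l = coord ρ l
  injective : ∀ ρ ρ', ∀ l ∈ Set.Icc (-1 : ℝ) 1, ∀ l' ∈ Set.Icc (-1 : ℝ) 1,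
    coord ρ l = coord ρ' l' → l = l' ∧ ∃ k : ℤ, ρ' = ρ + 2 * Real.pi * k
  immersion : ∀ ρ, ∀ l ∈ Set.Icc (-1 : ℝ) 1, LinearIndependent ℝ
    ![deriv (fun r => (coord r l : R4)) ρ, deriv (fun m => (coord ρ m : R4)) l]
  boundary_pos : SmoothlyIsotopic (Set.range fun ρ => coord ρ 1) K
  boundary_neg : SmoothlyIsotopic (Set.range fun ρ => coord ρ (-1)) K
  linking : linkingNumber (fun ρ => coord ρ 1) (fun ρ => coord ρ (-1)) = 0

/-- A solid torus around the band: a smooth orientation-preserving embedding of the product of the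
circle and the closed unit disk of `ℂ`, the band being the union of the real diameters of the
disks. It is the region in which the band is twisted. -/
structure Thickening {K : Set S3} (F : CharacteristicBand K) where
  coord : ℝ → ℂ → S3
  smooth : ContDiff ℝ ∞ (fun p : ℝ × ℂ => (coord p.1 p.2 : R4))
  periodic : ∀ ρ, ∀ v ∈ Metric.closedBall (0 : ℂ) 1, coord (ρ + 2 * Real.pi) v = coord ρ v
  injective : ∀ ρ ρ', ∀ v ∈ Metric.closedBall (0 : ℂ) 1, ∀ v' ∈ Metric.closedBall (0 : ℂ) 1,
    coord ρ v = coord ρ' v' → v = v' ∧ ∃ k : ℤ, ρ' = ρ + 2 * Real.pi * k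
  oriented : ∀ ρ, ∀ v ∈ Metric.closedBall (0 : ℂ) 1,
    0 < det4 (coord ρ v) (deriv (fun r => (coord r v : R4)) ρ)
      (deriv (fun m : ℝ => (coord ρ (v + m) : R4)) 0)
      (deriv (fun m : ℝ => (coord ρ (v + m * Complex.I) : R4)) 0)
  extends_band : ∀ ρ, ∀ l ∈ Set.Icc (-1 : ℝ) 1, coord ρ (l : ℂ) = F.coord ρ l

/-- The position `ρ₀` and the half-width `ε` of a slice, a proper part of the annulus. -/
structure Slice where
  ρ₀ : ℝ
  ε : ℝ
  ε_pos : 0 < ε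
  ε_lt : ε < Real.pi

/-- The slice `{(ρ, l) : |ρ - ρ₀| ≤ ε}` of a band. -/
def Slice.carrier {K : Set S3} (Q : Slice) (F : CharacteristicBand K) : Set S3 :=
  {σ | ∃ ρ l : ℝ, |ρ - Q.ρ₀| ≤ Q.ε ∧ l ∈ Set.Icc (-1 : ℝ) 1 ∧ σ = F.coord ρ l}

/-- An angle function that makes `n` full turns (each by `2π`, positively if `n > 0`) along the part
of the band outside the slice, and does not move the slice. -/
structure TwistAngle (Q : Slice) (n : ℤ) where
  angle : ℝ → ℝ
  contDiff : ContDiff ℝ 1 angle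
  turns : ∀ ρ, angle (ρ + 2 * Real.pi) = angle ρ + 2 * Real.pi * n
  zero_on_slice : ∀ ρ, |ρ - Q.ρ₀| ≤ Q.ε → angle ρ = 0

/-- Coordinates on the twisted band: the slice is removed from the band, the rest of the band is
rotated about its core by the angle function, and the slice is put back. -/
def twistedBand {K : Set S3} {F : CharacteristicBand K} (N : Thickening F) {Q : Slice} {n : ℤ}
    (τ : TwistAngle Q n) (ρ l : ℝ) : S3 :=
  N.coord ρ (l * Complex.exp (τ.angle ρ * Complex.I))

/-- The straight cone, with vertex at the origin, over a subset of the three-sphere. -/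
def cone (A : Set S3) : Set R4 := {p | ∃ t : ℝ, 0 ≤ t ∧ ∃ σ ∈ A, p = t • (σ : R4)}

/-! ### Bridges and the saddle move -/

/-- The section at height `t` of the `(β₁, β₂)`-bridge: two polygonal arcs, through
`(-t, t), (-t^β₁, t^β₂), (t^β₁, t^β₂), (t, t)` and through the mirror images of these points in the
`x`-axis. -/
def bridgeSection (β₁ β₂ t : ℝ) : Set (ℝ × ℝ) :=
  (segment ℝ (-t, t) (-t ^ β₁, t ^ β₂) ∪ segment ℝ (-t ^ β₁, t ^ β₂) (t ^ β₁, t ^ β₂) ∪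
    segment ℝ (t ^ β₁, t ^ β₂) (t, t)) ∪
  (segment ℝ (-t, -t) (-t ^ β₁, -t ^ β₂) ∪ segment ℝ (-t ^ β₁, -t ^ β₂) (t ^ β₁, -t ^ β₂) ∪
    segment ℝ (t ^ β₁, -t ^ β₂) (t, -t))

/-- The section after the saddle move: the two middle segments, which are parallel to the `x`-axis,
are replaced by the two segments parallel to the `y`-axis with the same four end points. -/
def saddleSection (β₁ β₂ t : ℝ) : Set (ℝ × ℝ) :=
  (segment ℝ (-t, t) (-t ^ β₁, t ^ β₂) ∪ segment ℝ (-t ^ β₁, t ^ β₂) (-t ^ β₁, -t ^ β₂) ∪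
    segment ℝ (-t ^ β₁, -t ^ β₂) (-t, -t)) ∪
  (segment ℝ (t, t) (t ^ β₁, t ^ β₂) ∪ segment ℝ (t ^ β₁, t ^ β₂) (t ^ β₁, -t ^ β₂) ∪
    segment ℝ (t ^ β₁, -t ^ β₂) (t, -t))

/-- The `(β₁, β₂)`-bridge in three-space. -/
def bridge (β₁ β₂ : ℝ) : Set (ℝ × ℝ × ℝ) :=
  {p | 0 ≤ p.2.2 ∧ (p.1, p.2.1) ∈ bridgeSection β₁ β₂ p.2.2}

/-- The surface in three-space that replaces the `(β₁, β₂)`-bridge in the saddle move. -/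
def saddleBridge (β₁ β₂ : ℝ) : Set (ℝ × ℝ × ℝ) :=
  {p | 0 ≤ p.2.2 ∧ (p.1, p.2.1) ∈ saddleSection β₁ β₂ p.2.2}

/-- The saddle move applied to a surface germ `X` that contains the image of the
`(β₁, β₂)`-bridge under the embedding `Θ`. -/
def saddleMove (Θ : ℝ × ℝ × ℝ → R4) (β₁ β₂ : ℝ) (X : Set R4) : Set R4 :=
  (X \ Θ '' bridge β₁ β₂) ∪ Θ '' saddleBridge β₁ β₂

/-- The embedding into `R4` of the three-dimensional cone `{|x| ≤ z, |y| ≤ z}` onto the cone over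
the slice, at each height `z = t` the rectangle with `x/t = l` and `y/t = (ρ - ρ₀)/ε`. The
coordinate `y` runs along the band, so that the bridge cuts the band across. -/
def sliceEmbedding {K : Set S3} (F : CharacteristicBand K) (Q : Slice) (p : ℝ × ℝ × ℝ) : R4 :=
  p.2.2 • (F.coord (Q.ρ₀ + Q.ε * (p.2.1 / p.2.2)) (p.1 / p.2.2) : R4)

/-- The twisted one-bridge surface germ: in the cone over the boundary of the twisted band, the part
inside the cone over the slice is replaced by the `(β₁, β₂)`-bridge. -/
def twistedGerm {K : Set S3} {F : CharacteristicBand K} (N : Thickening F) {Q : Slice} {n : ℤ}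
    (τ : TwistAngle Q n) (β₁ β₂ : ℝ) : Set R4 :=
  (cone ((Set.range fun ρ => twistedBand N τ ρ 1) ∪ Set.range fun ρ => twistedBand N τ ρ (-1)) \
    cone (Q.carrier F)) ∪ sliceEmbedding F Q '' bridge β₁ β₂

/-- The section of `X` by the sphere of radius `t`, rescaled to the unit sphere. The link at the
origin of `X` is the type of this set for all small positive `t`. -/
def linkAt (X : Set R4) (t : ℝ) : Set S3 := {σ | t • (σ : R4) ∈ X}

end MetricKnots

end

noncomputable section

namespace MetricKnots

section

/-! ### Radial projection to the sphere -/

/-! After division by the height `t`, the section of the saddle over the slice is a pair of graphs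
`|x| = r(|y|)` over the direction along the band, with `0 < r ≤ 1` and `r = 1` at the ends of the
slice. The saddle move therefore undoes the cut made by the bridge: the band is merely pinched, and
the link at radius `t` consists of the two curves `v = ± r(ρ) exp(iθ(ρ))` in the solid torus
(`linkAt_eq`), both on the torus `|v| = r(ρ)`. The exponents enter only through `t ^ (β₁ - 1)` and
`t ^ (β₂ - 1)`, which lie in `(0, 1)` for every `0 < t < 1`.

It remains to put the solid torus in standard position. It can be shrunk towards its core and
deformed to its first-order expansion along the edge `l = 1`. That edge is unknotted, so an isotopy
moves it onto a great circle, and the normal frame can then be straightened until only a sign `ε`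
(the direction of the core) and an integer `m` (the framing) are left
(`exists_isotopicOn_standard`). The two edges of the band have become toric curves of linking number
`ε m`; as the edges of a characteristic band have linking number zero, `m = 0`
(`exists_isotopicOn_standard_untwisted`). Rescaling the radius and rotating by the periodic function
`nρ - θ(ρ)` carries the torus to the Clifford torus and the two curves to `β = nα` and `β = nα + π`
(`isotopicOn_torus`). Together these form the link of type `(2, 2n)`, and their linking number is `ε
· εn = n`.

The deformations of tubes are made ambient by `isotopicOn_tube`, a metric form of isotopy extension:
a family of embeddings is cut into short time steps, each a small Lipschitz perturbation of the
previous map. Such a perturbation is extended to all of `R4` as a Lipschitz map, made homogeneous,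
and added to the identity (`exists_isotopicOn_of_near`).

These isotopies are only continuous, so the Gauss integral has to be invariant under continuous
homotopies through disjoint loops. The infinitesimal reason is that the volume form pulled back from
the sphere is closed: the variation of the integrand is a sum of derivatives along the two curves
and along the join parameter (`linkVar_eq`). Integration gives invariance under straight-line
homotopies (`linkInt_add`), and approximation by Lipschitz loops gives the general case
(`linkInt_eq_of_homotopy`). The value on toric curves is found by deforming them to two great
circles in orthogonal planes. -/

/-- The radial projection of `R4` to the sphere, with an arbitrary value at the origin. -/
def toS3 (x : R4) : S3 :=
  if h : x = 0 then ⟨EuclideanSpace.single 0 1, by simp⟩ else ⟨‖x‖⁻¹ • x, by simp [norm_smul, h]⟩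

theorem coe_toS3 {x : R4} (h : x ≠ 0) : (toS3 x : R4) = ‖x‖⁻¹ • x := by
  simp [toS3, h]

theorem S3.norm_coe (σ : S3) : ‖(σ : R4)‖ = 1 := by simp

theorem S3.coe_ne_zero (σ : S3) : (σ : R4) ≠ 0 := by
  intro h
  have := S3.norm_coe σ
  simp [h] at this

theorem toS3_coe (σ : S3) : toS3 (σ : R4) = σ := by
  apply Subtype.ext
  rw [coe_toS3 σ.coe_ne_zero]
  simp

theorem toS3_smul {c : ℝ} (hc : 0 < c) (x : R4) : toS3 (c • x) = toS3 x := by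
  by_cases h : x = 0
  · simp [h]
  · apply Subtype.ext
    rw [coe_toS3 h, coe_toS3 (smul_ne_zero hc.ne' h), norm_smul, smul_smul, Real.norm_of_nonneg hc.le]
    congr 1
    field_simp

theorem eq_smul_of_toS3_eq {x y : R4} (hx : x ≠ 0) (hy : y ≠ 0) (h : toS3 x = toS3 y) :
    x = (‖x‖ * ‖y‖⁻¹) • y := by
  have h' : (toS3 x : R4) = toS3 y := by rw [h]
  rw [coe_toS3 hx, coe_toS3 hy] at h'
  have : ‖x‖ ≠ 0 := norm_ne_zero_iff.2 hx
  rw [mul_smul, ← h', smul_smul, mul_inv_cancel₀ this, one_smul]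

/-! ### Ambient isotopies carrying one parametrization to another -/

/-- An ambient isotopy carries the map `ψ` to the map `ψ'`, on the set `S` of parameters. -/
def IsotopicOn {A : Type*} (S : Set A) (ψ ψ' : A → S3) : Prop :=
  ∃ H : unitInterval → (S3 ≃ₜ S3),
    Continuous (fun p : unitInterval × S3 => H p.1 p.2) ∧
    (∀ σ, H 0 σ = σ) ∧ ∀ a ∈ S, H 1 (ψ a) = ψ' a

section IsotopicOn

variable {A : Type*} {S S' : Set A} {ψ ψ' ψ'' : A → S3}

theorem IsotopicOn.refl (S : Set A) (ψ : A → S3) : IsotopicOn S ψ ψ :=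
  ⟨fun _ => Homeomorph.refl S3, continuous_snd, fun _ => rfl, fun _ _ => rfl⟩

theorem IsotopicOn.of_eqOn (h : ∀ a ∈ S, ψ a = ψ' a) : IsotopicOn S ψ ψ' :=
  ⟨fun _ => Homeomorph.refl S3, continuous_snd, fun _ => rfl, fun a ha => h a ha⟩

theorem IsotopicOn.trans (h : IsotopicOn S ψ ψ') (h' : IsotopicOn S ψ' ψ'') :
    IsotopicOn S ψ ψ'' := by
  obtain ⟨H, hc, h0, h1⟩ := h
  obtain ⟨H', hc', h0', h1'⟩ := h'
  refine ⟨fun s => (H s).trans (H' s), ?_, fun σ => by simp [h0, h0'], fun a ha => ?_⟩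
  · exact hc'.comp (continuous_fst.prodMk hc)
  · simp [h1 a ha, h1' a ha]

theorem IsotopicOn.mono (h : IsotopicOn S ψ ψ') (hS : S' ⊆ S) : IsotopicOn S' ψ ψ' := by
  obtain ⟨H, hc, h0, h1⟩ := h
  exact ⟨H, hc, h0, fun a ha => h1 a (hS ha)⟩

theorem IsotopicOn.comp {B : Type*} {R : Set B} (h : IsotopicOn S ψ ψ') (g : B → A)
    (hg : ∀ b ∈ R, g b ∈ S) : IsotopicOn R (ψ ∘ g) (ψ' ∘ g) := by
  obtain ⟨H, hc, h0, h1⟩ := h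
  exact ⟨H, hc, h0, fun b hb => h1 _ (hg b hb)⟩

end IsotopicOn

/-- A family of positively homogeneous bijections of `R4` induces an ambient isotopy. -/
theorem isotopicOn_of_homogeneous (f : ℝ → R4 → R4)
    (hc : Continuous (fun p : unitInterval × S3 => f p.1 p.2))
    (hhom : ∀ s ∈ Set.Icc (0 : ℝ) 1, ∀ c : ℝ, 0 < c → ∀ x, f s (c • x) = c • f s x)
    (hbij : ∀ s ∈ Set.Icc (0 : ℝ) 1, Function.Bijective (f s))
    (hid : ∀ x, f 0 x = x) {A : Type*} (S : Set A) (ψ : A → S3) :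
    IsotopicOn S ψ (fun a => toS3 (f 1 (ψ a))) := by
  have h0 : ∀ s ∈ Set.Icc (0 : ℝ) 1, f s 0 = 0 := by
    intro s hs
    have h1 := hhom s hs 2 two_pos 0
    rw [smul_zero, two_smul] at h1
    simpa using h1
  have hne : ∀ s ∈ Set.Icc (0 : ℝ) 1, ∀ x, x ≠ 0 → f s x ≠ 0 := by
    intro s hs x hx h
    exact hx ((hbij s hs).1 (h.trans (h0 s hs).symm))
  have hcont : Continuous (fun p : unitInterval × S3 => toS3 (f p.1 p.2)) := by
    rw [continuous_induced_rng]
    have : (Subtype.val ∘ fun p : unitInterval × S3 => toS3 (f p.1 p.2)) =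
        fun p : unitInterval × S3 => ‖f p.1 p.2‖⁻¹ • f p.1 p.2 := by
      funext p
      exact coe_toS3 (hne _ p.1.2 _ p.2.coe_ne_zero)
    rw [this]
    exact (hc.norm.inv₀ fun p => norm_ne_zero_iff.2 (hne _ p.1.2 _ p.2.coe_ne_zero)).smul hc
  have hbij' : ∀ s : unitInterval, Function.Bijective (fun σ : S3 => toS3 (f s σ)) := by
    intro s
    constructor
    · intro σ τ h
      have hσ := hne s s.2 σ σ.coe_ne_zero
      have hτ := hne s s.2 τ τ.coe_ne_zero
      have h1 := eq_smul_of_toS3_eq hσ hτ h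
      have hpos : 0 < ‖f s σ‖ * ‖f s τ‖⁻¹ := by
        have := norm_pos_iff.2 hσ
        have := norm_pos_iff.2 hτ
        positivity
      rw [← hhom s s.2 _ hpos] at h1
      have h2 := (hbij s s.2).1 h1
      rw [← toS3_coe σ, h2, toS3_smul hpos, toS3_coe]
    · intro τ
      obtain ⟨x, hx⟩ := (hbij s s.2).2 τ
      have hx0 : x ≠ 0 := by
        rintro rfl
        rw [h0 s s.2] at hx
        exact τ.coe_ne_zero hx.symm
      refine ⟨toS3 x, ?_⟩
      have : 0 < ‖x‖⁻¹ := by simpa using hx0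
      simp only [coe_toS3 hx0]
      rw [hhom s s.2 _ this, hx, toS3_smul this, toS3_coe]
  have hcs : ∀ s : unitInterval, Continuous (Equiv.ofBijective _ (hbij' s)) := fun s =>
    hcont.comp (continuous_const.prodMk continuous_id)
  -- Continuity of each inverse is free, because the sphere is compact and Hausdorff.
  refine ⟨fun s => (hcs s).homeoOfEquivCompactToT2, hcont, fun σ => ?_, fun a _ => rfl⟩
  change toS3 (f (0 : unitInterval) σ) = σ
  rw [Set.Icc.coe_zero, hid, toS3_coe]

/-- The perturbation `|x| e(x/|x|)` obtained from a small Lipschitz map has small Lipschitz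
constant. -/
theorem norm_homogenize_sub_le {e : R4 → R4} {M : ℝ} (hM : 0 ≤ M)
    (hl : ∀ x y, ‖e x - e y‖ ≤ M * ‖x - y‖) (hb : ∀ σ : S3, ‖e σ‖ ≤ M) (x y : R4) :
    ‖‖x‖ • e (toS3 x) - ‖y‖ • e (toS3 y)‖ ≤ 3 * M * ‖x - y‖ := by
  -- Normalizing both vectors at the scale of `y` moves `x` by at most `|‖x‖ - ‖y‖|`, which is again
  -- at most `‖x - y‖`; hence the factor 2.
  have key : ∀ x y : R4, y ≠ 0 → ‖y‖ * ‖(toS3 x : R4) - toS3 y‖ ≤ 2 * ‖x - y‖ ∨ x = 0 := by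
    intro x y hy
    by_cases hx : x = 0
    · exact Or.inr hx
    left
    have hx' : ‖x‖ ≠ 0 := norm_ne_zero_iff.2 hx
    have hy' : ‖y‖ ≠ 0 := norm_ne_zero_iff.2 hy
    rw [← Real.norm_of_nonneg (norm_nonneg y), ← norm_smul, coe_toS3 hx, coe_toS3 hy,
      smul_sub, smul_smul, smul_smul, mul_inv_cancel₀ hy', one_smul]
    have : (‖y‖ * ‖x‖⁻¹) • x - y = ((‖y‖ - ‖x‖) * ‖x‖⁻¹) • x + (x - y) := by
      rw [sub_mul, mul_inv_cancel₀ hx', sub_smul, one_smul]; abel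
    rw [this]
    refine (norm_add_le _ _).trans ?_
    rw [norm_smul, norm_mul, norm_inv, norm_norm, mul_assoc, inv_mul_cancel₀ hx', mul_one]
    have := abs_norm_sub_norm_le y x
    rw [norm_sub_rev y x] at this
    rw [Real.norm_eq_abs]; linarith
  by_cases hy : y = 0
  · subst hy
    simp only [norm_zero, zero_smul, sub_zero, norm_smul, norm_norm]
    have := hb (toS3 x)
    nlinarith [norm_nonneg x]
  rcases key x y hy with h | hx
  · have : ‖x‖ • e (toS3 x) - ‖y‖ • e (toS3 y) =
        (‖x‖ - ‖y‖) • e (toS3 x) + ‖y‖ • (e (toS3 x) - e (toS3 y)) := by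
      rw [sub_smul, smul_sub]; abel
    rw [this]
    refine (norm_add_le _ _).trans ?_
    rw [norm_smul, norm_smul, norm_norm, Real.norm_eq_abs]
    have h1 := abs_norm_sub_norm_le x y
    have h2 := hb (toS3 x)
    have h3 := hl (toS3 x) (toS3 y)
    have h4 : |‖x‖ - ‖y‖| * ‖e (toS3 x)‖ ≤ ‖x - y‖ * M :=
      mul_le_mul h1 h2 (norm_nonneg _) (norm_nonneg _)
    have h5 : ‖y‖ * ‖e (toS3 x) - e (toS3 y)‖ ≤ M * (2 * ‖x - y‖) := by
      calc _ ≤ ‖y‖ * (M * ‖(toS3 x : R4) - toS3 y‖) := by gcongr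
        _ = M * (‖y‖ * ‖(toS3 x : R4) - toS3 y‖) := by ring
        _ ≤ _ := by gcongr
    linarith
  · subst hx
    simp only [norm_zero, zero_smul, zero_sub, norm_neg, norm_smul, norm_norm]
    have := hb (toS3 y)
    nlinarith [norm_nonneg y]

/-- A map that is a small Lipschitz perturbation of `ψ` is ambient isotopic to `ψ`. -/
theorem exists_isotopicOn_of_near : ∃ κ : ℝ, 0 < κ ∧ ∀ {A : Type} (S : Set A) (ψ ψ' : A → S3),
    (∀ a ∈ S, ‖(ψ' a : R4) - ψ a‖ ≤ κ) →
    (∀ a ∈ S, ∀ b ∈ S, ‖((ψ' a : R4) - ψ a) - (ψ' b - ψ b)‖ ≤ κ * ‖(ψ a : R4) - ψ b‖) →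
    IsotopicOn S ψ ψ' := by
  set C : NNReal := lipschitzExtensionConstant R4 with hC
  have hCpos : 0 < C := lipschitzExtensionConstant_pos R4
  -- Lipschitz extension to `R4` costs the factor `C`, and the bound on the sphere, of diameter 2,
  -- costs `2C + 1`. With this choice both constants are at most `1/6`, so the homogenized
  -- perturbation, three times worse, is `1/2`-Lipschitz.
  set κ : NNReal := 1 / (6 * (2 * C + 1)) with hκ
  have hκpos : 0 < κ := by positivity
  refine ⟨κ, by exact_mod_cast hκpos, fun {A} S ψ ψ' h1 h2 => ?_⟩
  rcases S.eq_empty_or_nonempty with rfl | ⟨a₀, ha₀⟩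
  · exact IsotopicOn.of_eqOn (by simp)
  -- The displacement is a function of the point `ψ a` alone: parameters with the same image under
  -- `ψ` have the same displacement, by the Lipschitz hypothesis with right-hand side zero.
  have hD : ∃ D : R4 → R4, ∀ a ∈ S, D (ψ a) = ψ' a - ψ a := by
    classical
    refine ⟨fun x => if h : ∃ a ∈ S, (ψ a : R4) = x then ψ' h.choose - ψ h.choose else 0, ?_⟩
    intro a ha
    have h : ∃ b ∈ S, (ψ b : R4) = ψ a := ⟨a, ha, rfl⟩
    simp only [dif_pos h]
    have h3 := h2 h.choose h.choose_spec.1 a ha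
    rw [h.choose_spec.2, sub_self, norm_zero, mul_zero] at h3
    have h4 := norm_le_zero_iff.1 h3
    rw [← sub_eq_zero.1 h4]
    exact congrArg (fun z => (ψ' h.choose : R4) - z) h.choose_spec.2
  obtain ⟨D, hD⟩ := hD
  have hDl : LipschitzOnWith κ D ((fun a => (ψ a : R4)) '' S) := by
    apply LipschitzOnWith.of_dist_le_mul
    rintro _ ⟨a, ha, rfl⟩ _ ⟨b, hb, rfl⟩
    rw [dist_eq_norm, dist_eq_norm]
    simp only [hD a ha, hD b hb]
    exact h2 a ha b hb
  obtain ⟨e, hel, heq⟩ := hDl.extend_finite_dimension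
  rw [← hC] at hel
  have heS : ∀ a ∈ S, e (ψ a) = ψ' a - ψ a := fun a ha => by
    rw [← hD a ha]; exact (heq ⟨a, ha, rfl⟩).symm
  set M : ℝ := (2 * C + 1) * κ with hM
  have hM6 : M = 1 / 6 := by
    rw [hM, hκ]; push_cast
    have : (0 : ℝ) < C := by exact_mod_cast hCpos
    field_simp
  have hl : ∀ x y, ‖e x - e y‖ ≤ M * ‖x - y‖ := by
    intro x y
    have := hel.dist_le_mul x y
    rw [dist_eq_norm, dist_eq_norm] at this
    refine this.trans ?_
    gcongr
    push_cast
    have : (0 : ℝ) ≤ C := C.2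
    have : (0 : ℝ) ≤ κ := κ.2
    nlinarith
  have hb : ∀ σ : S3, ‖e σ‖ ≤ M := by
    intro σ
    have h3 := hel.dist_le_mul σ (ψ a₀)
    rw [dist_eq_norm, dist_eq_norm] at h3
    have h4 := h1 a₀ ha₀
    rw [← heS a₀ ha₀] at h4
    have h5 : ‖e σ‖ ≤ ‖e σ - e (ψ a₀)‖ + ‖e (ψ a₀)‖ := by
      simpa using norm_add_le (e σ - e (ψ a₀)) (e (ψ a₀))
    have h6 : ‖(σ : R4) - ψ a₀‖ ≤ 2 := by
      refine (norm_sub_le _ _).trans ?_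
      rw [S3.norm_coe, S3.norm_coe]; norm_num
    have h7 : ((C * κ : NNReal) : ℝ) * ‖(σ : R4) - ψ a₀‖ ≤ (C * κ : NNReal) * 2 := by gcongr
    rw [hM]
    push_cast at *
    linarith
  set p : R4 → R4 := fun x => ‖x‖ • e (toS3 x) with hp
  have hpl : ∀ x y, ‖p x - p y‖ ≤ 1 / 2 * ‖x - y‖ := by
    intro x y
    refine (norm_homogenize_sub_le (by rw [hM6]; norm_num) hl hb x y).trans (le_of_eq ?_)
    rw [hM6]; norm_num
  have hpc : Continuous p := by
    have : LipschitzWith (1 / 2) p := LipschitzWith.of_dist_le_mul fun x y => by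
      rw [dist_eq_norm, dist_eq_norm]; simpa using hpl x y
    exact this.continuous
  have hpS : ∀ σ : S3, p σ = e σ := fun σ => by simp [hp, toS3_coe]
  have hiso := isotopicOn_of_homogeneous (fun s x => x + s • p x) (by fun_prop)
    (fun s _ c hc x => by
      simp only [hp, toS3_smul hc, norm_smul, Real.norm_of_nonneg hc.le]
      rw [smul_add, smul_smul, smul_smul, smul_smul]; ring_nf)
    (fun s hs => ?_) (fun x => by simp) S ψ
  · refine hiso.trans (IsotopicOn.of_eqOn fun a ha => ?_)
    simp only [one_smul, hpS, heS a ha]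
    rw [add_sub_cancel, toS3_coe]
  -- A perturbation of the identity with Lipschitz constant `1/2 < 1` is bijective, by the
  -- quantitative inverse function theorem.
  · have hA : ApproximatesLinearOn (fun x => x + s • p x)
        ((ContinuousLinearEquiv.refl ℝ R4 : R4 ≃L[ℝ] R4) : R4 →L[ℝ] R4) Set.univ (1 / 2) := by
      intro x _ y _
      have : x + s • p x - (y + s • p y) -
          ((ContinuousLinearEquiv.refl ℝ R4 : R4 ≃L[ℝ] R4) : R4 →L[ℝ] R4) (x - y) =
          s • (p x - p y) := by
        simp only [ContinuousLinearEquiv.coe_refl, ContinuousLinearMap.id_apply, smul_sub]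
        abel
      rw [this, norm_smul, Real.norm_of_nonneg hs.1]
      have := hpl x y
      have h3 : s * ‖p x - p y‖ ≤ 1 * ‖p x - p y‖ := by gcongr; exact hs.2
      push_cast
      linarith
    have hlt : Subsingleton R4 ∨ (1 / 2 : NNReal) <
        ‖((ContinuousLinearEquiv.refl ℝ R4).symm : R4 →L[ℝ] R4)‖₊⁻¹ := by
      right
      have : ‖((ContinuousLinearEquiv.refl ℝ R4).symm : R4 →L[ℝ] R4)‖₊ = 1 := by
        simp
      rw [this, inv_one]
      exact NNReal.half_lt_self one_ne_zero
    exact ⟨Set.injOn_univ.1 (hA.injOn hlt), hA.surjective hlt⟩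

/-- A family of maps whose increments are small Lipschitz perturbations is an ambient isotopy. -/
theorem isotopicOn_of_family {A : Type} (S : Set A) (φ : ℝ → A → S3)
    (h : ∀ κ : ℝ, 0 < κ → ∃ η > 0, ∀ s ∈ Set.Icc (0 : ℝ) 1, ∀ s' ∈ Set.Icc (0 : ℝ) 1,
      |s - s'| ≤ η →
      (∀ a ∈ S, ‖(φ s' a : R4) - φ s a‖ ≤ κ) ∧
      ∀ a ∈ S, ∀ b ∈ S, ‖((φ s' a : R4) - φ s a) - (φ s' b - φ s b)‖ ≤
        κ * ‖(φ s a : R4) - φ s b‖) :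
    IsotopicOn S (φ 0) (φ 1) := by
  -- The threshold `κ` depends neither on the parameter set nor on the maps, so a single `η` serves
  -- all times and finitely many steps of length `1 / N` reach time 1.
  obtain ⟨κ, hκ, hnear⟩ := exists_isotopicOn_of_near
  obtain ⟨η, hη, hfam⟩ := h κ hκ
  obtain ⟨N, hN⟩ := exists_nat_gt (1 / η)
  have hNpos : (0 : ℝ) < N := lt_trans (by positivity) hN
  have key : ∀ k : ℕ, k ≤ N → IsotopicOn S (φ 0) (φ (k / N)) := by
    intro k
    induction k with
    | zero => intro _; simpa using IsotopicOn.refl S (φ 0)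
    | succ k ih =>
      intro hk
      have hk' : (k : ℝ) + 1 ≤ N := by exact_mod_cast hk
      refine (ih (by omega)).trans ?_
      obtain ⟨h1, h2⟩ := hfam (k / N) ⟨by positivity, by rw [div_le_one hNpos]; linarith⟩
        ((k + 1 : ℕ) / N) ⟨by positivity, by rw [div_le_one hNpos]; push_cast; linarith⟩ (by
          rw [← sub_div, abs_div, abs_of_pos hNpos]
          push_cast
          rw [show (k : ℝ) - (k + 1) = -1 by ring, abs_neg, abs_one]
          rw [div_lt_iff₀ hη] at hN
          rw [div_le_iff₀ hNpos]; linarith)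
      exact hnear S _ _ h1 h2
  have := key N le_rfl
  rwa [div_self hNpos.ne'] at this

end

section

/-! ### Isotopies of thickened curves -/

/-- The solid tube of radius `r` in the coordinates `(ρ, v)`. -/
def tube (r : ℝ) : Set (ℝ × ℂ) := {p | ‖p.2‖ ≤ r}

/-- At time `s` and parameter `p`, the family `W` of maps to `R4`, followed by the radial projection
to the sphere, is an immersion. -/
def ImmersiveAt (W : ℝ × (ℝ × ℂ) → R4) (s : ℝ) (p : ℝ × ℂ) : Prop :=
  ∀ (a : ℝ) (h : ℝ × ℂ), a • W (s, p) + fderiv ℝ W (s, p) (0, h) = 0 → a = 0 ∧ h = 0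

theorem ImmersiveAt.ne_zero {W : ℝ × (ℝ × ℂ) → R4} {s : ℝ} {p : ℝ × ℂ} (h : ImmersiveAt W s p) :
    W (s, p) ≠ 0 := by
  intro h0
  have := (h 1 0 (by rw [h0, smul_zero, zero_add]; exact map_zero _)).1
  exact one_ne_zero this

theorem continuousAt_toS3 {x : R4} (hx : x ≠ 0) : ContinuousAt toS3 x := by
  rw [Topology.IsInducing.subtypeVal.continuousAt_iff]
  have : (Subtype.val ∘ toS3) =ᶠ[𝓝 x] fun y => ‖y‖⁻¹ • y := by
    filter_upwards [isOpen_ne.mem_nhds hx] with y hy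
    exact coe_toS3 hy
  refine ContinuousAt.congr ?_ this.symm
  exact (continuousAt_id.norm.inv₀ (norm_ne_zero_iff.2 hx)).smul continuousAt_id

/-- The map `(x, s, p) ↦ (s, x W(s, p))` has injective derivative exactly because of immersivity:
the extra scalar `x` accounts for the radial direction, and the retained coordinate `s` makes the
bound uniform in time. Strict differentiability turns injectivity into a lower Lipschitz bound, and
the choice `x = ‖W‖⁻¹` recovers the projected map. -/
theorem ImmersiveAt.eventually_lower {W : ℝ × (ℝ × ℂ) → R4} (hW : ContDiff ℝ 1 W) {s : ℝ}
    {p : ℝ × ℂ} (h : ImmersiveAt W s p) :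
    ∃ c > 0, ∀ᶠ q in 𝓝 (s, p, p), c * ‖q.2.1 - q.2.2‖ ≤
      ‖(toS3 (W (q.1, q.2.1)) : R4) - toS3 (W (q.1, q.2.2))‖ := by
  have h0 := h.ne_zero
  let G : ℝ × (ℝ × (ℝ × ℂ)) → ℝ × R4 := fun x => (x.2.1, x.1 • W x.2)
  have hG : ContDiff ℝ 1 G := by fun_prop
  set τ : ℝ := ‖W (s, p)‖⁻¹ with hτ
  have hτ0 : τ ≠ 0 := inv_ne_zero (norm_ne_zero_iff.2 h0)
  set x₀ : ℝ × (ℝ × (ℝ × ℂ)) := (τ, s, p) with hx₀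
  have hs : HasStrictFDerivAt G (fderiv ℝ G x₀) x₀ := (hG.contDiffAt).hasStrictFDerivAt one_ne_zero
  have hL : ∀ y, fderiv ℝ G x₀ y = (y.2.1, τ • fderiv ℝ W (s, p) y.2 + y.1 • W (s, p)) := by
    intro y
    have hWd : HasFDerivAt W (fderiv ℝ W (s, p)) (s, p) :=
      (hW.differentiable one_ne_zero _).hasFDerivAt
    have h1 : HasFDerivAt (fun x : ℝ × (ℝ × (ℝ × ℂ)) => W x.2)
        ((fderiv ℝ W (s, p)).comp (ContinuousLinearMap.snd ℝ ℝ (ℝ × (ℝ × ℂ)))) x₀ :=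
      HasFDerivAt.comp x₀ (f := Prod.snd) (g := W) hWd hasFDerivAt_snd
    have h2 : HasFDerivAt (fun x : ℝ × (ℝ × (ℝ × ℂ)) => x.2.1) _ x₀ :=
      (hasFDerivAt_snd (𝕜 := ℝ) (p := x₀)).fst
    have h3 := h2.prodMk ((hasFDerivAt_fst (𝕜 := ℝ) (p := x₀)).smul h1)
    have h4 : fderiv ℝ G x₀ = _ := HasFDerivAt.fderiv (f := G) h3
    rw [h4]
    simp [hx₀]
  have hinj : Function.Injective (fderiv ℝ G x₀) := by
    rw [injective_iff_map_eq_zero]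
    rintro ⟨a, b, y⟩ hy
    rw [hL] at hy
    simp only [Prod.mk_eq_zero] at hy
    obtain ⟨rfl, hy⟩ := hy
    have h5 := h (a / τ) y (by
      rw [add_comm]
      have := congrArg (fun z => τ⁻¹ • z) hy
      simp only [smul_add, smul_smul, inv_mul_cancel₀ hτ0, one_smul, smul_zero] at this
      rw [div_eq_inv_mul]; exact this)
    have h6 : a = 0 := by
      rcases div_eq_zero_iff.1 h5.1 with h7 | h7
      · exact h7
      · exact absurd h7 hτ0
    simp [h6, h5.2]
  obtain ⟨K, hK, hanti⟩ := (fderiv ℝ G x₀).toLinearMap.exists_antilipschitzWith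
    (LinearMap.ker_eq_bot.2 hinj)
  have hK' : (0 : ℝ) < K := by exact_mod_cast hK
  have hlow : ∀ y, (K : ℝ)⁻¹ * ‖y‖ ≤ ‖fderiv ℝ G x₀ y‖ := by
    intro y
    have := hanti.le_mul_dist y 0
    simp only [dist_zero_right, map_zero, ContinuousLinearMap.coe_coe] at this
    rw [inv_mul_le_iff₀ hK']; exact this
  refine ⟨(K : ℝ)⁻¹ / 2, by positivity, ?_⟩
  have hev := hs.isLittleO.def (c := (K : ℝ)⁻¹ / 2) (by positivity)
  have hcont : ContinuousAt (fun q : ℝ × (ℝ × ℂ) × (ℝ × ℂ) =>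
      (((‖W (q.1, q.2.1)‖⁻¹, q.1, q.2.1) : ℝ × (ℝ × (ℝ × ℂ))),
        ((‖W (q.1, q.2.2)‖⁻¹, q.1, q.2.2) : ℝ × (ℝ × (ℝ × ℂ))))) (s, p, p) := by
    have hWc := hW.continuous
    have h1 : ContinuousAt (fun q : ℝ × (ℝ × ℂ) × (ℝ × ℂ) => ‖W (q.1, q.2.1)‖⁻¹) (s, p, p) :=
      ContinuousAt.inv₀ (by fun_prop) (norm_ne_zero_iff.2 h0)
    have h2 : ContinuousAt (fun q : ℝ × (ℝ × ℂ) × (ℝ × ℂ) => ‖W (q.1, q.2.2)‖⁻¹) (s, p, p) :=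
      ContinuousAt.inv₀ (by fun_prop) (norm_ne_zero_iff.2 h0)
    exact (h1.prodMk (by fun_prop)).prodMk (h2.prodMk (by fun_prop))
  have hne1 : ∀ᶠ q : ℝ × (ℝ × ℂ) × (ℝ × ℂ) in 𝓝 (s, p, p), W (q.1, q.2.1) ≠ 0 := by
    have hWc := hW.continuous
    exact ContinuousAt.eventually_ne (by fun_prop) h0
  have hne2 : ∀ᶠ q : ℝ × (ℝ × ℂ) × (ℝ × ℂ) in 𝓝 (s, p, p), W (q.1, q.2.2) ≠ 0 := by
    have hWc := hW.continuous
    exact ContinuousAt.eventually_ne (by fun_prop) h0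
  filter_upwards [hcont.eventually hev, hne1, hne2] with q hq hq1 hq2
  set x : ℝ × (ℝ × (ℝ × ℂ)) := (‖W (q.1, q.2.1)‖⁻¹, q.1, q.2.1) with hx
  set y : ℝ × (ℝ × (ℝ × ℂ)) := (‖W (q.1, q.2.2)‖⁻¹, q.1, q.2.2) with hy
  have h1 := hlow (x - y)
  have h2 : ‖fderiv ℝ G x₀ (x - y)‖ ≤ ‖G x - G y‖ + ‖G x - G y - fderiv ℝ G x₀ (x - y)‖ := by
    have := norm_sub_le (G x - G y) (G x - G y - fderiv ℝ G x₀ (x - y))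
    simpa using this
  have h3 : ‖G x - G y‖ = ‖(toS3 (W (q.1, q.2.1)) : R4) - toS3 (W (q.1, q.2.2))‖ := by
    have : G x - G y = (0, (toS3 (W (q.1, q.2.1)) : R4) - toS3 (W (q.1, q.2.2))) := by
      rw [coe_toS3 hq1, coe_toS3 hq2]
      simp [G, hx, hy]
    rw [this, Prod.norm_mk, norm_zero]
    exact max_eq_right (norm_nonneg _)
  have h4 : ‖q.2.1 - q.2.2‖ ≤ ‖x - y‖ :=
    (norm_snd_le (x - y).2).trans (norm_snd_le (x - y))
  rw [← h3]
  have h5 : (K : ℝ)⁻¹ / 2 * ‖q.2.1 - q.2.2‖ ≤ (K : ℝ)⁻¹ / 2 * ‖x - y‖ := by gcongr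
  linarith

theorem exists_int_near (x : ℝ) : ∃ k : ℤ, |x - k * (2 * Real.pi)| ≤ Real.pi := by
  have hpi := Real.pi_pos
  refine ⟨round (x / (2 * Real.pi)), ?_⟩
  have h := abs_sub_round (x / (2 * Real.pi))
  have : x - round (x / (2 * Real.pi)) * (2 * Real.pi) =
      (x / (2 * Real.pi) - round (x / (2 * Real.pi))) * (2 * Real.pi) := by
    field_simp
  rw [this, abs_mul, abs_of_pos (by positivity : (0 : ℝ) < 2 * Real.pi)]
  nlinarith

section Family

variable {W : ℝ × (ℝ × ℂ) → R4} {r R : ℝ}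

/-- Shifting the angle of a point of the tube by `k` full turns. -/
def shift (k : ℤ) (p : ℝ × ℂ) : ℝ × ℂ := (p.1 + k * (2 * Real.pi), p.2)

theorem apply_shift
    (hper : ∀ s ∈ Set.Icc (0 : ℝ) 1, ∀ ρ : ℝ, ∀ v : ℂ, ‖v‖ ≤ R →
      W (s, ρ + 2 * Real.pi, v) = W (s, ρ, v))
    {s : ℝ} (hs : s ∈ Set.Icc (0 : ℝ) 1) {p : ℝ × ℂ} (hp : ‖p.2‖ ≤ R) (k : ℤ) :
    W (s, shift k p) = W (s, p) := by
  have h : Function.Periodic (fun ρ => W (s, ρ, p.2)) (2 * Real.pi) := fun ρ => hper s hs ρ p.2 hp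
  exact h.int_mul k p.1

/-- A compactness argument. A sequence of counterexamples on shrinking neighbourhoods of the tube of
radius `r` converges to a pair of points in that tube itself, where injectivity makes the two limits
equal and the local lower bound applies. Hence the hypotheses are needed at radius `r` only, while
the conclusion holds on a larger tube inside radius `R`; with `r = 0` it is enough to look at the
core. -/
theorem exists_lower_bound (hW : ContDiff ℝ 1 W) 
    (hper : ∀ s ∈ Set.Icc (0 : ℝ) 1, ∀ ρ : ℝ, ∀ v : ℂ, ‖v‖ ≤ R →
      W (s, ρ + 2 * Real.pi, v) = W (s, ρ, v))
    (hinj : ∀ s ∈ Set.Icc (0 : ℝ) 1, ∀ p q : ℝ × ℂ, ‖p.2‖ ≤ r → ‖q.2‖ ≤ r →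
      toS3 (W (s, p)) = toS3 (W (s, q)) → p.2 = q.2 ∧ ∃ k : ℤ, q.1 = p.1 + 2 * Real.pi * k)
    (himm : ∀ s ∈ Set.Icc (0 : ℝ) 1, ∀ p : ℝ × ℂ, ‖p.2‖ ≤ r → ImmersiveAt W s p) :
    ∃ c > 0, ∃ δ > 0, ∀ s ∈ Set.Icc (0 : ℝ) 1, ∀ p ∈ tube (min R (r + δ)),
      ∀ q ∈ tube (min R (r + δ)), W (s, p) ≠ 0 ∧ ∃ k : ℤ, |p.1 - (shift k q).1| ≤ Real.pi ∧
        c * ‖p - shift k q‖ ≤ ‖(toS3 (W (s, p)) : R4) - toS3 (W (s, q))‖ := by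
  by_contra hcon
  -- Shifting by full turns brings the angle of `p` into `[0, 2π]` and that of `q` to within `π` of
  -- it, which explains the interval `[-π, 3π]`.
  have hbad : ∀ n : ℕ, ∃ (s : ℝ) (p q : ℝ × ℂ), s ∈ Set.Icc (0 : ℝ) 1 ∧
      p ∈ Set.Icc (-Real.pi) (3 * Real.pi) ×ˢ Metric.closedBall (0 : ℂ) R ∧
      q ∈ Set.Icc (-Real.pi) (3 * Real.pi) ×ˢ Metric.closedBall (0 : ℂ) R ∧
      ‖p.2‖ ≤ r + 1 / ((n : ℝ) + 1) ∧ ‖q.2‖ ≤ r + 1 / ((n : ℝ) + 1) ∧ |p.1 - q.1| ≤ Real.pi ∧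
      (W (s, p) ≠ 0 → ‖(toS3 (W (s, p)) : R4) - toS3 (W (s, q))‖ <
        1 / ((n : ℝ) + 1) * ‖p - q‖) := by
    intro n
    by_contra hn
    have hpos : (0 : ℝ) < 1 / ((n : ℝ) + 1) := by positivity
    refine hcon ⟨1 / ((n : ℝ) + 1), hpos, 1 / ((n : ℝ) + 1), hpos, fun s hs p hp q hq => ?_⟩
    by_contra h
    apply hn
    obtain ⟨hp1, hp2⟩ := le_min_iff.1 (show ‖p.2‖ ≤ _ from hp)
    obtain ⟨hq1, hq2⟩ := le_min_iff.1 (show ‖q.2‖ ≤ _ from hq)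
    obtain ⟨j, hj⟩ := exists_int_near (Real.pi - p.1)
    obtain ⟨k, hk⟩ := exists_int_near (p.1 - q.1)
    have hpi := Real.pi_pos
    have e1 : (shift j p).1 = p.1 + j * (2 * Real.pi) := rfl
    have e2 : (shift (j + k) q).1 = q.1 + (j + k) * (2 * Real.pi) := by simp [shift]
    have hj' := abs_le.1 hj
    have hk' := abs_le.1 hk
    have e3 : p - shift k q = shift j p - shift (j + k) q := by
      ext1
      · simp only [Prod.fst_sub, e1, e2]
        simp only [shift]; ring
      · rfl
    refine ⟨s, shift j p, shift (j + k) q, hs, ⟨⟨?_, ?_⟩, ?_⟩, ⟨⟨?_, ?_⟩, ?_⟩, hp2, hq2, ?_, ?_⟩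
    · rw [e1]; linarith
    · rw [e1]; linarith
    · exact mem_closedBall_zero_iff.2 hp1
    · rw [e2]; linarith
    · rw [e2]; linarith
    · exact mem_closedBall_zero_iff.2 hq1
    · rw [e1, e2, abs_le]; constructor <;> linarith
    · rw [apply_shift hper hs hp1, apply_shift hper hs hq1]
      intro hne
      by_contra hlt
      push Not at hlt
      refine h ⟨hne, k, ?_, ?_⟩
      · rw [abs_le]; simp only [shift]; constructor <;> linarith
      · rw [e3]; exact hlt
  choose s p q hs hp hq hpr hqr hpq hlt using hbad
  have hcomp : IsCompact (Set.Icc (0 : ℝ) 1 ×ˢ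
      ((Set.Icc (-Real.pi) (3 * Real.pi) ×ˢ Metric.closedBall (0 : ℂ) R) ×ˢ
        (Set.Icc (-Real.pi) (3 * Real.pi) ×ˢ Metric.closedBall (0 : ℂ) R))) :=
    isCompact_Icc.prod ((isCompact_Icc.prod (isCompact_closedBall _ _)).prod
      (isCompact_Icc.prod (isCompact_closedBall _ _)))
  obtain ⟨⟨s₀, p₀, q₀⟩, hmem, φ, hφ, hlim⟩ := hcomp.tendsto_subseq
    (x := fun n => (s n, p n, q n)) (fun n => ⟨hs n, hp n, hq n⟩)
  have hs₀ : s₀ ∈ Set.Icc (0 : ℝ) 1 := hmem.1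
  have hls : Filter.Tendsto (fun n => s (φ n)) Filter.atTop (𝓝 s₀) :=
    (continuous_fst.tendsto _).comp hlim
  have hlp : Filter.Tendsto (fun n => p (φ n)) Filter.atTop (𝓝 p₀) :=
    ((continuous_fst.comp continuous_snd).tendsto _).comp hlim
  have hlq : Filter.Tendsto (fun n => q (φ n)) Filter.atTop (𝓝 q₀) :=
    ((continuous_snd.comp continuous_snd).tendsto _).comp hlim
  have hl1 : Filter.Tendsto (fun n => 1 / ((φ n : ℝ) + 1)) Filter.atTop (𝓝 0) :=
    (tendsto_one_div_add_atTop_nhds_zero_nat (𝕜 := ℝ)).comp hφ.tendsto_atTop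
  have hp₀ : ‖p₀.2‖ ≤ r := by
    have := le_of_tendsto_of_tendsto' ((continuous_norm.comp continuous_snd).tendsto _ |>.comp hlp)
      (hl1.const_add r) (fun n => hpr (φ n))
    simpa using this
  have hq₀ : ‖q₀.2‖ ≤ r := by
    have := le_of_tendsto_of_tendsto' ((continuous_norm.comp continuous_snd).tendsto _ |>.comp hlq)
      (hl1.const_add r) (fun n => hqr (φ n))
    simpa using this
  have hWp := (himm s₀ hs₀ p₀ hp₀).ne_zero
  have hWq := (himm s₀ hs₀ q₀ hq₀).ne_zero
  have hcW := hW.continuous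
  have hlWp : Filter.Tendsto (fun n => W (s (φ n), p (φ n))) Filter.atTop (𝓝 (W (s₀, p₀))) :=
    (hcW.tendsto _).comp (hls.prodMk_nhds hlp)
  have hlWq : Filter.Tendsto (fun n => W (s (φ n), q (φ n))) Filter.atTop (𝓝 (W (s₀, q₀))) :=
    (hcW.tendsto _).comp (hls.prodMk_nhds hlq)
  have hevne : ∀ᶠ n in Filter.atTop, W (s (φ n), p (φ n)) ≠ 0 := hlWp.eventually_ne hWp
  have heq : toS3 (W (s₀, p₀)) = toS3 (W (s₀, q₀)) := by
    have h1 : Filter.Tendsto (fun n => ‖(toS3 (W (s (φ n), p (φ n))) : R4) -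
        toS3 (W (s (φ n), q (φ n)))‖) Filter.atTop
        (𝓝 ‖(toS3 (W (s₀, p₀)) : R4) - toS3 (W (s₀, q₀))‖) :=
      (((continuous_subtype_val.tendsto _).comp ((continuousAt_toS3 hWp).tendsto.comp hlWp)).sub
        ((continuous_subtype_val.tendsto _).comp
          ((continuousAt_toS3 hWq).tendsto.comp hlWq))).norm
    have h2 := hl1.mul (hlp.sub hlq).norm
    rw [zero_mul] at h2
    have h3 := le_of_tendsto_of_tendsto h1 h2
      (by filter_upwards [hevne] with n hn using (hlt (φ n) hn).le)
    exact Subtype.ext (sub_eq_zero.1 (norm_le_zero_iff.1 h3))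
  obtain ⟨h2, k, hk⟩ := hinj s₀ hs₀ p₀ q₀ hp₀ hq₀ heq
  have hpi := Real.pi_pos
  have habs : |p₀.1 - q₀.1| ≤ Real.pi := by
    have := le_of_tendsto' (((continuous_fst.tendsto _).comp hlp).sub
      ((continuous_fst.tendsto _).comp hlq)).abs (fun n => hpq (φ n))
    simpa using this
  -- The limits differ by `2πk` in angle, but by at most `π`.
  have hk0 : k = 0 := by
    rw [hk, show p₀.1 - (p₀.1 + 2 * Real.pi * k) = -(2 * Real.pi * k) by ring, abs_neg, abs_mul,
      abs_of_pos (by positivity : (0 : ℝ) < 2 * Real.pi)] at habs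
    have h3 : |(k : ℝ)| < 1 := by nlinarith
    have h4 : |k| < 1 := by exact_mod_cast h3
    exact Int.abs_lt_one_iff.1 h4
  have hpq₀ : q₀ = p₀ := by
    ext1
    · rw [hk, hk0]; simp
    · exact h2.symm
  obtain ⟨c, hc, hev⟩ := (himm s₀ hs₀ p₀ hp₀).eventually_lower hW
  rw [hpq₀] at hlim
  have hsmall : ∀ᶠ n in Filter.atTop, 1 / ((φ n : ℝ) + 1) < c := hl1.eventually_lt_const hc
  obtain ⟨n, hn1, hn2, hn3⟩ := ((hlim.eventually hev).and (hevne.and hsmall)).exists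
  have h5 := hlt (φ n) hn2
  simp only [Function.comp] at hn1
  have h6 := norm_nonneg (p (φ n) - q (φ n))
  nlinarith

/-- For nearby times the difference of the two projected maps has small derivative, by uniform
continuity on a compact set of parameters. The mean value inequality bounds its increments by the
distance of parameters, and `exists_lower_bound` converts this into distance on the sphere, which is
the input of `isotopicOn_of_family`. -/
theorem isotopicOn_tube (hW : ContDiff ℝ 1 W) 
    (hper : ∀ s ∈ Set.Icc (0 : ℝ) 1, ∀ ρ : ℝ, ∀ v : ℂ, ‖v‖ ≤ R →
      W (s, ρ + 2 * Real.pi, v) = W (s, ρ, v))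
    (hinj : ∀ s ∈ Set.Icc (0 : ℝ) 1, ∀ p q : ℝ × ℂ, ‖p.2‖ ≤ r → ‖q.2‖ ≤ r →
      toS3 (W (s, p)) = toS3 (W (s, q)) → p.2 = q.2 ∧ ∃ k : ℤ, q.1 = p.1 + 2 * Real.pi * k)
    (himm : ∀ s ∈ Set.Icc (0 : ℝ) 1, ∀ p : ℝ × ℂ, ‖p.2‖ ≤ r → ImmersiveAt W s p) :
    ∃ δ > 0, IsotopicOn (tube (min R (r + δ))) (fun p => toS3 (W (0, p)))
      (fun p => toS3 (W (1, p))) := by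
  obtain ⟨c, hc, δ, hδ, hlow⟩ := exists_lower_bound hW hper hinj himm
  refine ⟨δ, hδ, ?_⟩
  set R' := min R (r + δ) with hR'
  set Z : Set (ℝ × ℂ) := Set.Icc (-Real.pi) (3 * Real.pi) ×ˢ Metric.closedBall (0 : ℂ) R' with hZ
  have hZt : ∀ p ∈ Z, p ∈ tube R' := fun p hp => by simpa [tube] using hp.2
  have hZc : IsCompact Z := isCompact_Icc.prod (isCompact_closedBall _ _)
  have hZconv : Convex ℝ Z := (convex_Icc _ _).prod (convex_closedBall _ _)
  have hne : ∀ x ∈ Set.Icc (0 : ℝ) 1 ×ˢ Z, W x ≠ 0 := fun x hx =>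
    (hlow x.1 hx.1 x.2 (hZt _ hx.2) x.2 (hZt _ hx.2)).1
  let Φ : ℝ × (ℝ × ℂ) → R4 := fun x => ‖W x‖⁻¹ • W x
  have hΦ : ∀ x, W x ≠ 0 → ContDiffAt ℝ 1 Φ x := fun x hx =>
    ((hW.contDiffAt.norm ℝ hx).inv (norm_ne_zero_iff.2 hx)).smul hW.contDiffAt
  let D : ℝ × (ℝ × ℂ) → (ℝ × ℂ) →L[ℝ] R4 := fun x =>
    (fderiv ℝ Φ x).comp (ContinuousLinearMap.inr ℝ ℝ (ℝ × ℂ))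
  have hDc : ContinuousOn D (Set.Icc (0 : ℝ) 1 ×ˢ Z) := by
    intro x hx
    apply ContinuousAt.continuousWithinAt
    exact ((hΦ x (hne x hx)).continuousAt_fderiv one_ne_zero).clm_comp continuousAt_const
  have hΦc : ContinuousOn Φ (Set.Icc (0 : ℝ) 1 ×ˢ Z) := fun x hx =>
    (hΦ x (hne x hx)).continuousAt.continuousWithinAt
  have hcK := isCompact_Icc (a := (0 : ℝ)) (b := 1) |>.prod hZc
  have hDu := Metric.uniformContinuousOn_iff_le.1 (hcK.uniformContinuousOn_of_continuous hDc)
  have hΦu := Metric.uniformContinuousOn_iff_le.1 (hcK.uniformContinuousOn_of_continuous hΦc)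
  refine isotopicOn_of_family (tube R') (fun s p => toS3 (W (s, p))) fun κ hκ => ?_
  -- The factor `c` is used up when distances of parameters are replaced by distances on the sphere.
  obtain ⟨η₁, hη₁, h₁⟩ := hDu (κ * c) (by positivity)
  obtain ⟨η₂, hη₂, h₂⟩ := hΦu κ hκ
  refine ⟨min η₁ η₂, by positivity, fun s hs s' hs' hss => ?_⟩
  have hdist : ∀ p : ℝ × ℂ, dist (s', p) (s, p) ≤ min η₁ η₂ := fun p => by
    rw [Prod.dist_eq, dist_self, Real.dist_eq, abs_sub_comm]
    exact max_le hss (by positivity)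
  have hcoe : ∀ s ∈ Set.Icc (0 : ℝ) 1, ∀ p ∈ tube R', (toS3 (W (s, p)) : R4) = Φ (s, p) :=
    fun s hs p hp => coe_toS3 (hlow s hs p hp p hp).1
  have hsh : ∀ s ∈ Set.Icc (0 : ℝ) 1, ∀ p ∈ tube R', ∀ k : ℤ, Φ (s, shift k p) = Φ (s, p) :=
    fun s hs p hp k => by
      simp only [Φ, apply_shift hper hs (le_min_iff.1 (show ‖p.2‖ ≤ _ from hp)).1 k]
  have hpi := Real.pi_pos
  have hrep : ∀ p ∈ tube R', ∃ j : ℤ, (shift j p).1 ∈ Set.Icc 0 (2 * Real.pi) ∧ shift j p ∈ Z := by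
    intro p hp
    obtain ⟨j, hj⟩ := exists_int_near (Real.pi - p.1)
    have hj' := abs_le.1 hj
    have e1 : (shift j p).1 = p.1 + j * (2 * Real.pi) := rfl
    refine ⟨j, ⟨?_, ?_⟩, ⟨?_, ?_⟩, ?_⟩
    · rw [e1]; linarith
    · rw [e1]; linarith
    · rw [e1]; linarith
    · rw [e1]; linarith
    · exact mem_closedBall_zero_iff.2 hp
  constructor
  · intro p hp
    obtain ⟨j, -, hj⟩ := hrep p hp
    rw [hcoe s hs p hp, hcoe s' hs' p hp, ← hsh s hs p hp j, ← hsh s' hs' p hp j, ← dist_eq_norm]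
    exact h₂ _ ⟨hs', hj⟩ _ ⟨hs, hj⟩ ((hdist _).trans (min_le_right _ _))
  · intro p hp q hq
    obtain ⟨j, hj0, hj⟩ := hrep p hp
    obtain ⟨-, k, hk, hb⟩ := hlow s hs p hp q hq
    have e1 : (shift j p).1 = p.1 + j * (2 * Real.pi) := rfl
    have e2 : (shift (j + k) q).1 = q.1 + (j + k) * (2 * Real.pi) := by simp [shift]
    have e3 : p - shift k q = shift j p - shift (j + k) q := by
      ext1
      · simp only [Prod.fst_sub, e1, e2]
        simp only [shift]; ring
      · rfl
    have hqZ : shift (j + k) q ∈ Z := by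
      have hk' := abs_le.1 hk
      simp only [shift] at hk'
      rw [e1] at hj0
      refine ⟨⟨?_, ?_⟩, ?_⟩
      · rw [e2]; linarith [hj0.1]
      · rw [e2]; linarith [hj0.2]
      · exact mem_closedBall_zero_iff.2 hq
    rw [hcoe s hs p hp, hcoe s hs q hq, e3] at hb
    rw [hcoe s hs p hp, hcoe s' hs' p hp, hcoe s hs q hq, hcoe s' hs' q hq]
    rw [← hsh s hs p hp j, ← hsh s' hs' p hp j, ← hsh s hs q hq (j + k), ← hsh s' hs' q hq (j + k)]
      at *
    have hder : ∀ x ∈ Z, HasFDerivWithinAt (fun x => Φ (s', x) - Φ (s, x))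
        (D (s', x) - D (s, x)) Z x := by
      intro x hx
      have hd : ∀ s ∈ Set.Icc (0 : ℝ) 1, HasFDerivAt (fun x => Φ (s, x)) (D (s, x)) x := by
        intro s hs
        have h1 := ((hΦ (s, x) (hne _ ⟨hs, hx⟩)).differentiableAt one_ne_zero).hasFDerivAt
        exact h1.comp x (hasFDerivAt_prodMk_right s x)
      exact ((hd s' hs').sub (hd s hs)).hasFDerivWithinAt
    have hbound : ∀ x ∈ Z, ‖D (s', x) - D (s, x)‖ ≤ κ * c := by
      intro x hx
      rw [← dist_eq_norm]
      exact h₁ _ ⟨hs', hx⟩ _ ⟨hs, hx⟩ ((hdist _).trans (min_le_left _ _))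
    have := hZconv.norm_image_sub_le_of_norm_hasFDerivWithin_le hder hbound hqZ hj
    refine this.trans ?_
    rw [mul_assoc]
    gcongr
end Family

end

section

/-! ### Determinants of jets -/

theorem det4_eq (a b c d : R4) : det4 a b c d =
    a 0 * (b 1 * (c 2 * d 3 - c 3 * d 2) - b 2 * (c 1 * d 3 - c 3 * d 1) +
      b 3 * (c 1 * d 2 - c 2 * d 1)) -
    a 1 * (b 0 * (c 2 * d 3 - c 3 * d 2) - b 2 * (c 0 * d 3 - c 3 * d 0) +
      b 3 * (c 0 * d 2 - c 2 * d 0)) +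
    a 2 * (b 0 * (c 1 * d 3 - c 3 * d 1) - b 1 * (c 0 * d 3 - c 3 * d 0) +
      b 3 * (c 0 * d 1 - c 1 * d 0)) -
    a 3 * (b 0 * (c 1 * d 2 - c 2 * d 1) - b 1 * (c 0 * d 2 - c 2 * d 0) +
      b 2 * (c 0 * d 1 - c 1 * d 0)) := by
  simp [det4, Matrix.det_succ_row_zero, Fin.sum_univ_succ, Fin.succAbove]
  ring

theorem det4_ne_zero_iff {a b c d : R4} : det4 a b c d ≠ 0 ↔
    ∀ x y z w : ℝ, x • a + y • b + z • c + w • d = 0 → x = 0 ∧ y = 0 ∧ z = 0 ∧ w = 0 := by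
  have h1 : det4 a b c d ≠ 0 ↔ LinearIndependent ℝ
      (Matrix.of fun i j => (![a, b, c, d] i) j : Matrix (Fin 4) (Fin 4) ℝ).row := by
    rw [Matrix.linearIndependent_rows_iff_isUnit, Matrix.isUnit_iff_isUnit_det, isUnit_iff_ne_zero]
    rfl
  rw [h1, Fintype.linearIndependent_iff]
  have h2 : ∀ g : Fin 4 → ℝ, (∑ i, g i •
      (Matrix.of fun i j => (![a, b, c, d] i) j : Matrix (Fin 4) (Fin 4) ℝ).row i = 0) ↔
      g 0 • a + g 1 • b + g 2 • c + g 3 • d = 0 := by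
    intro g
    rw [Fin.sum_univ_four]
    constructor
    · intro h
      ext j
      simpa using congrFun h j
    · intro h
      funext j
      simpa using congrArg (fun x : R4 => x j) h
  constructor
  · intro h x y z w he
    have h3 := h ![x, y, z, w] ((h2 _).2 he)
    exact ⟨h3 0, h3 1, h3 2, h3 3⟩
  · intro h g hg
    obtain ⟨h0, h1, h2, h3⟩ := h _ _ _ _ ((h2 g).1 hg)
    intro i
    fin_cases i <;> assumption

/-- The determinant of a vector and the values of a linear map on the standard frame of `ℝ × ℂ`. -/
def jetDet (x : R4) (L : ℝ × ℂ →L[ℝ] R4) : ℝ := det4 x (L (1, 0)) (L (0, 1)) (L (0, Complex.I))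

theorem jet_apply (L : ℝ × ℂ →L[ℝ] R4) (h : ℝ × ℂ) :
    L h = h.1 • L (1, 0) + h.2.re • L (0, 1) + h.2.im • L (0, Complex.I) := by
  rw [← map_smul, ← map_smul, ← map_smul, ← map_add, ← map_add]
  congr 1
  ext1
  · simp
  · simp

theorem jetDet_ne_zero_iff {x : R4} {L : ℝ × ℂ →L[ℝ] R4} : jetDet x L ≠ 0 ↔
    ∀ (a : ℝ) (h : ℝ × ℂ), a • x + L h = 0 → a = 0 ∧ h = 0 := by
  rw [jetDet, det4_ne_zero_iff]
  constructor
  · intro H a h he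
    rw [jet_apply] at he
    obtain ⟨h0, h1, h2, h3⟩ := H a h.1 h.2.re h.2.im (by rw [← he]; abel)
    refine ⟨h0, ?_⟩
    ext1
    · exact h1
    · exact Complex.ext h2 h3
  · intro H a y z w he
    obtain ⟨h0, h1⟩ := H a (y, ⟨z, w⟩) (by rw [jet_apply, ← he]; simp only; abel)
    simp only [Prod.mk_eq_zero, Complex.ext_iff] at h1
    exact ⟨h0, h1.1, h1.2.1, h1.2.2⟩

/-- Multiplying a map by a positive function adds to its derivative only multiples of the position
vector, which the determinant ignores. Thus radial projection preserves the sign of the jet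
determinant. -/
theorem jetDet_scale (x : R4) (L : ℝ × ℂ →L[ℝ] R4) (g : ℝ) (l : ℝ × ℂ →L[ℝ] ℝ) :
    jetDet (g • x) (g • L + l.smulRight x) = g ^ 4 * jetDet x L := by
  simp only [jetDet, det4_eq, add_apply, smul_apply,
    ContinuousLinearMap.smulRight_apply, PiLp.add_apply, PiLp.smul_apply, smul_eq_mul]
  ring

theorem hasFDerivAt_slice {W : ℝ × (ℝ × ℂ) → R4} (hW : Differentiable ℝ W) (s : ℝ) (p : ℝ × ℂ) :
    HasFDerivAt (fun p => W (s, p))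
      ((fderiv ℝ W (s, p)).comp (ContinuousLinearMap.inr ℝ ℝ (ℝ × ℂ))) p :=
  (hW (s, p)).hasFDerivAt.comp p (hasFDerivAt_prodMk_right s p)

theorem immersiveAt_iff {W : ℝ × (ℝ × ℂ) → R4} (hW : Differentiable ℝ W) {s : ℝ} {p : ℝ × ℂ}
    {L : ℝ × ℂ →L[ℝ] R4} (hL : HasFDerivAt (fun p => W (s, p)) L p) :
    ImmersiveAt W s p ↔ jetDet (W (s, p)) L ≠ 0 := by
  rw [jetDet_ne_zero_iff, hL.unique (hasFDerivAt_slice hW s p)]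
  rfl

theorem inner_fderiv_eq_zero {f : ℝ × ℂ → S3} {p : ℝ × ℂ} {L : ℝ × ℂ →L[ℝ] R4}
    (hL : HasFDerivAt (fun p => (f p : R4)) L p) (h : ℝ × ℂ) :
    inner ℝ (f p : R4) (L h) = 0 := by
  have h1 := hL.inner ℝ hL
  have h2 : (fun p => inner ℝ (f p : R4) (f p : R4)) = fun _ => (1 : ℝ) := by
    funext p
    rw [real_inner_self_eq_norm_sq, S3.norm_coe, one_pow]
  rw [h2] at h1
  have h3 := congrArg (fun l => l h) (h1.unique (hasFDerivAt_const (1 : ℝ) p))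
  simp [fderivInnerCLM_apply] at h3
  rw [real_inner_comm (f p : R4) (L h)] at h3
  linarith

/-! ### The coordinates of a thickening -/

section Thickening

variable {K : Set S3} {F : CharacteristicBand K} (N : Thickening F)

/-- The coordinates of a thickening, as a map to `R4`. -/
def Thickening.map (p : ℝ × ℂ) : R4 := N.coord p.1 p.2

theorem Thickening.contDiff_map : ContDiff ℝ ∞ N.map := N.smooth

theorem Thickening.contDiff_fderiv_map : ContDiff ℝ ∞ (fderiv ℝ N.map) :=
  N.contDiff_map.fderiv_right (by simp)

theorem Thickening.hasFDerivAt (p : ℝ × ℂ) : HasFDerivAt N.map (fderiv ℝ N.map p) p :=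
  (N.contDiff_map.differentiable (by simp) p).hasFDerivAt

theorem Thickening.toS3_map (p : ℝ × ℂ) : toS3 (N.map p) = N.coord p.1 p.2 := toS3_coe _

theorem Thickening.jetDet_pos (ρ : ℝ) {v : ℂ} (hv : ‖v‖ ≤ 1) :
    0 < jetDet (N.map (ρ, v)) (fderiv ℝ N.map (ρ, v)) := by
  have h := N.oriented ρ v (by simpa using hv)
  have h1 : deriv (fun r => (N.coord r v : R4)) ρ = fderiv ℝ N.map (ρ, v) (1, 0) := by
    apply HasDerivAt.deriv
    have h2 : HasDerivAt (fun r : ℝ => (r, v)) (1, 0) ρ :=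
      (hasDerivAt_id ρ).prodMk (hasDerivAt_const ρ v)
    exact (N.hasFDerivAt (ρ, v)).comp_hasDerivAt ρ h2
  have hw : ∀ w : ℂ, deriv (fun m : ℝ => (N.coord ρ (v + m * w) : R4)) 0 =
      fderiv ℝ N.map (ρ, v) (0, w) := by
    intro w
    apply HasDerivAt.deriv
    have h3 : HasDerivAt (fun m : ℝ => v + (m : ℂ) * w) w 0 := by
      simpa using ((Complex.ofRealCLM.hasDerivAt (x := (0 : ℝ))).mul_const w).const_add v
    have h2 : HasDerivAt (fun m : ℝ => (ρ, v + (m : ℂ) * w)) (0, w) 0 :=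
      (hasDerivAt_const (0 : ℝ) ρ).prodMk h3
    have h4 : HasFDerivAt N.map (fderiv ℝ N.map (ρ, v)) (ρ, v + ((0 : ℝ) : ℂ) * w) := by
      simpa using N.hasFDerivAt (ρ, v)
    exact h4.comp_hasDerivAt (0 : ℝ) h2
  have h5 := hw 1
  simp only [mul_one] at h5
  rw [h1, h5, hw Complex.I] at h
  exact h

theorem Thickening.map_periodic (ρ : ℝ) {v : ℂ} (hv : ‖v‖ ≤ 1) :
    N.map (ρ + 2 * Real.pi, v) = N.map (ρ, v) := by
  simp only [Thickening.map, N.periodic ρ v (by simpa using hv)]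

/-- Periodicity is known only on the closed disk, and the derivative is wanted at its boundary point
`v = 1` as well. The product of the line with a closed disk has unique derivatives, so the values on
it suffice. -/
theorem Thickening.fderiv_periodic (ρ : ℝ) {v : ℂ} (hv : ‖v‖ ≤ 1) :
    fderiv ℝ N.map (ρ + 2 * Real.pi, v) = fderiv ℝ N.map (ρ, v) := by
  set S : Set (ℝ × ℂ) := Set.univ ×ˢ Metric.closedBall 0 1 with hS
  have hp : (ρ, v) ∈ S := ⟨trivial, by simpa using hv⟩
  have hu : UniqueDiffOn ℝ S := by
    apply uniqueDiffOn_univ.prod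
    apply uniqueDiffOn_convex (convex_closedBall _ _)
    rw [interior_closedBall _ one_ne_zero]
    exact ⟨0, by simp⟩
  have h1 : HasFDerivAt (fun p : ℝ × ℂ => N.map (p + (2 * Real.pi, 0)))
      (fderiv ℝ N.map (ρ + 2 * Real.pi, v)) (ρ, v) := by
    have h2 : HasFDerivAt N.map (fderiv ℝ N.map (ρ + 2 * Real.pi, v))
        ((ρ, v) + (2 * Real.pi, 0)) := by
      simpa using N.hasFDerivAt (ρ + 2 * Real.pi, v)
    exact h2.comp (ρ, v) ((hasFDerivAt_id (𝕜 := ℝ) (ρ, v)).add_const (2 * Real.pi, (0 : ℂ)))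
  have h3 : HasFDerivWithinAt N.map (fderiv ℝ N.map (ρ + 2 * Real.pi, v)) S (ρ, v) := by
    refine h1.hasFDerivWithinAt.congr (fun p hp => ?_) ?_
    · have := N.map_periodic p.1 (v := p.2) (by simpa using hp.2)
      simpa [Prod.add_def] using this.symm
    · simpa [Prod.add_def] using (N.map_periodic ρ hv).symm
  exact (hu _ hp).eq h3 (N.hasFDerivAt (ρ, v)).hasFDerivWithinAt

theorem Thickening.coord_injective {p q : ℝ × ℂ} (hp : ‖p.2‖ ≤ 1) (hq : ‖q.2‖ ≤ 1)
    (h : N.coord p.1 p.2 = N.coord q.1 q.2) :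
    p.2 = q.2 ∧ ∃ k : ℤ, q.1 = p.1 + 2 * Real.pi * k :=
  N.injective _ _ _ (by simpa using hp) _ (by simpa using hq) h

/-- The solid torus can be shrunk. -/
theorem Thickening.isotopicOn_shrink {δ : ℝ} (hδ : 0 < δ) (hδ1 : δ ≤ 1) :
    IsotopicOn (tube 1) (fun p => N.coord p.1 p.2) (fun p => N.coord p.1 ((δ : ℂ) * p.2)) := by
  let W : ℝ × (ℝ × ℂ) → R4 := fun x => N.map (x.2.1, (1 - x.1 + x.1 * δ) • x.2.2)
  have hW : ContDiff ℝ 1 W := by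
    have := (N.contDiff_map.of_le (m := 1) (by simp))
    exact this.comp (by fun_prop)
  have hl : ∀ s ∈ Set.Icc (0 : ℝ) 1, 0 < 1 - s + s * δ ∧ 1 - s + s * δ ≤ 1 := fun s hs => by
    obtain ⟨h0, h1⟩ := hs
    constructor
    · rcases h1.lt_or_eq with h | h
      · have := mul_nonneg h0 hδ.le; linarith
      · rw [h]; linarith
    · nlinarith
  have hn : ∀ s ∈ Set.Icc (0 : ℝ) 1, ∀ v : ℂ, ‖v‖ ≤ 1 → ‖(1 - s + s * δ) • v‖ ≤ 1 := by
    intro s hs v hv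
    rw [norm_smul, Real.norm_of_nonneg (hl s hs).1.le]
    exact mul_le_one₀ (hl s hs).2 (norm_nonneg _) hv
  obtain ⟨η, hη, h⟩ := isotopicOn_tube (W := W) (r := 1) (R := 1) hW
    (fun s hs ρ v hv => N.map_periodic ρ (hn s hs v hv))
    (fun s hs p q hp hq heq => by
      change toS3 (N.map _) = toS3 (N.map _) at heq
      rw [N.toS3_map, N.toS3_map] at heq
      have h1 := N.coord_injective (p := (p.1, (1 - s + s * δ) • p.2))
        (q := (q.1, (1 - s + s * δ) • q.2)) (hn s hs _ hp) (hn s hs _ hq) heq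
      exact ⟨smul_right_injective ℂ (hl s hs).1.ne' h1.1, h1.2⟩)
    (fun s hs p hp => by
      have h1 : HasFDerivAt (fun p : ℝ × ℂ => (p.1, (1 - s + s * δ) • p.2)) 
          ((ContinuousLinearMap.fst ℝ ℝ ℂ).prod
            ((1 - s + s * δ) • ContinuousLinearMap.snd ℝ ℝ ℂ)) p :=
        hasFDerivAt_fst.prodMk
          ((1 - s + s * δ) • ContinuousLinearMap.snd ℝ ℝ ℂ).hasFDerivAt
      have h2 := (N.hasFDerivAt (p.1, (1 - s + s * δ) • p.2)).comp p h1
      rw [immersiveAt_iff (hW.differentiable one_ne_zero) h2, jetDet_ne_zero_iff]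
      intro a h he
      have h3 := jetDet_ne_zero_iff.1 (N.jetDet_pos p.1 (hn s hs _ hp)).ne' a _ he
      refine ⟨h3.1, ?_⟩
      have h4 : (h.1, (1 - s + s * δ) • h.2) = (0 : ℝ × ℂ) := h3.2
      simp only [Prod.mk_eq_zero, smul_eq_zero] at h4
      ext1
      · exact h4.1
      · exact h4.2.resolve_left (hl s hs).1.ne')
  -- Here `r = R = 1`, so the enlargement by `η` is not used.
  rw [min_eq_left (by linarith : (1 : ℝ) ≤ 1 + η)] at h
  convert h using 2 with p
  · simp [W, N.toS3_map]
  · simp [W, N.toS3_map]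

/-- The first-order expansion of the thickening along a boundary curve of the band. -/
def Thickening.edgeJet (p : ℝ × ℂ) : R4 := N.map (p.1, 1) + fderiv ℝ N.map (p.1, 1) (0, p.2)

theorem Thickening.contDiff_edgeJet : ContDiff ℝ ∞ N.edgeJet := by
  have h1 := N.contDiff_map
  have h2 := N.contDiff_fderiv_map
  unfold Thickening.edgeJet
  refine ContDiff.add (h1.comp (by fun_prop)) (ContDiff.clm_apply (h2.comp (by fun_prop)) ?_)
  fun_prop

/-- Being affine in `v`, the expansion is periodic for all `v`, not only in the unit disk; so the
later tubes can be defined on all of `ℝ × ℂ`. -/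
theorem Thickening.edgeJet_periodic (ρ : ℝ) (v : ℂ) :
    N.edgeJet (ρ + 2 * Real.pi, v) = N.edgeJet (ρ, v) := by
  simp only [Thickening.edgeJet, N.map_periodic ρ (v := 1) (by simp),
    N.fderiv_periodic ρ (v := 1) (by simp)]

theorem Thickening.edgeJet_ne_zero (p : ℝ × ℂ) : N.edgeJet p ≠ 0 := by
  intro h
  have h1 := jetDet_ne_zero_iff.1 (N.jetDet_pos p.1 (v := 1) (by simp)).ne' 1 (0, p.2)
    (by rw [one_smul]; exact h)
  exact one_ne_zero h1.1

/-- In the product rule the term that differentiates `f` is evaluated at the zero vector and drops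
out. -/
theorem hasFDerivAt_clm_zero {f : ℝ × ℂ → (ℝ × ℂ →L[ℝ] R4)} {ρ : ℝ}
    (hf : DifferentiableAt ℝ f (ρ, 0)) :
    HasFDerivAt (fun p => f p (0, p.2)) ((f (ρ, 0)).comp
      ((ContinuousLinearMap.inr ℝ ℝ ℂ).comp (ContinuousLinearMap.snd ℝ ℝ ℂ))) (ρ, 0) := by
  have h1 : HasFDerivAt (fun p : ℝ × ℂ => ((0 : ℝ), p.2))
      ((ContinuousLinearMap.inr ℝ ℝ ℂ).comp (ContinuousLinearMap.snd ℝ ℝ ℂ)) (ρ, 0) :=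
    ((ContinuousLinearMap.inr ℝ ℝ ℂ).comp (ContinuousLinearMap.snd ℝ ℝ ℂ)).hasFDerivAt
  have h2 := hf.hasFDerivAt.clm_apply h1
  have e : (fderiv ℝ f (ρ, 0)).flip (0, ((ρ, 0) : ℝ × ℂ).2) = 0 := by
    rw [show ((0 : ℝ), ((ρ, 0) : ℝ × ℂ).2) = 0 from rfl, map_zero]
  rw [e, add_zero] at h2
  exact h2

/-- Near its core, the thickening is isotopic to its first-order expansion along a boundary curve
of the band. -/
theorem Thickening.exists_isotopicOn_edgeJet :
    ∃ δ > 0, IsotopicOn (tube δ) (fun p => N.coord p.1 p.2) (fun p => toS3 (N.edgeJet p)) := by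
  -- At time `s` the centre of the tube is the curve `l = s`, and the normal variable is split
  -- between the true map, with weight `1 - s`, and its derivative, with weight `s`. On the core the
  -- weights add up to 1, so the derivative is that of the thickening at `v = s`. Convexity keeps `s
  -- + (1 - s) v` in the unit disk.
  let W : ℝ × (ℝ × ℂ) → R4 := fun x => N.map (x.2.1, (x.1 : ℂ) + (1 - x.1) • x.2.2) +
    x.1 • fderiv ℝ N.map (x.2.1, (x.1 : ℂ)) (0, x.2.2)
  have hof : ContDiff ℝ 1 (fun x : ℝ => (x : ℂ)) := Complex.ofRealCLM.contDiff
  have hW : ContDiff ℝ 1 W := by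
    have h1 := (N.contDiff_map.of_le (m := 1) (by simp))
    have h2 := N.contDiff_fderiv_map.of_le (m := 1) (by simp)
    refine ContDiff.add (h1.comp ?_) (contDiff_fst.smul (ContDiff.clm_apply (h2.comp ?_) ?_))
    · fun_prop
    · fun_prop
    · fun_prop
  have hs1 : ∀ s ∈ Set.Icc (0 : ℝ) 1, ‖(s : ℂ)‖ ≤ 1 := fun s hs => by
    rw [Complex.norm_real, Real.norm_of_nonneg hs.1]; exact hs.2
  have hn : ∀ s ∈ Set.Icc (0 : ℝ) 1, ∀ v : ℂ, ‖v‖ ≤ 1 → ‖(s : ℂ) + (1 - s) • v‖ ≤ 1 := by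
    intro s hs v hv
    refine (norm_add_le _ _).trans ?_
    rw [norm_smul, Complex.norm_real, Real.norm_of_nonneg hs.1,
      Real.norm_of_nonneg (by linarith [hs.2])]
    nlinarith [hs.1, hs.2]
  obtain ⟨δ, hδ, h⟩ := isotopicOn_tube (W := W) (r := 0) (R := 1) hW
    (fun s hs ρ v hv => by
      simp only [W, N.map_periodic ρ (hn s hs v hv), N.fderiv_periodic ρ (hs1 s hs)])
    (fun s hs p q hp hq heq => by
      rw [norm_le_zero_iff] at hp hq
      have e : ∀ p : ℝ × ℂ, p.2 = 0 → W (s, p) = N.map (p.1, (s : ℂ)) := fun p hp => by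
        simp only [W, hp, smul_zero, add_zero]
        rw [show ((0 : ℝ), (0 : ℂ)) = 0 from rfl, map_zero, smul_zero, add_zero]
      rw [e p hp, e q hq, N.toS3_map, N.toS3_map] at heq
      have h1 := N.coord_injective (p := (p.1, (s : ℂ))) (q := (q.1, (s : ℂ)))
        (hs1 s hs) (hs1 s hs) heq
      exact ⟨hp.trans hq.symm, h1.2⟩)
    (fun s hs p hp => by
      obtain ⟨ρ, v⟩ := p
      obtain rfl : v = 0 := by simpa using hp
      have h1 : HasFDerivAt (fun p : ℝ × ℂ => (p.1, (s : ℂ) + (1 - s) • p.2)) 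
          ((ContinuousLinearMap.fst ℝ ℝ ℂ).prod
            ((1 - s) • ContinuousLinearMap.snd ℝ ℝ ℂ)) (ρ, 0) :=
        hasFDerivAt_fst.prodMk
          (((1 - s) • ContinuousLinearMap.snd ℝ ℝ ℂ).hasFDerivAt.const_add (s : ℂ))
      have h2 : HasFDerivAt N.map (fderiv ℝ N.map (ρ, s))
          ((ρ, (0 : ℂ)).1, (s : ℂ) + (1 - s) • (ρ, (0 : ℂ)).2) := by
        simpa using N.hasFDerivAt (ρ, (s : ℂ))
      have h3 := h2.comp (ρ, (0 : ℂ)) h1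
      have h4 : DifferentiableAt ℝ (fun p : ℝ × ℂ => fderiv ℝ N.map (p.1, (s : ℂ))) (ρ, 0) := by
        have h2 := N.contDiff_fderiv_map.of_le (m := 1) (by simp)
        exact (h2.differentiable one_ne_zero).comp (by fun_prop) _
      have h5 := h3.add ((hasFDerivAt_clm_zero h4).const_smul s)
      rw [immersiveAt_iff (hW.differentiable one_ne_zero) h5, jetDet_ne_zero_iff]
      intro a h he
      refine jetDet_ne_zero_iff.1 (N.jetDet_pos ρ (hs1 s hs)).ne' a h ?_
      have e : W (s, ρ, 0) = N.map (ρ, (s : ℂ)) := by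
        simp only [W, smul_zero, add_zero]
        rw [show ((0 : ℝ), (0 : ℂ)) = 0 from rfl, map_zero, smul_zero, add_zero]
      rw [e] at he
      rw [← he]
      congr 1
      simp only [add_apply, ContinuousLinearMap.comp_apply,
        smul_apply, ContinuousLinearMap.prod_apply,
        ContinuousLinearMap.coe_fst', ContinuousLinearMap.coe_snd', ContinuousLinearMap.inr_apply]
      rw [← map_smul, ← map_add]
      congr 1
      ext1
      · simp
      · simp [sub_smul])
  refine ⟨min 1 (0 + δ), by positivity, ?_⟩
  convert h using 2 with p p
  · simp [W, N.toS3_map]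
  · simp [W, Thickening.edgeJet]

end Thickening

end

section

/-! ### Moving the edge of the band to a great circle -/

theorem SmoothlyIsotopic.trans {A B C : Set S3} (h : SmoothlyIsotopic A B)
    (h' : SmoothlyIsotopic B C) : SmoothlyIsotopic A C := by
  obtain ⟨H, hs, h0, h1⟩ := h
  obtain ⟨H', hs', h0', h1'⟩ := h'
  refine ⟨fun s => (H s).trans (H' s), ?_, fun σ => ?_, ?_⟩
  · have : ContMDiff (𝓘(ℝ, ℝ).prod (𝓡 3)) (𝓘(ℝ, ℝ).prod (𝓡 3)) ∞
        (fun p : ℝ × S3 => (p.1, H p.1 p.2)) := contMDiff_fst.prodMk hs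
    exact hs'.comp this
  · simp [h0, h0']
  · rw [← h1', ← h1, Set.image_image]
    rfl

theorem contMDiff_toS3_comp {V : Type*} [NormedAddCommGroup V] [NormedSpace ℝ V] {Y : V → R4}
    (hY : ContDiff ℝ ∞ Y) (hne : ∀ p, Y p ≠ 0) :
    ContMDiff 𝓘(ℝ, V) (𝓡 3) ∞ (fun p => toS3 (Y p)) := by
  have h1 : ContDiff ℝ ∞ (fun p => ‖Y p‖⁻¹ • Y p) :=
    ((hY.norm ℝ hne).inv fun p => norm_ne_zero_iff.2 (hne p)).smul hY
  have h2 : ∀ p, ‖Y p‖⁻¹ • Y p ∈ Metric.sphere (0 : R4) 1 := fun p => by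
    rw [← coe_toS3 (hne p)]; exact (toS3 (Y p)).2
  have h3 := h1.contMDiff.codRestrict_sphere (n := 3) h2
  have e : (fun p => toS3 (Y p)) = Set.codRestrict (fun p => ‖Y p‖⁻¹ • Y p) _ h2 := by
    funext p
    apply Subtype.ext
    rw [coe_toS3 (hne p)]
    rfl
  rw [e]
  exact h3

theorem fderiv_coe_comp {f : ℝ × ℂ → S3} (hf : ContMDiff 𝓘(ℝ, ℝ × ℂ) (𝓡 3) ∞ f) (p : ℝ × ℂ)
    (h : ℝ × ℂ) : fderiv ℝ (fun p => (f p : R4)) p h =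
      mfderiv (𝓡 3) 𝓘(ℝ, R4) (Subtype.val : S3 → R4) (f p) (mfderiv 𝓘(ℝ, ℝ × ℂ) (𝓡 3) f p h) := by
  have h1 : MDifferentiableAt (𝓡 3) 𝓘(ℝ, R4) (Subtype.val : S3 → R4) (f p) :=
    (contMDiff_coe_sphere (n := 3) (m := 1)).mdifferentiable one_ne_zero _
  have h2 : MDifferentiableAt 𝓘(ℝ, ℝ × ℂ) (𝓡 3) f p := hf.mdifferentiable (by simp) p
  have h3 := mfderiv_comp p h1 h2
  rw [mfderiv_eq_fderiv] at h3
  exact congrArg (fun l : ℝ × ℂ →L[ℝ] R4 => l h) h3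

/-- The inclusion of the sphere is an immersion and `f = H⁻¹ ∘ (H ∘ f)`, so a vector annihilated
after composition with `H` was annihilated before. -/
theorem fderiv_diffeomorph_comp_eq_zero {f : ℝ × ℂ → S3}
    (hf : ContMDiff 𝓘(ℝ, ℝ × ℂ) (𝓡 3) ∞ f) (H : Diffeomorph (𝓡 3) (𝓡 3) S3 S3 ∞) {p h : ℝ × ℂ}
    (h0 : fderiv ℝ (fun p => (H (f p) : R4)) p h = 0) :
    fderiv ℝ (fun p => (f p : R4)) p h = 0 := by
  have hg : ContMDiff 𝓘(ℝ, ℝ × ℂ) (𝓡 3) ∞ (fun p => H (f p)) := H.contMDiff.comp hf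
  rw [fderiv_coe_comp hg] at h0
  have h1 : mfderiv 𝓘(ℝ, ℝ × ℂ) (𝓡 3) (fun p => H (f p)) p h = 0 := by
    apply mfderiv_coe_sphere_injective (H (f p))
    rw [h0]; exact (map_zero _).symm
  have h2 : f = H.symm ∘ fun p => H (f p) := by funext p; simp
  have h3 : mfderiv 𝓘(ℝ, ℝ × ℂ) (𝓡 3) f p h = 0 := by
    have h4 := mfderiv_comp (I := 𝓘(ℝ, ℝ × ℂ)) (I' := 𝓡 3) (I'' := 𝓡 3) p
      (H.symm.contMDiff.mdifferentiable (by simp) (H (f p)))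
      (hg.mdifferentiable (by simp) p)
    rw [← h2] at h4
    have h5 := congrArg (fun l : ℝ × ℂ →L[ℝ] EuclideanSpace ℝ (Fin 3) => l h) h4
    exact h5.trans ((congrArg (mfderiv (𝓡 3) (𝓡 3) H.symm (H (f p))) h1).trans (map_zero _))
  rw [fderiv_coe_comp hf, h3]
  exact map_zero _

/-- The thickening of the band is, near its core, isotopic to a tube around a great circle. -/
theorem exists_tube_on_greatCircle {K : Set S3} (hK : IsTrivialKnot K) {F : CharacteristicBand K}
    (N : Thickening F) : ∃ Φ : ℝ × ℂ → S3, ContDiff ℝ ∞ (fun p => (Φ p : R4)) ∧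
      (∀ ρ v, Φ (ρ + 2 * Real.pi, v) = Φ (ρ, v)) ∧
      (∀ ρ, 0 < jetDet (Φ (ρ, 0)) (fderiv ℝ (fun p => (Φ p : R4)) (ρ, 0))) ∧
      (∀ ρ ρ', Φ (ρ, 0) = Φ (ρ', 0) → ∃ k : ℤ, ρ' = ρ + 2 * Real.pi * k) ∧
      (∀ ρ, Φ (ρ, 0) ∈ greatCircle) ∧
      ∃ δ > 0, IsotopicOn (tube δ) (fun p => N.coord p.1 p.2) Φ := by
  obtain ⟨H, hs, h0, h1⟩ := F.boundary_pos.trans hK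
  obtain ⟨δ, hδ, hiso⟩ := N.exists_isotopicOn_edgeJet
  set κ : ℝ × ℂ → S3 := fun p => toS3 (N.edgeJet p) with hκ
  have hκs : ContMDiff 𝓘(ℝ, ℝ × ℂ) (𝓡 3) ∞ κ :=
    contMDiff_toS3_comp N.contDiff_edgeJet N.edgeJet_ne_zero
  have hκd : ContDiff ℝ ∞ (fun p => (κ p : R4)) :=
    contMDiff_iff_contDiff.1 ((contMDiff_coe_sphere (n := 3)).comp hκs)
  have hjoint : ContDiff ℝ ∞ (fun x : ℝ × (ℝ × ℂ) => (H x.1 (κ x.2) : R4)) := by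
    have hpair : ContMDiff 𝓘(ℝ, ℝ × (ℝ × ℂ)) (𝓘(ℝ, ℝ).prod (𝓡 3)) ∞
        (fun x : ℝ × (ℝ × ℂ) => (x.1, κ x.2)) :=
      (contDiff_fst.contMDiff).prodMk (hκs.comp contDiff_snd.contMDiff)
    exact contMDiff_iff_contDiff.1 ((contMDiff_coe_sphere (n := 3)).comp (hs.comp hpair))
  have hcore : ∀ ρ, N.edgeJet (ρ, 0) = N.map (ρ, 1) := fun ρ => by
    simp only [Thickening.edgeJet]
    rw [show ((0 : ℝ), (0 : ℂ)) = 0 from rfl, map_zero, add_zero]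
  have hκ0 : ∀ ρ, κ (ρ, 0) = N.coord ρ 1 := fun ρ => by
    simp only [hκ, hcore, N.toS3_map]
  have hjet0 : ∀ ρ, 0 < jetDet (κ (ρ, 0)) (fderiv ℝ (fun p => (κ p : R4)) (ρ, 0)) := by
    intro ρ
    have hd : HasFDerivAt N.edgeJet (fderiv ℝ N.map (ρ, 1)) (ρ, 0) := by
      have h4 : DifferentiableAt ℝ (fun p : ℝ × ℂ => fderiv ℝ N.map (p.1, 1)) (ρ, 0) := by
        have h2 := N.contDiff_fderiv_map.of_le (m := 1) (by simp)
        exact (h2.differentiable one_ne_zero).comp (by fun_prop) _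
      have h5 : HasFDerivAt (fun p : ℝ × ℂ => (p.1, (1 : ℂ)))
          ((ContinuousLinearMap.fst ℝ ℝ ℂ).prod (0 : ℝ × ℂ →L[ℝ] ℂ)) (ρ, 0) :=
        hasFDerivAt_fst.prodMk (hasFDerivAt_const _ _)
      have h6 := ((N.hasFDerivAt (ρ, 1)).comp (ρ, (0 : ℂ)) h5).add (hasFDerivAt_clm_zero h4)
      have e : fderiv ℝ N.map (ρ, 1) = (fderiv ℝ N.map (ρ, 1)).comp
          ((ContinuousLinearMap.fst ℝ ℝ ℂ).prod (0 : ℝ × ℂ →L[ℝ] ℂ)) +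
          (fderiv ℝ N.map (ρ, 1)).comp
            ((ContinuousLinearMap.inr ℝ ℝ ℂ).comp (ContinuousLinearMap.snd ℝ ℝ ℂ)) := by
        rw [← ContinuousLinearMap.comp_add]
        apply ContinuousLinearMap.ext
        intro h
        change _ = fderiv ℝ N.map (ρ, 1) ((h.1, 0) + (0, h.2))
        congr 1
        ext1 <;> simp
      rw [e]
      exact h6
    have hg : DifferentiableAt ℝ (fun p => ‖N.edgeJet p‖⁻¹) (ρ, 0) :=
      (((N.contDiff_edgeJet.norm ℝ N.edgeJet_ne_zero).inv
        fun p => norm_ne_zero_iff.2 (N.edgeJet_ne_zero p)).differentiable (by simp)) _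
    have h7 := hg.hasFDerivAt.smul hd
    have h8 : (fun p => (κ p : R4)) = (fun p => ‖N.edgeJet p‖⁻¹) • N.edgeJet := by
      funext p
      exact coe_toS3 (N.edgeJet_ne_zero p)
    rw [h8, h7.fderiv, hκ, coe_toS3 (N.edgeJet_ne_zero _), jetDet_scale, hcore]
    have h9 := N.jetDet_pos ρ (v := 1) (by simp)
    have h10 : ‖N.map (ρ, 1)‖ = 1 := S3.norm_coe _
    rw [h10]
    simpa using h9
  refine ⟨fun p => H 1 (κ p), ?_, ?_, ?_, ?_, ?_, δ, hδ, ?_⟩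
  · exact hjoint.comp (contDiff_const.prodMk contDiff_id)
  · intro ρ v
    simp only [hκ, N.edgeJet_periodic]
  · intro ρ
    -- Orientation survives the isotopy: `d` is continuous, never zero because every `H s` is a
    -- diffeomorphism, and positive at `s = 0`.
    let d : ℝ → ℝ := fun s => jetDet (H s (κ (ρ, 0)) : R4)
      ((fderiv ℝ (fun x : ℝ × (ℝ × ℂ) => (H x.1 (κ x.2) : R4)) (s, (ρ, 0))).comp
        (ContinuousLinearMap.inr ℝ ℝ (ℝ × ℂ)))
    have hslice : ∀ s, (fderiv ℝ (fun x : ℝ × (ℝ × ℂ) => (H x.1 (κ x.2) : R4)) (s, (ρ, 0))).comp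
        (ContinuousLinearMap.inr ℝ ℝ (ℝ × ℂ)) = fderiv ℝ (fun p => (H s (κ p) : R4)) (ρ, 0) :=
      fun s => ((hasFDerivAt_slice (hjoint.differentiable (by simp)) s (ρ, 0)).fderiv).symm
    have hdc : Continuous d := by
      have e1 : Continuous (fun s => (H s (κ (ρ, 0)) : R4)) :=
        hjoint.continuous.comp (Continuous.prodMk_left (ρ, (0 : ℂ)))
      have e2 : ∀ h, Continuous (fun s =>
          fderiv ℝ (fun x : ℝ × (ℝ × ℂ) => (H x.1 (κ x.2) : R4)) (s, (ρ, (0 : ℂ))) (0, h)) :=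
        fun h => (((hjoint.continuous_fderiv (by simp)).comp
          (Continuous.prodMk_left (ρ, (0 : ℂ)))).clm_apply continuous_const)
      have e3 : ∀ (f : ℝ → R4) (i : Fin 4), Continuous f → Continuous fun s => f s i :=
        fun f i hf => by fun_prop
      simp only [d, jetDet, det4_eq, ContinuousLinearMap.comp_apply,
        ContinuousLinearMap.inr_apply]
      have e4 := fun i => e3 _ i e1
      have e5 := fun h i => e3 _ i (e2 h)
      fun_prop
    have hdne : ∀ s, d s ≠ 0 := by
      intro s
      simp only [d]
      rw [hslice, jetDet_ne_zero_iff]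
      intro a h he
      have hg : ContDiff ℝ ∞ (fun p => (H s (κ p) : R4)) :=
        hjoint.comp (contDiff_const.prodMk contDiff_id)
      have hgd := (hg.differentiable (by simp) (ρ, 0)).hasFDerivAt
      have ha : a = 0 := by
        have h2 := congrArg (fun x => inner ℝ (H s (κ (ρ, 0)) : R4) x) he
        simp only [inner_add_right, inner_smul_right, inner_zero_right] at h2
        rw [inner_fderiv_eq_zero hgd, real_inner_self_eq_norm_sq, S3.norm_coe] at h2
        simpa using h2
      refine ⟨ha, ?_⟩
      rw [ha, zero_smul, zero_add] at he
      have h3 := fderiv_diffeomorph_comp_eq_zero hκs (H s) he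
      exact (jetDet_ne_zero_iff.1 (hjet0 ρ).ne' 0 h (by rw [zero_smul, zero_add, h3])).2
    have hd0 : 0 < d 0 := by
      simp only [d]
      rw [hslice]
      simp only [h0]
      exact hjet0 ρ
    have hd1 : 0 < d 1 := by
      by_contra hneg
      push Not at hneg
      obtain ⟨s, -, hs⟩ := intermediate_value_Icc' zero_le_one hdc.continuousOn ⟨hneg, hd0.le⟩
      exact hdne s hs
    simp only [d] at hd1
    rw [hslice] at hd1
    exact hd1
  · intro ρ ρ' h
    have h2 := (H 1).injective h
    rw [hκ0, hκ0] at h2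
    exact (N.coord_injective (p := (ρ, 1)) (q := (ρ', 1)) (by simp) (by simp) h2).2
  · intro ρ
    rw [← h1]
    refine ⟨_, ⟨ρ, ?_⟩, rfl⟩
    have := N.extends_band ρ 1 (by simp)
    simp only [Complex.ofReal_one] at this
    rw [hκ0, this]
  · refine hiso.trans ⟨fun s => (H s).toHomeomorph, ?_, fun σ => ?_, fun p _ => rfl⟩
    · have := hs.continuous
      exact this.comp (continuous_subtype_val.prodMap continuous_id)
    · simp [h0]

end

section

/-! ### Logarithms of curves in the plane -/

/-- Take `g` to be a primitive of `f' / f` with `exp (g 0) = f 0`; then `f exp(-g)` has derivative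
zero and equals 1 at 0. -/
theorem exists_smooth_log {f : ℝ → ℂ} (hf : ContDiff ℝ ∞ f) (h0 : ∀ x, f x ≠ 0) :
    ∃ g : ℝ → ℂ, ContDiff ℝ ∞ g ∧ ∀ x, f x = Complex.exp (g x) := by
  have hf' : ContDiff ℝ ∞ (deriv f) := (contDiff_infty_iff_deriv.1 hf).2
  have hq : ContDiff ℝ ∞ (fun x => deriv f x / f x) := by
    simp only [div_eq_mul_inv]
    exact hf'.mul (hf.inv h0)
  set g : ℝ → ℂ := fun x => Complex.log (f 0) + ∫ t in (0 : ℝ)..x, deriv f t / f t with hg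
  have hgd : ∀ x, HasDerivAt g (deriv f x / f x) x := fun x =>
    (intervalIntegral.integral_hasDerivAt_right (hq.continuous.intervalIntegrable _ _)
      (hq.continuous.stronglyMeasurableAtFilter _ _) hq.continuous.continuousAt).const_add _
  refine ⟨g, ?_, ?_⟩
  · rw [contDiff_infty_iff_deriv]
    refine ⟨fun x => (hgd x).differentiableAt, ?_⟩
    rw [show deriv g = fun x => deriv f x / f x from funext fun x => (hgd x).deriv]
    exact hq
  · have hd : ∀ x, HasDerivAt (fun x => f x * Complex.exp (-g x)) 0 x := by
      intro x
      have h1 := (hf.differentiable (by simp) x).hasDerivAt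
      have h2 := h1.fun_mul ((hgd x).fun_neg.cexp)
      have h3 : f x * (deriv f x / f x) = deriv f x := mul_div_cancel₀ _ (h0 x)
      refine h2.congr_deriv ?_
      linear_combination -Complex.exp (-g x) * h3
    have hconst := is_const_of_deriv_eq_zero (fun x => (hd x).differentiableAt)
      (fun x => (hd x).deriv)
    intro x
    have h3 := hconst x 0
    have h4 : g 0 = Complex.log (f 0) := by simp [hg]
    simp only [h4] at h3
    rw [Complex.exp_neg (Complex.log _), Complex.exp_log (h0 0), mul_inv_cancel₀ (h0 0),
      Complex.exp_neg] at h3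
    exact (mul_inv_eq_one₀ (Complex.exp_ne_zero _)).1 h3

/-- The increment of the logarithm over a period, divided by `2πi`, is a continuous integer-valued
function, hence constant: this is the winding number `m`. -/
theorem exists_smooth_arg {f : ℝ → ℂ} (hf : ContDiff ℝ ∞ f) (h0 : ∀ x, f x ≠ 0)
    (hper : ∀ x, f (x + 2 * Real.pi) = f x) :
    ∃ (μ : ℝ → ℝ) (m : ℤ), ContDiff ℝ ∞ μ ∧
      (∀ x, (f x).re = ‖f x‖ * Real.cos (μ x) ∧ (f x).im = ‖f x‖ * Real.sin (μ x)) ∧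
      ∀ x, μ (x + 2 * Real.pi) = μ x + 2 * Real.pi * m := by
  obtain ⟨g, hg, hfg⟩ := exists_smooth_log hf h0
  have him : ContDiff ℝ ∞ (fun x => (g x).im) := Complex.imCLM.contDiff.comp hg
  have hper' : ∀ x, ∃ m : ℤ, g (x + 2 * Real.pi) = g x + m * (2 * Real.pi * Complex.I) := by
    intro x
    have := hper x
    rw [hfg, hfg, Complex.exp_eq_exp_iff_exists_int] at this
    exact this
  obtain ⟨m, hm⟩ := hper' 0
  refine ⟨fun x => (g x).im, m, him, fun x => ?_, fun x => ?_⟩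
  · rw [hfg, Complex.norm_exp, Complex.exp_re, Complex.exp_im]
    exact ⟨rfl, rfl⟩
  · have hk : ∀ x, ∃ k : ℤ, ((g (x + 2 * Real.pi)).im - (g x).im) / (2 * Real.pi) = k := by
      intro x
      obtain ⟨k, hk⟩ := hper' x
      refine ⟨k, ?_⟩
      rw [hk]
      have := Real.pi_pos
      simp
    choose k hk using hk
    have hc : Continuous (fun x => ((g (x + 2 * Real.pi)).im - (g x).im) / (2 * Real.pi)) := by
      have := him.continuous
      exact ((this.comp (continuous_id.add continuous_const)).sub this).div_const _
    have hkc : Continuous k := by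
      rw [Int.isClosedEmbedding_coe_real.isInducing.continuous_iff]
      exact hc.congr fun x => hk x
    have hkk : k x = k 0 := by
      have := IsLocallyConstant.iff_continuous k |>.2 hkc
      exact this.apply_eq_of_preconnectedSpace x 0
    have h1 := hk x
    have h2 := hk 0
    rw [hkk, ← h2, hm] at h1
    have := Real.pi_pos
    rw [div_eq_div_iff (by positivity) (by positivity)] at h1
    have h3 := mul_right_cancel₀ (by positivity : (2 * Real.pi) ≠ 0) h1
    simp at h3
    simp only
    linarith

/-! ### Tubes with a planar frame around the standard great circle -/

/-- The curve with angle `a` on the standard great circle, thickened by a normal frame turned by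
the angle `b`; the second normal vector is multiplied by `ε`. -/
def framed (ε : ℝ) (a b : ℝ → ℝ) (p : ℝ × ℂ) : R4 :=
  !₂[Real.cos (a p.1), Real.sin (a p.1),
    p.2.re * Real.cos (b p.1) - ε * p.2.im * Real.sin (b p.1),
    p.2.re * Real.sin (b p.1) + ε * p.2.im * Real.cos (b p.1)]

theorem contDiff_complex_re {n : ℕ∞ω} : ContDiff ℝ n Complex.re := Complex.reCLM.contDiff
theorem contDiff_complex_im {n : ℕ∞ω} : ContDiff ℝ n Complex.im := Complex.imCLM.contDiff

theorem contDiff_framed {V : Type*} [NormedAddCommGroup V] [NormedSpace ℝ V] {n : ℕ∞ω} (ε : ℝ)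
    {a b : V → ℝ → ℝ} {q : V → ℝ × ℂ}
    (ha : ContDiff ℝ n fun x => a x (q x).1) (hb : ContDiff ℝ n fun x => b x (q x).1)
    (hq : ContDiff ℝ n q) : ContDiff ℝ n (fun x => framed ε (a x) (b x) (q x)) := by
  have hre : ContDiff ℝ n fun x => (q x).2.re := contDiff_complex_re.comp hq.snd
  have him : ContDiff ℝ n fun x => (q x).2.im := contDiff_complex_im.comp hq.snd
  rw [contDiff_euclidean]
  intro i
  fin_cases i
  · exact ha.cos
  · exact ha.sin
  · exact (hre.mul hb.cos).sub ((contDiff_const.mul him).mul hb.sin)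
  · exact (hre.mul hb.sin).add ((contDiff_const.mul him).mul hb.cos)

theorem fderiv_coord {f : ℝ × ℂ → R4} {L : ℝ × ℂ →L[ℝ] R4} {p : ℝ × ℂ} (hL : HasFDerivAt f L p)
    (h : ℝ × ℂ) (j : Fin 4) {d : ℝ} (hd : HasDerivAt (fun t : ℝ => f (p + t • h) j) d 0) :
    (L h) j = d := by
  have h1 : HasDerivAt (fun t : ℝ => p + t • h) h 0 := by
    simpa using ((hasDerivAt_id (0 : ℝ)).smul_const h).const_add p
  have h2 : HasFDerivAt f L (p + (0 : ℝ) • h) := by simpa using hL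
  have h3 := h2.comp_hasDerivAt (0 : ℝ) h1
  have h4 := (EuclideanSpace.proj (𝕜 := ℝ) j).hasFDerivAt.comp_hasDerivAt (0 : ℝ) h3
  exact h4.unique hd

theorem framed_jet (ε : ℝ) {a b : ℝ → ℝ} {ρ a' : ℝ} (ha : HasDerivAt a a' ρ)
    {L : ℝ × ℂ →L[ℝ] R4} (hL : HasFDerivAt (framed ε a b) L (ρ, 0)) :
    L (1, 0) = !₂[-(a' * Real.sin (a ρ)), a' * Real.cos (a ρ), 0, 0] ∧
    L (0, 1) = !₂[0, 0, Real.cos (b ρ), Real.sin (b ρ)] ∧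
    L (0, Complex.I) = !₂[0, 0, -(ε * Real.sin (b ρ)), ε * Real.cos (b ρ)] := by
  have ha0 : HasDerivAt (fun t : ℝ => a (ρ + t)) a' 0 := by
    have h1 : HasDerivAt a a' (ρ + 0) := by simpa using ha
    exact h1.comp_const_add ρ 0
  refine ⟨?_, ?_, ?_⟩
  · ext j
    apply fderiv_coord hL
    fin_cases j
    · simpa [framed, mul_comm] using ha0.cos
    · simpa [framed, mul_comm] using ha0.sin
    · simpa [framed] using hasDerivAt_const (0 : ℝ) (0 : ℝ)
    · simpa [framed] using hasDerivAt_const (0 : ℝ) (0 : ℝ)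
  · ext j
    apply fderiv_coord hL
    fin_cases j
    · simpa [framed] using hasDerivAt_const (0 : ℝ) (Real.cos (a ρ))
    · simpa [framed] using hasDerivAt_const (0 : ℝ) (Real.sin (a ρ))
    · simpa [framed] using (hasDerivAt_id (0 : ℝ)).mul_const (Real.cos (b ρ))
    · simpa [framed] using (hasDerivAt_id (0 : ℝ)).mul_const (Real.sin (b ρ))
  · ext j
    apply fderiv_coord hL
    fin_cases j
    · simpa [framed] using hasDerivAt_const (0 : ℝ) (Real.cos (a ρ))
    · simpa [framed] using hasDerivAt_const (0 : ℝ) (Real.sin (a ρ))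
    · simpa [framed] using
        (((hasDerivAt_id (0 : ℝ)).const_mul ε).mul_const (Real.sin (b ρ))).fun_neg
    · simpa [framed] using ((hasDerivAt_id (0 : ℝ)).const_mul ε).mul_const (Real.cos (b ρ))

theorem framed_zero (ε : ℝ) (a b : ℝ → ℝ) (ρ : ℝ) :
    framed ε a b (ρ, 0) = !₂[Real.cos (a ρ), Real.sin (a ρ), 0, 0] := by
  simp [framed]

theorem toS3_of_norm_one {x : R4} (h : ‖x‖ = 1) : (toS3 x : R4) = x := by
  have h0 : x ≠ 0 := by rintro rfl; simp at h
  rw [coe_toS3 h0, h, inv_one, one_smul]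

theorem norm_framed_zero (ε : ℝ) (a b : ℝ → ℝ) (ρ : ℝ) : ‖framed ε a b (ρ, 0)‖ = 1 := by
  rw [framed_zero, EuclideanSpace.norm_eq]
  simp [Fin.sum_univ_succ]

theorem framed_periodic (ε : ℝ) {a b : ℝ → ℝ} {ρ : ℝ} {k m : ℤ}
    (ha : a (ρ + 2 * Real.pi) = a ρ + 2 * Real.pi * k)
    (hb : b (ρ + 2 * Real.pi) = b ρ + 2 * Real.pi * m) (v : ℂ) :
    framed ε a b (ρ + 2 * Real.pi, v) = framed ε a b (ρ, v) := by
  have hc : ∀ (x : ℝ) (k : ℤ), Real.cos (x + 2 * Real.pi * k) = Real.cos x := fun x k => by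
    rw [mul_comm]; exact Real.cos_add_int_mul_two_pi x k
  have hs : ∀ (x : ℝ) (k : ℤ), Real.sin (x + 2 * Real.pi * k) = Real.sin x := fun x k => by
    rw [mul_comm]; exact Real.sin_add_int_mul_two_pi x k
  simp only [framed, ha, hb, hc, hs]

theorem eq_add_of_cos_sin_eq {x y : ℝ} (hc : Real.cos x = Real.cos y)
    (hs : Real.sin x = Real.sin y) : ∃ k : ℤ, y = x + 2 * Real.pi * k := by
  have h : (y : Real.Angle) = x := Real.Angle.cos_sin_inj hc.symm hs.symm
  rw [Real.Angle.angle_eq_iff_two_pi_dvd_sub] at h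
  obtain ⟨k, hk⟩ := h
  exact ⟨k, by linarith⟩

/-- A `C^1` circle map with nowhere zero derivative which is injective has degree `±1`. -/
theorem exists_sign {φ : ℝ → ℝ} (hφ : ContDiff ℝ 1 φ) (h0 : ∀ x, deriv φ x ≠ 0) {k : ℤ}
    (hper : ∀ x, φ (x + 2 * Real.pi) = φ x + 2 * Real.pi * k)
    (hinj : ∀ x y, (∃ j : ℤ, φ y = φ x + 2 * Real.pi * j) → ∃ j : ℤ, y = x + 2 * Real.pi * j) :
    ∃ ε : ℤ, (ε = 1 ∨ ε = -1) ∧ k = ε ∧ ∀ x, 0 < ε * deriv φ x := by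
  have hpi := Real.pi_pos
  -- For an increasing lift the degree is at least 1. If it were at least 2, the value `ψ 0 + 2π`
  -- would be taken strictly between 0 and `2π`, against injectivity modulo `2π`. A decreasing lift
  -- is treated by passing to `-φ`.
  have main : ∀ ψ : ℝ → ℝ, ∀ k : ℤ, Differentiable ℝ ψ → (∀ x, 0 < deriv ψ x) →
      (∀ x, ψ (x + 2 * Real.pi) = ψ x + 2 * Real.pi * k) →
      (∀ x y, (∃ j : ℤ, ψ y = ψ x + 2 * Real.pi * j) → ∃ j : ℤ, y = x + 2 * Real.pi * j) →
      k = 1 := by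
    intro ψ k hd hpos hper hinj
    have hmono : StrictMono ψ := strictMono_of_deriv_pos hpos
    have h1 := hmono (by linarith : (0 : ℝ) < 0 + 2 * Real.pi)
    rw [hper] at h1
    have hk : (0 : ℝ) < k := by
      by_contra h; push Not at h; nlinarith
    have hk1 : 1 ≤ k := by exact_mod_cast hk
    by_contra hne
    have hk2 : (2 : ℝ) ≤ k := by exact_mod_cast (by omega : 2 ≤ k)
    have hiv := intermediate_value_Icc (by linarith : (0 : ℝ) ≤ 0 + 2 * Real.pi)
      hd.continuous.continuousOn
    have hmem : ψ 0 + 2 * Real.pi ∈ Set.Icc (ψ 0) (ψ (0 + 2 * Real.pi)) := by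
      rw [hper]; constructor <;> nlinarith
    obtain ⟨y, hy, hy'⟩ := hiv hmem
    obtain ⟨j, hj⟩ := hinj 0 y ⟨1, by rw [hy']; simp⟩
    have hy0 : y ≠ 0 := by rintro rfl; linarith
    have hy2 : y ≠ 0 + 2 * Real.pi := by
      intro h; rw [h, hper] at hy'; nlinarith
    have h3 : 0 < y := lt_of_le_of_ne hy.1 hy0.symm
    have h4 : y < 2 * Real.pi := by
      have := lt_of_le_of_ne hy.2 hy2
      linarith
    rw [zero_add] at hj
    have h5 : (0 : ℝ) < j := by by_contra h; push Not at h; nlinarith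
    have h6 : (j : ℝ) < 1 := by by_contra h; push Not at h; nlinarith
    have h7 : 0 < j := by exact_mod_cast h5
    have h8 : j < 1 := by exact_mod_cast h6
    omega
  have hdc : Continuous (deriv φ) := hφ.continuous_deriv_one
  have hd := hφ.differentiable one_ne_zero
  have hsign : (∀ x, 0 < deriv φ x) ∨ (∀ x, deriv φ x < 0) := by
    by_contra hcon
    push Not at hcon
    obtain ⟨⟨x, hx⟩, ⟨y, hy⟩⟩ := hcon
    obtain ⟨z, hz⟩ := mem_range_of_exists_le_of_exists_ge hdc ⟨x, hx⟩ ⟨y, hy⟩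
    exact h0 z hz
  rcases hsign with h | h
  · exact ⟨1, Or.inl rfl, main φ k hd h hper hinj, fun x => by simpa using h x⟩
  · refine ⟨-1, Or.inr rfl, ?_, fun x => by simpa using h x⟩
    have := main (fun x => -φ x) (-k) hd.neg (fun x => by rw [deriv.fun_neg]; linarith [h x])
      (fun x => by simp only [hper]; push_cast; ring)
      (fun x y ⟨j, hj⟩ => hinj x y ⟨-j, by push_cast; linarith⟩)
    omega

end

/-! ### Straightening a tube around the standard great circle -/

section

/-- A block determinant: position and velocity of the core span the first coordinate plane and
contribute `a`, so only the components of the frame in the second plane matter. -/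
theorem det4_plane (a : ℝ) (x y z w : R4) (α β : ℝ)
    (hx : x = !₂[Real.cos α, Real.sin α, 0, 0])
    (hy : y = !₂[-(a * Real.sin α), a * Real.cos α, 0, 0])
    (hβ : β = z 2 * w 3 - z 3 * w 2) : det4 x y z w = a * β := by
  have h := Real.sin_sq_add_cos_sq α
  rw [det4_eq, hx, hy, hβ]
  simp only [Matrix.cons_val]
  linear_combination (a * (z 2 * w 3 - z 3 * w 2)) * h

/-- A framed tube is isotopic to one whose angles are linear. -/
theorem isotopicOn_framed_linear {φ μ : ℝ → ℝ} (hφ : ContDiff ℝ ∞ φ) (hμ : ContDiff ℝ ∞ μ)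
    {ε m : ℤ} (hε : ε = 1 ∨ ε = -1) (hφp : ∀ x, φ (x + 2 * Real.pi) = φ x + 2 * Real.pi * ε)
    (hμp : ∀ x, μ (x + 2 * Real.pi) = μ x + 2 * Real.pi * m) (hpos : ∀ x, 0 < ε * deriv φ x) :
    ∃ δ > 0, IsotopicOn (tube δ) (fun p => toS3 (framed ε φ μ p))
      (fun p => toS3 (framed ε (fun ρ => ε * ρ) (fun ρ => m * ρ) p)) := by
  have hε2 : (ε : ℝ) * ε = 1 := by rcases hε with h | h <;> simp [h]
  -- Each angle and its linear model have the same increment over a period, so convex combinations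
  -- keep periodicity; they also keep the sign `ε` of the core speed.
  let a : ℝ → ℝ → ℝ := fun s ρ => (1 - s) * φ ρ + s * (ε * ρ)
  let b : ℝ → ℝ → ℝ := fun s ρ => (1 - s) * μ ρ + s * (m * ρ)
  let W : ℝ × (ℝ × ℂ) → R4 := fun x => framed ε (a x.1) (b x.1) x.2
  have hφ1 := hφ.of_le (m := 1) (by simp)
  have hμ1 := hμ.of_le (m := 1) (by simp)
  have hW : ContDiff ℝ 1 W := by
    apply contDiff_framed (a := fun x : ℝ × (ℝ × ℂ) => a x.1)
      (b := fun x : ℝ × (ℝ × ℂ) => b x.1) (q := fun x : ℝ × (ℝ × ℂ) => x.2)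
    · have : ContDiff ℝ 1 fun x : ℝ × (ℝ × ℂ) => φ x.2.1 := hφ1.comp (by fun_prop)
      simp only [a]
      fun_prop
    · have : ContDiff ℝ 1 fun x : ℝ × (ℝ × ℂ) => μ x.2.1 := hμ1.comp (by fun_prop)
      simp only [b]
      fun_prop
    · fun_prop
  have had : ∀ s ρ, HasDerivAt (a s) ((1 - s) * deriv φ ρ + s * ε) ρ := fun s ρ => by
    have h1 := ((hφ1.differentiable one_ne_zero ρ).hasDerivAt.const_mul (1 - s)).fun_add
      (((hasDerivAt_id ρ).const_mul (ε : ℝ)).const_mul s)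
    refine h1.congr_deriv (by simp)
  have hap : ∀ s ρ, a s (ρ + 2 * Real.pi) = a s ρ + 2 * Real.pi * ε := fun s ρ => by
    simp only [a, hφp]; ring
  have hbp : ∀ s ρ, b s (ρ + 2 * Real.pi) = b s ρ + 2 * Real.pi * m := fun s ρ => by
    simp only [b, hμp]; ring
  have hapos : ∀ s ∈ Set.Icc (0 : ℝ) 1, ∀ ρ, 0 < ε * ((1 - s) * deriv φ ρ + s * ε) := by
    intro s hs ρ
    have h1 := hpos ρ
    have h2 : ε * ((1 - s) * deriv φ ρ + s * ε) = (1 - s) * (ε * deriv φ ρ) + s := by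
      linear_combination s * hε2
    rw [h2]
    obtain ⟨h3, h4⟩ := hs
    rcases h4.lt_or_eq with h | h
    · have := mul_pos (sub_pos.2 h) h1; linarith
    · rw [h]; simp
  have hper : ∀ s ρ v, W (s, ρ + 2 * Real.pi, v) = W (s, ρ, v) := fun s ρ v =>
    framed_periodic (ε : ℝ) (hap s ρ) (hbp s ρ) v
  have hW0 : ∀ s ρ, W (s, ρ, 0) = !₂[Real.cos (a s ρ), Real.sin (a s ρ), 0, 0] := fun s ρ =>
    framed_zero _ _ _ _
  have hinj : ∀ s ∈ Set.Icc (0 : ℝ) 1, ∀ ρ ρ' : ℝ, toS3 (W (s, ρ, 0)) = toS3 (W (s, ρ', 0)) →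
      ∃ k : ℤ, ρ' = ρ + 2 * Real.pi * k := by
    intro s hs ρ ρ' heq
    have h1 : (toS3 (W (s, ρ, 0)) : R4) = toS3 (W (s, ρ', 0)) := by rw [heq]
    rw [toS3_of_norm_one (norm_framed_zero _ _ _ _), toS3_of_norm_one (norm_framed_zero _ _ _ _),
      framed_zero, framed_zero] at h1
    have h2 := congrArg (fun x : R4 => x 0) h1
    have h3 := congrArg (fun x : R4 => x 1) h1
    simp only [Matrix.cons_val] at h2 h3
    obtain ⟨k, hk⟩ := eq_add_of_cos_sin_eq h2 h3
    -- A shift of the parameter by `ε k` turns changes the angle by `k` turns, since `ε² = 1`;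
    -- monotonicity of `ε a` then identifies the two points.
    refine ⟨ε * k, ?_⟩
    have hinj : Function.Injective (fun x => ε * a s x) := by
      apply StrictMono.injective
      apply strictMono_of_deriv_pos
      intro x
      rw [((had s x).const_mul (ε : ℝ)).deriv]
      exact hapos s hs x
    have hak : a s (ρ + 2 * Real.pi * (ε * k : ℤ)) = a s ρ + 2 * Real.pi * k := by
      have h4 : Function.Periodic (fun x => a s x - ε * x) (2 * Real.pi) := fun x => by
        simp only [hap]; ring
      have h5 : a s (ρ + (ε * k : ℤ) * (2 * Real.pi)) - ε * (ρ + (ε * k : ℤ) * (2 * Real.pi)) =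
        a s ρ - ε * ρ := h4.int_mul (ε * k) ρ
      rw [mul_comm (2 * Real.pi)]
      push_cast at h5 ⊢
      linear_combination h5 + (2 * Real.pi * k) * hε2
    apply hinj
    change ε * a s ρ' = ε * a s _
    rw [hak, hk]
  have himm : ∀ s ∈ Set.Icc (0 : ℝ) 1, ∀ ρ : ℝ, ImmersiveAt W s (ρ, 0) := by
    intro s hs ρ
    have h1 := hasFDerivAt_slice (hW.differentiable one_ne_zero) s (ρ, (0 : ℂ))
    rw [immersiveAt_iff (hW.differentiable one_ne_zero) h1]
    have h1' : HasFDerivAt (framed ε (a s) (b s)) ((fderiv ℝ W (s, (ρ, 0))).comp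
        (ContinuousLinearMap.inr ℝ ℝ (ℝ × ℂ))) (ρ, 0) := h1
    obtain ⟨h2, h3, h4⟩ := framed_jet (a := a s) (b := b s) (ε : ℝ) (had s ρ) h1'
    rw [jetDet, h2, h3, h4, det4_plane ((1 - s) * deriv φ ρ + s * ε) _ _ _ _ (a s ρ) ε
      (hW0 s ρ) rfl]
    · have := hapos s hs ρ
      rw [mul_comm] at this
      exact this.ne'
    · have h := Real.sin_sq_add_cos_sq (b s ρ)
      simp only [Matrix.cons_val]
      linear_combination -(ε : ℝ) * h
  obtain ⟨δ, hδ, h⟩ := isotopicOn_tube (W := W) (r := 0) (R := 1) hW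
    (fun s _ ρ v _ => hper s ρ v)
    (fun s hs p q hp hq heq => by
      obtain ⟨ρ, v⟩ := p
      obtain ⟨ρ', v'⟩ := q
      obtain rfl : v = 0 := norm_le_zero_iff.1 hp
      obtain rfl : v' = 0 := norm_le_zero_iff.1 hq
      exact ⟨rfl, hinj s hs ρ ρ' heq⟩)
    (fun s hs p hp => by
      obtain ⟨ρ, v⟩ := p
      obtain rfl : v = 0 := norm_le_zero_iff.1 hp
      exact himm s hs ρ)
  refine ⟨min 1 (0 + δ), by positivity, ?_⟩
  have e0 : ∀ p, framed ε φ μ p = W (0, p) := fun p => by simp [W, a, b, framed]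
  have e1 : ∀ p, framed ε (fun ρ => ε * ρ) (fun ρ => m * ρ) p = W (1, p) := fun p => by
    simp [W, a, b, framed]
  simp only [e0, e1]
  exact h

/-- A tube around the standard great circle is isotopic to a standard one. -/
theorem exists_isotopicOn_framed {Φ : ℝ × ℂ → S3} (hΦ : ContDiff ℝ ∞ (fun p => (Φ p : R4)))
    (hper : ∀ ρ v, Φ (ρ + 2 * Real.pi, v) = Φ (ρ, v))
    (hdet : ∀ ρ, 0 < jetDet (Φ (ρ, 0)) (fderiv ℝ (fun p => (Φ p : R4)) (ρ, 0)))
    (hinj : ∀ ρ ρ', Φ (ρ, 0) = Φ (ρ', 0) → ∃ k : ℤ, ρ' = ρ + 2 * Real.pi * k)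
    (hgc : ∀ ρ, Φ (ρ, 0) ∈ greatCircle) :
    ∃ ε m : ℤ, (ε = 1 ∨ ε = -1) ∧ ∃ δ > 0, IsotopicOn (tube δ) Φ
      (fun p => toS3 (framed ε (fun ρ => ε * ρ) (fun ρ => m * ρ) p)) := by
  set D : ℝ → ℝ × ℂ →L[ℝ] R4 := fun ρ => fderiv ℝ (fun p => (Φ p : R4)) (ρ, 0) with hD
  have hDs : ContDiff ℝ ∞ D := (hΦ.fderiv_right (by simp)).comp (by fun_prop)
  have hΦd : ∀ p, HasFDerivAt (fun p => (Φ p : R4)) (fderiv ℝ (fun p => (Φ p : R4)) p) p :=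
    fun p => (hΦ.differentiable (by simp) p).hasFDerivAt
  have hDper : ∀ ρ, D (ρ + 2 * Real.pi) = D ρ := by
    intro ρ
    have h1 : HasFDerivAt (fun p : ℝ × ℂ => (Φ (p + (2 * Real.pi, 0)) : R4))
        (D (ρ + 2 * Real.pi)) (ρ, 0) := by
      have h2 : HasFDerivAt (fun p => (Φ p : R4)) (D (ρ + 2 * Real.pi))
          ((ρ, (0 : ℂ)) + (2 * Real.pi, 0)) := by
        simpa [hD] using hΦd (ρ + 2 * Real.pi, 0)
      exact h2.comp (ρ, (0 : ℂ))
        ((hasFDerivAt_id (𝕜 := ℝ) (ρ, (0 : ℂ))).add_const (2 * Real.pi, (0 : ℂ)))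
    have h2 : (fun p : ℝ × ℂ => (Φ (p + (2 * Real.pi, 0)) : R4)) = fun p => (Φ p : R4) := by
      funext p
      have := hper p.1 p.2
      simp [Prod.add_def, this]
    rw [h2] at h1
    exact h1.unique (hΦd _)
  have hC : ContDiff ℝ ∞ (fun ρ => Complex.mk ((Φ (ρ, 0) : R4) 0) ((Φ (ρ, 0) : R4) 1)) := by
    have h1 : ContDiff ℝ ∞ (fun ρ => (Φ (ρ, 0) : R4)) := hΦ.comp (by fun_prop)
    have h2 := contDiff_euclidean.1 h1
    have h3 : (fun ρ => Complex.mk ((Φ (ρ, 0) : R4) 0) ((Φ (ρ, 0) : R4) 1)) =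
        fun ρ => (Complex.ofRealCLM ((Φ (ρ, 0) : R4) 0)) +
          (Complex.ofRealCLM ((Φ (ρ, 0) : R4) 1)) * Complex.I := by
      funext ρ; simp [Complex.ext_iff]
    rw [h3]
    exact (Complex.ofRealCLM.contDiff.comp (h2 0)).add
      ((Complex.ofRealCLM.contDiff.comp (h2 1)).mul contDiff_const)
  have hgc' : ∀ ρ, (Φ (ρ, 0) : R4) 2 = 0 ∧ (Φ (ρ, 0) : R4) 3 = 0 := hgc
  have hnorm : ∀ ρ, ‖Complex.mk ((Φ (ρ, 0) : R4) 0) ((Φ (ρ, 0) : R4) 1)‖ = 1 := by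
    intro ρ
    have h1 := S3.norm_coe (Φ (ρ, 0))
    rw [EuclideanSpace.norm_eq, Real.sqrt_eq_one] at h1
    simp [Fin.sum_univ_succ, hgc' ρ] at h1
    rw [Complex.norm_def, Real.sqrt_eq_one, Complex.normSq_mk]
    linarith
  obtain ⟨φ, k, hφ, hφC, hφp⟩ := exists_smooth_arg hC
    (fun ρ h => by have := hnorm ρ; rw [h] at this; simp at this)
    (fun ρ => by simp only [hper])
  have hcore : ∀ ρ, (Φ (ρ, 0) : R4) = !₂[Real.cos (φ ρ), Real.sin (φ ρ), 0, 0] := by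
    intro ρ
    have h1 := hφC ρ
    rw [hnorm, one_mul, one_mul] at h1
    ext i
    fin_cases i
    · exact h1.1
    · exact h1.2
    · exact (hgc' ρ).1
    · exact (hgc' ρ).2
  have hφd : ∀ ρ, HasDerivAt φ (deriv φ ρ) ρ := fun ρ =>
    (hφ.differentiable (by simp) ρ).hasDerivAt
  have hD1 : ∀ ρ, D ρ (1, 0) =
      !₂[-(deriv φ ρ * Real.sin (φ ρ)), deriv φ ρ * Real.cos (φ ρ), 0, 0] := by
    intro ρ
    have ha0 : HasDerivAt (fun t : ℝ => φ (ρ + t)) (deriv φ ρ) 0 := by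
      have h1 : HasDerivAt φ (deriv φ ρ) (ρ + 0) := by simpa using hφd ρ
      exact h1.comp_const_add ρ 0
    ext j
    apply fderiv_coord (hΦd (ρ, 0))
    have e : ∀ t : ℝ, (Φ ((ρ, (0 : ℂ)) + t • ((1 : ℝ), (0 : ℂ))) : R4) =
        !₂[Real.cos (φ (ρ + t)), Real.sin (φ (ρ + t)), 0, 0] := fun t => by
      rw [← hcore]; simp
    simp only [e]
    fin_cases j
    · simpa [mul_comm] using ha0.cos
    · simpa [mul_comm] using ha0.sin
    · simpa using hasDerivAt_const (0 : ℝ) (0 : ℝ)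
    · simpa using hasDerivAt_const (0 : ℝ) (0 : ℝ)
  set u : ℝ → R4 := fun ρ => D ρ (0, 1) with hu
  set w : ℝ → R4 := fun ρ => D ρ (0, Complex.I) with hw
  have hdet' : ∀ ρ, 0 < deriv φ ρ * (u ρ 2 * w ρ 3 - u ρ 3 * w ρ 2) := by
    intro ρ
    have := hdet ρ
    rwa [jetDet, det4_plane (deriv φ ρ) _ _ _ _ (φ ρ) _ (hcore ρ) (hD1 ρ) rfl] at this
  obtain ⟨ε, hε, hkε, hpos⟩ := exists_sign (hφ.of_le (by simp))
    (fun x h => by have := hdet' x; rw [h, zero_mul] at this; exact lt_irrefl _ this) hφp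
    (fun x y ⟨j, hj⟩ => by
      apply hinj
      apply Subtype.ext
      rw [hcore, hcore, hj, mul_comm (2 * Real.pi), Real.cos_add_int_mul_two_pi,
        Real.sin_add_int_mul_two_pi])
  rw [hkε] at hφp
  have hε2 : (ε : ℝ) * ε = 1 := by rcases hε with h | h <;> simp [h]
  -- A positively oriented tube whose core runs in direction `ε` has a normal frame of orientation
  -- `ε`. This is why `framed` multiplies the second normal vector by `ε`.
  have hB : ∀ ρ, 0 < ε * (u ρ 2 * w ρ 3 - u ρ 3 * w ρ 2) := by
    intro ρ
    have h1 := mul_pos (hpos ρ) (hdet' ρ)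
    have h2 : ε * deriv φ ρ * (deriv φ ρ * (u ρ 2 * w ρ 3 - u ρ 3 * w ρ 2)) =
      (deriv φ ρ) ^ 2 * (ε * (u ρ 2 * w ρ 3 - u ρ 3 * w ρ 2)) := by ring
    rw [h2] at h1
    exact pos_of_mul_pos_right h1 (sq_nonneg _)
  have hU : ContDiff ℝ ∞ (fun ρ => Complex.mk (u ρ 2) (u ρ 3)) := by
    have h1 : ContDiff ℝ ∞ u := hDs.clm_apply contDiff_const
    have h2 := contDiff_euclidean.1 h1
    have h3 : (fun ρ => Complex.mk (u ρ 2) (u ρ 3)) =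
        fun ρ => (Complex.ofRealCLM (u ρ 2)) + (Complex.ofRealCLM (u ρ 3)) * Complex.I := by
      funext ρ; simp [Complex.ext_iff]
    rw [h3]
    exact (Complex.ofRealCLM.contDiff.comp (h2 2)).add
      ((Complex.ofRealCLM.contDiff.comp (h2 3)).mul contDiff_const)
  have hU0 : ∀ ρ, Complex.mk (u ρ 2) (u ρ 3) ≠ 0 := by
    intro ρ h
    have h1 := congrArg Complex.re h
    have h2 := congrArg Complex.im h
    simp only [Complex.zero_re, Complex.zero_im] at h1 h2
    have := hB ρ
    rw [h1, h2] at this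
    simp at this
  obtain ⟨μ, m, hμ, hμU, hμp⟩ := exists_smooth_arg hU hU0 (fun ρ => by simp only [hu, hDper])
  refine ⟨ε, m, hε, ?_⟩
  -- The straight line from `Φ` to the framed model is constant on the core, so injectivity there is
  -- inherited and only the normal derivatives have to be checked. The angle `μ` is that of the
  -- first normal vector, which makes the two frames comparable.
  let W : ℝ × (ℝ × ℂ) → R4 := fun x => (1 - x.1) • (Φ x.2 : R4) + x.1 • framed ε φ μ x.2
  have hW : ContDiff ℝ 1 W := by
    have h1 := hΦ.of_le (m := 1) (by simp)
    have h2 : ContDiff ℝ 1 (fun x : ℝ × (ℝ × ℂ) => framed ε φ μ x.2) :=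
      contDiff_framed (a := fun _ => φ) (b := fun _ => μ) (q := fun x : ℝ × (ℝ × ℂ) => x.2) _
        ((hφ.of_le (m := 1) (by simp)).comp (by fun_prop))
        ((hμ.of_le (m := 1) (by simp)).comp (by fun_prop)) (by fun_prop)
    have h3 : ContDiff ℝ 1 (fun x : ℝ × (ℝ × ℂ) => (Φ x.2 : R4)) := h1.comp (by fun_prop)
    simp only [W]
    fun_prop
  have hW0 : ∀ s ρ, W (s, (ρ, 0)) = Φ (ρ, 0) := by
    intro s ρ
    simp only [W]
    rw [hcore, framed_zero, ← add_smul]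
    simp
  obtain ⟨δ, hδ, h⟩ := isotopicOn_tube (W := W) (r := 0) (R := 1) hW
    (fun s hs ρ v hv => by
      simp only [W, hper, framed_periodic _ (hφp ρ) (hμp ρ)])
    (fun s hs p q hp hq heq => by
      obtain ⟨ρ, v⟩ := p
      obtain ⟨ρ', v'⟩ := q
      obtain rfl : v = 0 := by simpa using hp
      obtain rfl : v' = 0 := by simpa using hq
      rw [hW0, hW0, toS3_coe, toS3_coe] at heq
      exact ⟨rfl, hinj _ _ heq⟩)
    (fun s hs p hp => by
      obtain ⟨ρ, v⟩ := p
      obtain rfl : v = 0 := by simpa using hp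
      have hfd : Differentiable ℝ (framed ε φ μ) :=
        (contDiff_framed (a := fun _ => φ) (b := fun _ => μ) (q := fun x : ℝ × ℂ => x) _
          ((hφ.of_le (m := 1) (by simp)).comp (by fun_prop))
          ((hμ.of_le (m := 1) (by simp)).comp (by fun_prop)) (by fun_prop)).differentiable
            one_ne_zero
      obtain ⟨e1, e2, e3⟩ := framed_jet (ε : ℝ) (b := μ) (hφd ρ) (hfd (ρ, 0)).hasFDerivAt
      have h1 := ((hΦd (ρ, 0)).const_smul (1 - s)).add ((hfd (ρ, 0)).hasFDerivAt.const_smul s)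
      rw [immersiveAt_iff (hW.differentiable one_ne_zero) h1, jetDet, hW0]
      have d1 : ((1 - s) • D ρ + s • fderiv ℝ (framed ε φ μ) (ρ, 0)) (1, 0) =
          !₂[-(deriv φ ρ * Real.sin (φ ρ)), deriv φ ρ * Real.cos (φ ρ), 0, 0] := by
        rw [add_apply, smul_apply, smul_apply, e1, hD1, ← add_smul]
        simp
      have d2 : ((1 - s) • D ρ + s • fderiv ℝ (framed ε φ μ) (ρ, 0)) (0, 1) =
          (1 - s) • u ρ + s • !₂[0, 0, Real.cos (μ ρ), Real.sin (μ ρ)] := by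
        rw [add_apply, smul_apply, smul_apply, e2]
      have d3 : ((1 - s) • D ρ + s • fderiv ℝ (framed ε φ μ) (ρ, 0)) (0, Complex.I) =
          (1 - s) • w ρ + s • !₂[0, 0, -(ε * Real.sin (μ ρ)), ε * Real.cos (μ ρ)] := by
        rw [add_apply, smul_apply, smul_apply, e3]
      rw [d1, d2, d3, det4_plane (deriv φ ρ) _ _ _ _ (φ ρ) _ (hcore ρ) rfl rfl]
      apply mul_ne_zero
      · intro h; have := hpos ρ; rw [h, mul_zero] at this; exact lt_irrefl _ this
      obtain ⟨r1, r2⟩ := hμU ρ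
      set r := ‖Complex.mk (u ρ 2) (u ρ 3)‖ with hr
      have hrpos : 0 < r := norm_pos_iff.2 (hU0 ρ)
      simp only at r1 r2
      have hBρ := hB ρ
      have hcs := Real.sin_sq_add_cos_sq (μ ρ)
      simp only [PiLp.add_apply, PiLp.smul_apply, Matrix.cons_val, smul_eq_mul]
      rw [r1, r2] at hBρ ⊢
      set c := Real.cos (μ ρ)
      set d := Real.sin (μ ρ)
      have hq : 0 < ε * (c * w ρ 3 - d * w ρ 2) := by
        have h2 : ε * (r * c * w ρ 3 - r * d * w ρ 2) = r * (ε * (c * w ρ 3 - d * w ρ 2)) := by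
          ring
        rw [h2] at hBρ
        exact pos_of_mul_pos_right hBρ hrpos.le
      obtain ⟨hs0, hs1⟩ := hs
      -- Up to the sign `ε`, this product is the normal determinant at time `s`. In it `r` is the
      -- length of the normal part of `u`, the model vector has the same direction and length 1, and
      -- each factor is a convex combination of a positive number with 1.
      have hfac : 0 < ((1 - s) * r + s) * ((1 - s) * (ε * (c * w ρ 3 - d * w ρ 2)) + s) := by
        rcases hs1.lt_or_eq with h | h
        · have h3 := sub_pos.2 h
          have := mul_pos h3 hrpos
          have := mul_pos h3 hq
          apply mul_pos <;> linarith
        · rw [h]; simp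
      intro h0
      have h4 : ((1 - s) * r + s) * ((1 - s) * (ε * (c * w ρ 3 - d * w ρ 2)) + s) = 0 := by
        linear_combination (ε : ℝ) * h0 - (((1 - s) * r + s) * s) * hε2 * (c ^ 2 + d ^ 2) -
          (((1 - s) * r + s) * s) * hcs
      exact hfac.ne' h4)
  obtain ⟨δ', hδ', h'⟩ := isotopicOn_framed_linear hφ hμ hε hφp hμp hpos
  refine ⟨min (min 1 (0 + δ)) δ', by positivity, IsotopicOn.trans (ψ' := fun p => toS3 (W (1, p)))
    ?_ ?_⟩
  · have h2 : Φ = fun p => toS3 (W (0, p)) := by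
      funext p; simp [W, toS3_coe]
    rw [h2]
    refine h.mono fun p hp => ?_
    exact le_trans (show ‖p.2‖ ≤ _ from hp) (min_le_left _ _)
  · have h2 : (fun p => toS3 (W (1, p))) = fun p => toS3 (framed ε φ μ p) := by
      funext p; simp [W]
    rw [h2]
    refine h'.mono fun p hp => ?_
    exact le_trans (show ‖p.2‖ ≤ _ from hp) (min_le_right _ _)

/-- The thickening is isotopic to a standard solid torus, up to the framing `m`. -/
theorem exists_isotopicOn_standard {K : Set S3} (hK : IsTrivialKnot K) {F : CharacteristicBand K}
    (N : Thickening F) : ∃ ε m : ℤ, (ε = 1 ∨ ε = -1) ∧ ∃ δ : ℝ, 0 < δ ∧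
      IsotopicOn (tube 1) (fun p => N.coord p.1 p.2)
        (fun p => toS3 (framed ε (fun ρ => ε * ρ) (fun ρ => m * ρ) (p.1, δ * p.2))) := by
  obtain ⟨Φ, h1, h2, h3, h4, h5, δ₁, hδ₁, h6⟩ := exists_tube_on_greatCircle hK N
  obtain ⟨ε, m, hε, δ₂, hδ₂, h7⟩ := exists_isotopicOn_framed h1 h2 h3 h4 h5
  refine ⟨ε, m, hε, min 1 (min δ₁ δ₂), by positivity, ?_⟩
  -- Both isotopies are available on thin tubes only, so the solid torus is shrunk into a common one
  -- first.
  set δ := min 1 (min δ₁ δ₂) with hδ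
  have hδ0 : 0 < δ := by positivity
  refine (N.isotopicOn_shrink hδ0 (min_le_left _ _)).trans ?_
  have h8 : IsotopicOn (tube δ) (fun p => N.coord p.1 p.2)
      (fun p => toS3 (framed ε (fun ρ => ε * ρ) (fun ρ => m * ρ) p)) := by
    refine (h6.mono fun p hp => ?_).trans (h7.mono fun p hp => ?_)
    · exact le_trans (show ‖p.2‖ ≤ _ from hp) ((min_le_right _ _).trans (min_le_left _ _))
    · exact le_trans (show ‖p.2‖ ≤ _ from hp) ((min_le_right _ _).trans (min_le_right _ _))
  refine h8.comp (fun p : ℝ × ℂ => (p.1, (δ : ℂ) * p.2)) fun p hp => ?_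
  change ‖(δ : ℂ) * p.2‖ ≤ δ
  rw [norm_mul, Complex.norm_real, Real.norm_of_nonneg hδ0.le]
  exact mul_le_of_le_one_right hδ0.le hp

end

section

/-! ### The linking form -/

theorem real_inner_eq (a b : R4) : inner ℝ a b = a 0 * b 0 + a 1 * b 1 + a 2 * b 2 + a 3 * b 3 := by
  simp [PiLp.inner_apply, Fin.sum_univ_succ]
  ring

@[fun_prop]
theorem continuous_det4 {T : Type*} [TopologicalSpace T] {a b c d : T → R4} (ha : Continuous a)
    (hb : Continuous b) (hc : Continuous c) (hd : Continuous d) :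
    Continuous fun x => det4 (a x) (b x) (c x) (d x) := by
  simp only [det4_eq]
  fun_prop

theorem HasDerivAt.coord {f : ℝ → R4} {f' : R4} {x : ℝ} (h : HasDerivAt f f' x) (i : Fin 4) :
    HasDerivAt (fun x => f x i) (f' i) x :=
  (EuclideanSpace.proj (𝕜 := ℝ) i).hasFDerivAt.comp_hasDerivAt x h

theorem hasDerivAt_det4 {a b c d : ℝ → R4} {a' b' c' d' : R4} {x : ℝ} (ha : HasDerivAt a a' x)
    (hb : HasDerivAt b b' x) (hc : HasDerivAt c c' x) (hd : HasDerivAt d d' x) :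
    HasDerivAt (fun x => det4 (a x) (b x) (c x) (d x))
      (det4 a' (b x) (c x) (d x) + det4 (a x) b' (c x) (d x) + det4 (a x) (b x) c' (d x) +
        det4 (a x) (b x) (c x) d') x := by
  have A := fun i => HasDerivAt.coord ha i
  have B := fun i => HasDerivAt.coord hb i
  have C := fun i => HasDerivAt.coord hc i
  have D := fun i => HasDerivAt.coord hd i
  have M := fun i j => ((C i).fun_mul (D j)).fun_sub ((C j).fun_mul (D i))
  have T := fun i j k => ((B i).fun_mul (M j k)).fun_sub ((B j).fun_mul (M i k)) |>.fun_add
    ((B k).fun_mul (M i j))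
  have h := ((((A 0).fun_mul (T 1 2 3)).fun_sub ((A 1).fun_mul (T 0 2 3))).fun_add
    ((A 2).fun_mul (T 0 1 3))).fun_sub ((A 3).fun_mul (T 0 1 2))
  simp only [det4_eq]
  refine h.congr_deriv ?_
  ring

theorem hasDerivAt_div_sq {D N : ℝ → ℝ} {D' N' x : ℝ} (hD : HasDerivAt D D' x)
    (hN : HasDerivAt N N' x) (h0 : N x ≠ 0) :
    HasDerivAt (fun x => D x / N x ^ 2) (D' / N x ^ 2 - 2 * N' * D x / N x ^ 3) x := by
  refine (hD.fun_div (hN.fun_pow 2) (pow_ne_zero 2 h0)).congr_deriv ?_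
  field_simp
  norm_num
  ring

theorem hasDerivAt_inner_self {V : ℝ → R4} {V' : R4} {x : ℝ} (hV : HasDerivAt V V' x) :
    HasDerivAt (fun x => inner ℝ (V x) (V x)) (2 * inner ℝ (V x) V') x := by
  refine (hV.inner ℝ hV).congr_deriv ?_
  rw [real_inner_comm]; ring

/-- The point at parameter `u` on the segment from `X` to `-y`. -/
def joinPt (u : ℝ) (X y : R4) : R4 := (1 - u) • X - u • y

/-- The integrand of the linking integral. -/
def linkForm (u : ℝ) (X ξ y η : R4) : ℝ :=
  u * (1 - u) * det4 X ξ y η / inner ℝ (joinPt u X y) (joinPt u X y) ^ 2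

/-- The variation of `linkForm` along `X ↦ X + r d`, `ξ ↦ ξ + r δ`. -/
def linkVar (u : ℝ) (X ξ d δ y η : R4) : ℝ :=
  (u * (1 - u) * (det4 d ξ y η + det4 X δ y η)) / inner ℝ (joinPt u X y) (joinPt u X y) ^ 2 -
    2 * (2 * inner ℝ (joinPt u X y) ((1 - u) • d)) * (u * (1 - u) * det4 X ξ y η) /
      inner ℝ (joinPt u X y) (joinPt u X y) ^ 3

/-- The derivative of `(1 - u)² det (X, ξ, d, y) / |V|⁴` along the second curve. -/
def linkSnd (u : ℝ) (X ξ d y η : R4) : ℝ :=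
  ((1 - u) ^ 2 * det4 X ξ d η) / inner ℝ (joinPt u X y) (joinPt u X y) ^ 2 -
    2 * (2 * inner ℝ (joinPt u X y) (-(u • η))) * ((1 - u) ^ 2 * det4 X ξ d y) /
      inner ℝ (joinPt u X y) (joinPt u X y) ^ 3

/-- The derivative of `(1 - u)² u det (V, ξ, d, η) / |V|⁴` in the direction of `u`. -/
def linkThd (u : ℝ) (X ξ d y η : R4) : ℝ :=
  (((1 - u) * (1 - 3 * u)) * det4 (joinPt u X y) ξ d η +
      (1 - u) ^ 2 * u * det4 (-(X + y)) ξ d η) / inner ℝ (joinPt u X y) (joinPt u X y) ^ 2 -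
    2 * (2 * inner ℝ (joinPt u X y) (-(X + y))) *
      ((1 - u) ^ 2 * u * det4 (joinPt u X y) ξ d η) /
      inner ℝ (joinPt u X y) (joinPt u X y) ^ 3

/-- Cramer's rule expands `det(a, b, c, d) V` in terms of `a, b, c, d`; pair the expansion with `V`.
-/
theorem inner_self_mul_det4 (V a b c d : R4) : inner ℝ V V * det4 a b c d =
    inner ℝ V a * det4 V b c d + inner ℝ V b * det4 a V c d + inner ℝ V c * det4 a b V d +
      inner ℝ V d * det4 a b c V := by
  simp only [real_inner_eq, det4_eq]
  ring

/-- This is closedness of the volume form on the sphere, in coordinates. When the first curve moves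
by `d`, the integrand changes by an exact expression: the first term is a derivative along the first
curve, whose velocity is `ξ` and along which `d` has derivative `δ`, the second a derivative along
the second curve, the third a derivative in `u`. After denominators are cleared, the identity is a
multiple of Cramer's rule for `V` corrected by the relation `i1` for `⟨V, X + y⟩`. -/
theorem linkVar_eq (u : ℝ) (X ξ d δ y η : R4) (h : joinPt u X y ≠ 0) :
    linkVar u X ξ d δ y η =
      linkVar u X d ξ δ y η + linkSnd u X ξ d y η - linkThd u X ξ d y η := by
  have hN : inner ℝ (joinPt u X y) (joinPt u X y) ≠ 0 := inner_self_ne_zero.2 h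
  have hc := inner_self_mul_det4 (joinPt u X y) d ξ y η
  set V := joinPt u X y with hV
  have hVi : ∀ i, V i = (1 - u) * X i - u * y i := fun i => by simp [hV, joinPt]
  have d1 : det4 V ξ y η = (1 - u) * det4 X ξ y η := by
    simp only [det4_eq, hVi]; ring
  have d2 : det4 d V y η = -(1 - u) * det4 X d y η := by
    simp only [det4_eq, hVi]; ring
  have d3 : det4 d ξ V η = -det4 V ξ d η := by
    simp only [det4_eq]; ring
  have d4 : det4 d ξ y V = (1 - u) * det4 X ξ d y := by
    simp only [det4_eq, hVi]; ring
  have d5 : det4 ξ d y η = -det4 d ξ y η := by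
    simp only [det4_eq]; ring
  have d6 : det4 V ξ d η = (1 - u) * det4 X ξ d η + u * det4 d ξ y η := by
    simp only [det4_eq, hVi]; ring
  have d7 : det4 (-(X + y)) ξ d η = -det4 X ξ d η + det4 d ξ y η := by
    simp only [det4_eq, PiLp.neg_apply, PiLp.add_apply]; ring
  have i1 : (1 - u) * inner ℝ V (-(X + y)) = -(inner ℝ V V + inner ℝ V y) := by
    simp only [real_inner_eq, hVi, PiLp.neg_apply, PiLp.add_apply]; ring
  have i2 : inner ℝ V (-(u • η)) = -(u * inner ℝ V η) := by
    rw [inner_neg_right, inner_smul_right]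
  rw [d1, d2, d3, d4, d6] at hc
  simp only [linkVar, linkSnd, linkThd, ← hV, inner_smul_right, i2, d5, d6, d7]
  generalize inner ℝ V V = N at *
  generalize inner ℝ V y = vy at *
  generalize inner ℝ V η = vη at *
  generalize inner ℝ V d = vd at *
  generalize inner ℝ V ξ = vξ at *
  generalize inner ℝ V (-(X + y)) = vw at *
  generalize det4 d ξ y η = D at *
  generalize det4 X ξ d η = a at *
  generalize det4 X ξ y η = e at *
  generalize det4 X d y η = f at *
  generalize det4 X ξ d y = g at *
  field_simp
  linear_combination (4 * u * (1 - u)) * hc -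
    (4 * (1 - u) * u * ((1 - u) * a + u * D)) * i1

end

/-! ### Measurability and uniform bounds for the linking integrands -/

section

open MeasureTheory

@[fun_prop]
theorem continuous_joinPt {T : Type*} [TopologicalSpace T] {u : T → ℝ} {a b : T → R4}
    (hu : Continuous u) (ha : Continuous a) (hb : Continuous b) :
    Continuous fun x => joinPt (u x) (a x) (b x) := by
  unfold joinPt
  fun_prop

theorem measurable_linkForm : Measurable (fun q : ℝ × R4 × R4 × R4 × R4 =>
    linkForm q.1 q.2.1 q.2.2.1 q.2.2.2.1 q.2.2.2.2) := by
  unfold linkForm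
  exact (Continuous.measurable (by fun_prop)).div (Continuous.measurable (by fun_prop))

theorem measurable_linkVar : Measurable (fun q : ℝ × R4 × R4 × R4 × R4 × R4 × R4 =>
    linkVar q.1 q.2.1 q.2.2.1 q.2.2.2.1 q.2.2.2.2.1 q.2.2.2.2.2.1 q.2.2.2.2.2.2) := by
  unfold linkVar
  exact ((Continuous.measurable (by fun_prop)).div (Continuous.measurable (by fun_prop))).sub
    ((Continuous.measurable (by fun_prop)).div (Continuous.measurable (by fun_prop)))

theorem measurable_linkSnd : Measurable (fun q : ℝ × R4 × R4 × R4 × R4 × R4 =>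
    linkSnd q.1 q.2.1 q.2.2.1 q.2.2.2.1 q.2.2.2.2.1 q.2.2.2.2.2) := by
  unfold linkSnd
  exact ((Continuous.measurable (by fun_prop)).div (Continuous.measurable (by fun_prop))).sub
    ((Continuous.measurable (by fun_prop)).div (Continuous.measurable (by fun_prop)))

theorem measurable_linkThd : Measurable (fun q : ℝ × R4 × R4 × R4 × R4 × R4 =>
    linkThd q.1 q.2.1 q.2.2.1 q.2.2.2.1 q.2.2.2.2.1 q.2.2.2.2.2) := by
  unfold linkThd
  exact ((Continuous.measurable (by fun_prop)).div (Continuous.measurable (by fun_prop))).sub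
    ((Continuous.measurable (by fun_prop)).div (Continuous.measurable (by fun_prop)))

theorem inner_self_pow_ne_zero {c : ℝ} (hc : 0 < c) {V : R4} (h : c ≤ ‖V‖) (n : ℕ) :
    inner ℝ V V ^ n ≠ 0 := by
  apply pow_ne_zero
  rw [inner_self_ne_zero]
  rintro rfl
  rw [norm_zero] at h
  linarith

/-- The arguments range over a compact set on which the denominator stays away from zero. Velocities
are merely bounded and measurable, so the bound is over all vectors of norm at most `M` and not
along a curve. -/
theorem exists_bound_linkForm (M : ℝ) {c : ℝ} (hc : 0 < c) :
    ∃ C, ∀ u ∈ Set.Icc (0 : ℝ) 1, ∀ X ξ y η : R4, ‖X‖ ≤ M → ‖ξ‖ ≤ M → ‖y‖ ≤ M →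
      ‖η‖ ≤ M → c ≤ ‖joinPt u X y‖ → ‖linkForm u X ξ y η‖ ≤ C := by
  set B := Metric.closedBall (0 : R4) M
  have hB : IsCompact B := isCompact_closedBall _ _
  have hK : IsCompact ((Set.Icc (0 : ℝ) 1 ×ˢ B ×ˢ B ×ˢ B ×ˢ B) ∩
      {q | c ≤ ‖joinPt q.1 q.2.1 q.2.2.2.1‖}) :=
    (isCompact_Icc.prod (hB.prod (hB.prod (hB.prod hB)))).inter_right
      (isClosed_le continuous_const (by fun_prop))
  obtain ⟨C, hC⟩ := hK.exists_bound_of_continuousOn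
    (f := fun q => linkForm q.1 q.2.1 q.2.2.1 q.2.2.2.1 q.2.2.2.2) (by
      unfold linkForm
      refine ContinuousOn.div ?_ ?_ ?_
      · exact Continuous.continuousOn (by fun_prop)
      · exact Continuous.continuousOn (by fun_prop)
      · exact fun q hq => inner_self_pow_ne_zero hc hq.2 _)
  refine ⟨C, fun u hu X ξ y η h1 h2 h3 h4 h => hC (u, X, ξ, y, η) ⟨⟨hu, ?_⟩, h⟩⟩
  simp [B, h1, h2, h3, h4]

theorem exists_bound_linkVar (M : ℝ) {c : ℝ} (hc : 0 < c) :
    ∃ C, ∀ u ∈ Set.Icc (0 : ℝ) 1, ∀ X ξ d δ y η : R4, ‖X‖ ≤ M → ‖ξ‖ ≤ M → ‖d‖ ≤ M → ‖δ‖ ≤ M →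
      ‖y‖ ≤ M → ‖η‖ ≤ M → c ≤ ‖joinPt u X y‖ → ‖linkVar u X ξ d δ y η‖ ≤ C := by
  set B := Metric.closedBall (0 : R4) M
  have hB : IsCompact B := isCompact_closedBall _ _
  have hK : IsCompact ((Set.Icc (0 : ℝ) 1 ×ˢ B ×ˢ B ×ˢ B ×ˢ B ×ˢ B ×ˢ B) ∩
      {q | c ≤ ‖joinPt q.1 q.2.1 q.2.2.2.2.2.1‖}) :=
    (isCompact_Icc.prod (hB.prod (hB.prod (hB.prod (hB.prod (hB.prod hB)))))).inter_right
      (isClosed_le continuous_const (by fun_prop))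
  obtain ⟨C, hC⟩ := hK.exists_bound_of_continuousOn
    (f := fun q => linkVar q.1 q.2.1 q.2.2.1 q.2.2.2.1 q.2.2.2.2.1 q.2.2.2.2.2.1 q.2.2.2.2.2.2) (by
      unfold linkVar
      refine ContinuousOn.sub (ContinuousOn.div ?_ ?_ ?_) (ContinuousOn.div ?_ ?_ ?_)
      · exact Continuous.continuousOn (by fun_prop)
      · exact Continuous.continuousOn (by fun_prop)
      · exact fun q hq => inner_self_pow_ne_zero hc hq.2 _
      · exact Continuous.continuousOn (by fun_prop)
      · exact Continuous.continuousOn (by fun_prop)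
      · exact fun q hq => inner_self_pow_ne_zero hc hq.2 _)
  refine ⟨C, fun u hu X ξ d δ y η h1 h2 h3 h4 h5 h6 h =>
    hC (u, X, ξ, d, δ, y, η) ⟨⟨hu, ?_⟩, h⟩⟩
  simp [B, h1, h2, h3, h4, h5, h6]

theorem exists_bound_linkSnd_linkThd (M : ℝ) {c : ℝ} (hc : 0 < c) :
    ∃ C, ∀ u ∈ Set.Icc (0 : ℝ) 1, ∀ X ξ d y η : R4, ‖X‖ ≤ M → ‖ξ‖ ≤ M → ‖d‖ ≤ M →
      ‖y‖ ≤ M → ‖η‖ ≤ M → c ≤ ‖joinPt u X y‖ →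
      ‖linkSnd u X ξ d y η‖ ≤ C ∧ ‖linkThd u X ξ d y η‖ ≤ C := by
  set B := Metric.closedBall (0 : R4) M
  have hB : IsCompact B := isCompact_closedBall _ _
  have hK : IsCompact ((Set.Icc (0 : ℝ) 1 ×ˢ B ×ˢ B ×ˢ B ×ˢ B ×ˢ B) ∩
      {q | c ≤ ‖joinPt q.1 q.2.1 q.2.2.2.2.1‖}) :=
    (isCompact_Icc.prod (hB.prod (hB.prod (hB.prod (hB.prod hB))))).inter_right
      (isClosed_le continuous_const (by fun_prop))
  obtain ⟨C, hC⟩ := hK.exists_bound_of_continuousOn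
    (f := fun q => linkSnd q.1 q.2.1 q.2.2.1 q.2.2.2.1 q.2.2.2.2.1 q.2.2.2.2.2) (by
      unfold linkSnd
      refine ContinuousOn.sub (ContinuousOn.div ?_ ?_ ?_) (ContinuousOn.div ?_ ?_ ?_)
      · exact Continuous.continuousOn (by fun_prop)
      · exact Continuous.continuousOn (by fun_prop)
      · exact fun q hq => inner_self_pow_ne_zero hc hq.2 _
      · exact Continuous.continuousOn (by fun_prop)
      · exact Continuous.continuousOn (by fun_prop)
      · exact fun q hq => inner_self_pow_ne_zero hc hq.2 _)
  obtain ⟨C', hC'⟩ := hK.exists_bound_of_continuousOn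
    (f := fun q => linkThd q.1 q.2.1 q.2.2.1 q.2.2.2.1 q.2.2.2.2.1 q.2.2.2.2.2) (by
      unfold linkThd
      refine ContinuousOn.sub (ContinuousOn.div ?_ ?_ ?_) (ContinuousOn.div ?_ ?_ ?_)
      · exact Continuous.continuousOn (by fun_prop)
      · exact Continuous.continuousOn (by fun_prop)
      · exact fun q hq => inner_self_pow_ne_zero hc hq.2 _
      · exact Continuous.continuousOn (by fun_prop)
      · exact Continuous.continuousOn (by fun_prop)
      · exact fun q hq => inner_self_pow_ne_zero hc hq.2 _)
  refine ⟨max C C', fun u hu X ξ d y η h1 h2 h3 h4 h5 h => ?_⟩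
  have hmem : (u, X, ξ, d, y, η) ∈ (Set.Icc (0 : ℝ) 1 ×ˢ B ×ˢ B ×ˢ B ×ˢ B ×ˢ B) ∩
      {q | c ≤ ‖joinPt q.1 q.2.1 q.2.2.2.2.1‖} := by
    refine ⟨⟨hu, ?_⟩, h⟩
    simp [B, h1, h2, h3, h4, h5]
  exact ⟨(hC _ hmem).trans (le_max_left _ _), (hC' _ hmem).trans (le_max_right _ _)⟩

/-! ### Lipschitz functions on a period -/

/-- A real function which is Lipschitz on `[0, 2π]`. -/
def LipOn (f : ℝ → ℝ) : Prop := ∃ K : ℝ, 0 ≤ K ∧ ∀ a ∈ Set.Icc 0 (2 * Real.pi),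
  ∀ b ∈ Set.Icc 0 (2 * Real.pi), |f a - f b| ≤ K * |a - b|

theorem LipOn.lipschitzOnWith {f : ℝ → ℝ} (h : LipOn f) :
    ∃ K : NNReal, LipschitzOnWith K f (Set.Icc 0 (2 * Real.pi)) := by
  obtain ⟨K, hK, h⟩ := h
  exact ⟨⟨K, hK⟩, LipschitzOnWith.of_dist_le_mul fun a ha b hb => h a ha b hb⟩

theorem LipOn.exists_bound {f : ℝ → ℝ} (h : LipOn f) :
    ∃ C, 0 ≤ C ∧ ∀ a ∈ Set.Icc 0 (2 * Real.pi), |f a| ≤ C := by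
  obtain ⟨K, hK⟩ := h.lipschitzOnWith
  obtain ⟨C, hC⟩ := isCompact_Icc.exists_bound_of_continuousOn hK.continuousOn
  exact ⟨|C|, abs_nonneg C, fun a ha => (hC a ha).trans (le_abs_self C)⟩

theorem LipOn.const (c : ℝ) : LipOn fun _ => c := ⟨0, le_rfl, by simp⟩

theorem LipOn.add {f g : ℝ → ℝ} (hf : LipOn f) (hg : LipOn g) : LipOn fun x => f x + g x := by
  obtain ⟨K, hK, h⟩ := hf
  obtain ⟨L, hL, h'⟩ := hg
  refine ⟨K + L, by positivity, fun a ha b hb => ?_⟩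
  rw [show f a + g a - (f b + g b) = (f a - f b) + (g a - g b) by ring, add_mul]
  exact (abs_add_le _ _).trans (add_le_add (h a ha b hb) (h' a ha b hb))

theorem LipOn.mul {f g : ℝ → ℝ} (hf : LipOn f) (hg : LipOn g) : LipOn fun x => f x * g x := by
  obtain ⟨C, hC, hfC⟩ := hf.exists_bound
  obtain ⟨D, hD, hgD⟩ := hg.exists_bound
  obtain ⟨K, hK, h⟩ := hf
  obtain ⟨L, hL, h'⟩ := hg
  refine ⟨K * D + C * L, by positivity, fun a ha b hb => ?_⟩
  rw [show f a * g a - f b * g b = (f a - f b) * g a + f b * (g a - g b) by ring]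
  refine (abs_add_le _ _).trans ?_
  rw [abs_mul, abs_mul]
  have h1 : |f a - f b| * |g a| ≤ K * |a - b| * D :=
    mul_le_mul (h a ha b hb) (hgD a ha) (abs_nonneg _) (by positivity)
  have h2 : |f b| * |g a - g b| ≤ C * (L * |a - b|) :=
    mul_le_mul (hfC b hb) (h' a ha b hb) (abs_nonneg _) hC
  linarith

theorem LipOn.sub {f g : ℝ → ℝ} (hf : LipOn f) (hg : LipOn g) : LipOn fun x => f x - g x := by
  have := hf.add ((LipOn.const (-1)).mul hg)
  simpa [sub_eq_add_neg] using this

theorem LipOn.inv {f : ℝ → ℝ} (hf : LipOn f) {c : ℝ} (hc : 0 < c)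
    (h : ∀ x ∈ Set.Icc 0 (2 * Real.pi), c ≤ f x) : LipOn fun x => (f x)⁻¹ := by
  obtain ⟨K, hK, hl⟩ := hf
  refine ⟨K / c ^ 2, by positivity, fun a ha b hb => ?_⟩
  have h1 := h a ha
  have h2 := h b hb
  have h3 : 0 < f a := by linarith
  have h4 : 0 < f b := by linarith
  rw [inv_sub_inv h3.ne' h4.ne', abs_div, abs_of_pos (mul_pos h3 h4), abs_sub_comm,
    div_mul_eq_mul_div]
  apply div_le_div₀ (by positivity) (hl a ha b hb) (by positivity)
  nlinarith

theorem LipOn.det4 {a b c d : ℝ → R4} (ha : ∀ i, LipOn fun x => a x i)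
    (hb : ∀ i, LipOn fun x => b x i) (hc : ∀ i, LipOn fun x => c x i)
    (hd : ∀ i, LipOn fun x => d x i) : LipOn fun x => det4 (a x) (b x) (c x) (d x) := by
  have M := fun i j => ((hc i).mul (hd j)).sub ((hc j).mul (hd i))
  have T := fun i j k => (((hb i).mul (M j k)).sub ((hb j).mul (M i k))).add
    ((hb k).mul (M i j))
  have h := ((((ha 0).mul (T 1 2 3)).sub ((ha 1).mul (T 0 2 3))).add
    ((ha 2).mul (T 0 1 3))).sub ((ha 3).mul (T 0 1 2))
  simp only [det4_eq]
  exact h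

theorem LipOn.inner {a b : ℝ → R4} (ha : ∀ i, LipOn fun x => a x i)
    (hb : ∀ i, LipOn fun x => b x i) : LipOn fun x => inner ℝ (a x) (b x) := by
  simp only [real_inner_eq]
  exact ((((ha 0).mul (hb 0)).add ((ha 1).mul (hb 1))).add ((ha 2).mul (hb 2))).add
    ((ha 3).mul (hb 3))

theorem LipOn.div_sq {D N : ℝ → ℝ} (hD : LipOn D) (hN : LipOn N) {c : ℝ} (hc : 0 < c)
    (h : ∀ x ∈ Set.Icc 0 (2 * Real.pi), c ≤ N x) : LipOn fun x => D x / N x ^ 2 := by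
  have := hD.mul ((hN.inv hc h).mul (hN.inv hc h))
  convert this using 2 with x
  rw [div_eq_mul_inv, sq, mul_inv]

/-- Lipschitz functions are absolutely continuous, so the fundamental theorem of calculus holds
although the curves have velocities only almost everywhere. -/
theorem LipOn.integral_eq_zero {f f' : ℝ → ℝ} (hf : LipOn f) (hd : ∀ᵐ s, HasDerivAt f (f' s) s)
    (hp : f (2 * Real.pi) = f 0) : ∫ s in Set.Ioc 0 (2 * Real.pi), f' s = 0 := by
  have hpi : (0 : ℝ) ≤ 2 * Real.pi := by positivity
  obtain ⟨K, hK⟩ := hf.lipschitzOnWith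
  rw [← Set.uIcc_of_le hpi] at hK
  have h1 := hK.absolutelyContinuousOnInterval.integral_deriv_eq_sub
  rw [hp, sub_self, intervalIntegral.integral_of_le hpi] at h1
  refine Eq.trans ?_ h1
  apply integral_congr_ae
  apply ae_restrict_of_ae
  filter_upwards [hd] with s hs using hs.deriv.symm

theorem LipschitzWith.lipOn_coord {x : ℝ → R4} {K : NNReal} (h : LipschitzWith K x) (i : Fin 4) :
    LipOn fun s => x s i := by
  refine ⟨K, K.2, fun a _ b _ => ?_⟩
  have h1 := h.dist_le_mul a b
  rw [dist_eq_norm, Real.dist_eq] at h1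
  refine le_trans ?_ h1
  have := PiLp.norm_apply_le (x a - x b) i
  simpa using this

/-! ### Closed Lipschitz curves in `R4` -/

/-- `x` is a closed Lipschitz curve, and `x'` is almost everywhere its derivative. -/
structure LipLoop (x x' : ℝ → R4) : Prop where
  lip : ∃ K, LipschitzWith K x
  periodic : ∀ s, x (s + 2 * Real.pi) = x s
  meas : Measurable x'
  bdd : ∃ M, ∀ s, ‖x' s‖ ≤ M
  hasDeriv : ∀ᵐ s, HasDerivAt x (x' s) s

theorem LipLoop.of_lipschitz {x : ℝ → R4} {K : NNReal} (h : LipschitzWith K x)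
    (hp : ∀ s, x (s + 2 * Real.pi) = x s) : LipLoop x (deriv x) where
  lip := ⟨K, h⟩
  periodic := hp
  meas := measurable_deriv x
  bdd := ⟨K, fun _ => norm_deriv_le_of_lipschitz h⟩
  hasDeriv := by
    filter_upwards [h.ae_differentiableAt_real] with s hs using hs.hasDerivAt

theorem LipLoop.exists_bound {x x' : ℝ → R4} (h : LipLoop x x') :
    ∃ M, ∀ s, ‖x s‖ ≤ M ∧ ‖x' s‖ ≤ M := by
  obtain ⟨K, hK⟩ := h.lip
  obtain ⟨M', hM'⟩ := h.bdd
  have hper : Function.Periodic (fun s => ‖x s‖) (2 * Real.pi) := fun s => by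
    simp only [h.periodic]
  obtain ⟨M, hM⟩ := isCompact_Icc (a := (0 : ℝ)) (b := 2 * Real.pi) |>.exists_bound_of_continuousOn
    hK.continuous.continuousOn
  refine ⟨max M M', fun s => ⟨?_, (hM' s).trans (le_max_right _ _)⟩⟩
  obtain ⟨t, ht, hst⟩ := hper.exists_mem_Ico₀ (by positivity) s
  rw [hst]
  exact (hM t ⟨ht.1, ht.2.le⟩).trans (le_max_left _ _)

/-- No integrability is required: the integral of a non-integrable function is zero by convention.
-/
theorem integral_prod_eq_zero_of_fst {α β : Type*} [MeasurableSpace α] [MeasurableSpace β]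
    {μ : Measure α} {ν : Measure β} [SFinite μ] [SFinite ν] {f : α × β → ℝ}
    (h : ∀ᵐ y ∂ν, ∫ x, f (x, y) ∂μ = 0) : ∫ z, f z ∂(μ.prod ν) = 0 := by
  by_cases hf : Integrable f (μ.prod ν)
  · rw [integral_prod_symm f hf, integral_congr_ae h]; simp
  · exact integral_undef hf

theorem integral_prod_eq_zero_of_snd {α β : Type*} [MeasurableSpace α] [MeasurableSpace β]
    {μ : Measure α} {ν : Measure β} [SFinite μ] [SFinite ν] {f : α × β → ℝ}
    (h : ∀ᵐ x ∂μ, ∫ y, f (x, y) ∂ν = 0) : ∫ z, f z ∂(μ.prod ν) = 0 := by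
  by_cases hf : Integrable f (μ.prod ν)
  · rw [integral_prod f hf, integral_congr_ae h]; simp
  · exact integral_undef hf

end

/-! ### The linking integral and its invariance under straight-line homotopies -/

section

open MeasureTheory

theorem norm_le_inner_self {c : ℝ} (hc : 0 < c) {V : R4} (h : c ≤ ‖V‖) : c ^ 2 ≤ inner ℝ V V := by
  rw [real_inner_self_eq_norm_sq]
  gcongr

theorem ne_zero_of_le_norm {c : ℝ} (hc : 0 < c) {V : R4} (h : c ≤ ‖V‖) : V ≠ 0 := by
  rintro rfl
  rw [norm_zero] at h
  linarith

theorem hasDerivAt_linkForm {u s : ℝ} {X ξ : ℝ → R4} {d δ y η : R4} (hX : HasDerivAt X d s)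
    (hξ : HasDerivAt ξ δ s) (h : joinPt u (X s) y ≠ 0) :
    HasDerivAt (fun s => linkForm u (X s) (ξ s) y η) (linkVar u (X s) (ξ s) d δ y η) s := by
  have hV : HasDerivAt (fun s => joinPt u (X s) y) ((1 - u) • d) s :=
    (hX.const_smul (1 - u)).sub_const _
  refine (hasDerivAt_div_sq ((hasDerivAt_det4 hX hξ (hasDerivAt_const s y)
    (hasDerivAt_const s η)).const_mul (u * (1 - u))) (hasDerivAt_inner_self hV)
    (inner_self_ne_zero.2 h)).congr_deriv ?_
  have h0 : ∀ a b c : R4, det4 a b 0 c = 0 ∧ det4 a b c 0 = 0 := fun a b c => by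
    simp [det4_eq]
  simp only [linkVar, h0]
  ring

theorem hasDerivAt_linkSnd {u t : ℝ} {X ξ d : R4} {y : ℝ → R4} {η : R4} (hy : HasDerivAt y η t)
    (h : joinPt u X (y t) ≠ 0) :
    HasDerivAt (fun t => (1 - u) ^ 2 * det4 X ξ d (y t) /
      inner ℝ (joinPt u X (y t)) (joinPt u X (y t)) ^ 2) (linkSnd u X ξ d (y t) η) t := by
  have hV : HasDerivAt (fun t => joinPt u X (y t)) (-(u • η)) t :=
    (hy.const_smul u).const_sub _
  refine (hasDerivAt_div_sq ((hasDerivAt_det4 (hasDerivAt_const t X) (hasDerivAt_const t ξ)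
    (hasDerivAt_const t d) hy).const_mul ((1 - u) ^ 2)) (hasDerivAt_inner_self hV)
    (inner_self_ne_zero.2 h)).congr_deriv ?_
  have h0 : ∀ a b c : R4, det4 0 a b c = 0 ∧ det4 a 0 b c = 0 ∧ det4 a b 0 c = 0 :=
    fun a b c => by simp [det4_eq]
  simp only [linkSnd, h0]
  ring

theorem hasDerivAt_joinPt (u : ℝ) (X y : R4) :
    HasDerivAt (fun u => joinPt u X y) (-(X + y)) u := by
  refine ((((hasDerivAt_id u).const_sub 1).smul_const X).fun_sub
    ((hasDerivAt_id u).smul_const y)).congr_deriv ?_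
  simp only [neg_smul, one_smul]
  abel

theorem hasDerivAt_linkThd {u : ℝ} {X ξ d y η : R4} (h : joinPt u X y ≠ 0) :
    HasDerivAt (fun u => (1 - u) ^ 2 * u * det4 (joinPt u X y) ξ d η /
      inner ℝ (joinPt u X y) (joinPt u X y) ^ 2) (linkThd u X ξ d y η) u := by
  have hV := hasDerivAt_joinPt u X y
  have hp : HasDerivAt (fun u : ℝ => (1 - u) ^ 2 * u) ((1 - u) * (1 - 3 * u)) u := by
    refine ((((hasDerivAt_id u).const_sub 1).fun_pow 2).fun_mul (hasDerivAt_id u)).congr_deriv ?_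
    simp
    ring
  refine (hasDerivAt_div_sq (hp.fun_mul (hasDerivAt_det4 hV (hasDerivAt_const u ξ)
    (hasDerivAt_const u d) (hasDerivAt_const u η))) (hasDerivAt_inner_self hV)
    (inner_self_ne_zero.2 h)).congr_deriv ?_
  have h0 : ∀ a b c : R4, det4 a 0 b c = 0 ∧ det4 a b 0 c = 0 ∧ det4 a b c 0 = 0 :=
    fun a b c => by simp [det4_eq]
  simp only [linkThd, h0]
  ring

/-- Lebesgue measure on a period. -/
def perMeasure : Measure ℝ := volume.restrict (Set.Ioc 0 (2 * Real.pi))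

/-- Lebesgue measure on the unit interval. -/
def unitMeasure : Measure ℝ := volume.restrict (Set.Ioc 0 1)

instance : IsFiniteMeasure perMeasure := by unfold perMeasure; infer_instance

instance : IsFiniteMeasure unitMeasure := by unfold unitMeasure; infer_instance

theorem ae_unitMeasure : ∀ᵐ u ∂unitMeasure, u ∈ Set.Icc (0 : ℝ) 1 :=
  (ae_restrict_mem measurableSet_Ioc).mono fun _ h => ⟨h.1.le, h.2⟩

/-- The domain of the linking integral. -/
def joinMeasure : Measure (ℝ × ℝ × ℝ) := perMeasure.prod (perMeasure.prod unitMeasure)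

instance : IsFiniteMeasure joinMeasure := by unfold joinMeasure; infer_instance

theorem ae_joinMeasure : ∀ᵐ p ∂joinMeasure, p.2.2 ∈ Set.Icc (0 : ℝ) 1 :=
  (Measure.quasiMeasurePreserving_snd.comp Measure.quasiMeasurePreserving_snd).ae ae_unitMeasure

/-- The linking integral of two closed curves in `R4`. -/
def linkInt (x x' y y' : ℝ → R4) : ℝ :=
  ∫ p, linkForm p.2.2 (x p.1) (x' p.1) (y p.2.1) (y' p.2.1) ∂joinMeasure

theorem integrable_linkForm {x x' y y' : ℝ → R4} (hx : LipLoop x x') (hy : LipLoop y y') {c : ℝ}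
    (hc : 0 < c) (h : ∀ u ∈ Set.Icc (0 : ℝ) 1, ∀ s t, c ≤ ‖joinPt u (x s) (y t)‖) :
    Integrable (fun p : ℝ × ℝ × ℝ => linkForm p.2.2 (x p.1) (x' p.1) (y p.2.1) (y' p.2.1))
      joinMeasure := by
  obtain ⟨M₀, h₀⟩ := hx.exists_bound
  obtain ⟨M₁, h₁⟩ := hy.exists_bound
  obtain ⟨C, hC⟩ := exists_bound_linkForm (max M₀ M₁) hc
  obtain ⟨K, hK⟩ := hx.lip
  obtain ⟨L, hL⟩ := hy.lip
  have m₀ := hx.meas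
  have m₁ := hy.meas
  have n₀ := hK.continuous.measurable
  have n₁ := hL.continuous.measurable
  refine Integrable.of_bound (C := C) (Measurable.aestronglyMeasurable
    (measurable_linkForm.comp (by fun_prop : Measurable fun p : ℝ × ℝ × ℝ =>
      (p.2.2, x p.1, x' p.1, y p.2.1, y' p.2.1)))) ?_
  filter_upwards [ae_joinMeasure] with p hp
  exact hC _ hp _ _ _ _ ((h₀ _).1.trans (le_max_left _ _)) ((h₀ _).2.trans (le_max_left _ _))
    ((h₁ _).1.trans (le_max_right _ _)) ((h₁ _).2.trans (le_max_right _ _)) (h _ hp _ _)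

theorem lipOn_inner_joinPt {u : ℝ} {a b : ℝ → R4} (ha : ∀ i, LipOn fun s => a s i)
    (hb : ∀ i, LipOn fun s => b s i) :
    LipOn fun s => inner ℝ (joinPt u (a s) (b s)) (joinPt u (a s) (b s)) := by
  have h : ∀ i, LipOn fun s => joinPt u (a s) (b s) i := fun i => by
    simpa [joinPt] using ((LipOn.const (1 - u)).mul (ha i)).sub ((LipOn.const u).mul (hb i))
  exact LipOn.inner h h

theorem integral_linkVar_fst {u c : ℝ} (hc : 0 < c) {X d ξ δ : ℝ → R4} {y η : R4}
    (hX : LipLoop X ξ) (hd : LipLoop d δ) (h : ∀ s, c ≤ ‖joinPt u (X s) y‖) :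
    ∫ s, linkVar u (X s) (d s) (ξ s) (δ s) y η ∂perMeasure = 0 := by
  obtain ⟨K, hK⟩ := hX.lip
  obtain ⟨L, hL⟩ := hd.lip
  have hX' := LipschitzWith.lipOn_coord hK
  have hd' := LipschitzWith.lipOn_coord hL
  refine LipOn.integral_eq_zero (f := fun s => linkForm u (X s) (d s) y η) ?_ ?_ ?_
  · exact (((LipOn.const (u * (1 - u))).mul (LipOn.det4 hX' hd' (fun i => LipOn.const (y i))
      fun i => LipOn.const (η i)))).div_sq (lipOn_inner_joinPt hX' fun i => LipOn.const (y i))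
      (by positivity : 0 < c ^ 2) fun s _ => norm_le_inner_self hc (h s)
  · filter_upwards [hX.hasDeriv, hd.hasDeriv] with s h1 h2
    exact hasDerivAt_linkForm h1 h2 (ne_zero_of_le_norm hc (h s))
  · have h1 := hX.periodic 0
    have h2 := hd.periodic 0
    rw [zero_add] at h1 h2
    rw [h1, h2]

theorem integral_linkSnd_snd {u c : ℝ} (hc : 0 < c) {X ξ d : R4} {y η : ℝ → R4}
    (hy : LipLoop y η) (h : ∀ t, c ≤ ‖joinPt u X (y t)‖) :
    ∫ t, linkSnd u X ξ d (y t) (η t) ∂perMeasure = 0 := by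
  obtain ⟨K, hK⟩ := hy.lip
  have hy' := LipschitzWith.lipOn_coord hK
  refine LipOn.integral_eq_zero (f := fun t => (1 - u) ^ 2 * det4 X ξ d (y t) /
      inner ℝ (joinPt u X (y t)) (joinPt u X (y t)) ^ 2) ?_ ?_ ?_
  · exact (((LipOn.const ((1 - u) ^ 2)).mul (LipOn.det4 (fun i => LipOn.const (X i))
      (fun i => LipOn.const (ξ i)) (fun i => LipOn.const (d i)) hy'))).div_sq
      (lipOn_inner_joinPt (fun i => LipOn.const (X i)) hy')
      (by positivity : 0 < c ^ 2) fun s _ => norm_le_inner_self hc (h s)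
  · filter_upwards [hy.hasDeriv] with s h1
    exact hasDerivAt_linkSnd h1 (ne_zero_of_le_norm hc (h s))
  · have h1 := hy.periodic 0
    rw [zero_add] at h1
    rw [h1]

theorem integral_linkThd_thd {c : ℝ} (hc : 0 < c) {X ξ d y η : R4}
    (h : ∀ u ∈ Set.Icc (0 : ℝ) 1, c ≤ ‖joinPt u X y‖) :
    ∫ u, linkThd u X ξ d y η ∂unitMeasure = 0 := by
  have hd := fun u hu => hasDerivAt_linkThd (ξ := ξ) (d := d) (η := η)
    (ne_zero_of_le_norm hc (h u hu))
  have := intervalIntegral.integral_eq_sub_of_hasDerivAt (a := 0) (b := 1)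
    (f' := fun u => linkThd u X ξ d y η) (fun u hu => hd u (by
      rwa [Set.uIcc_of_le zero_le_one] at hu)) (by
    apply ContinuousOn.intervalIntegrable
    rw [Set.uIcc_of_le zero_le_one]
    unfold linkThd
    refine ContinuousOn.sub (ContinuousOn.div ?_ ?_ ?_) (ContinuousOn.div ?_ ?_ ?_)
    · exact Continuous.continuousOn (by fun_prop)
    · exact Continuous.continuousOn (by fun_prop)
    · exact fun q hq => inner_self_pow_ne_zero hc (h q hq) _
    · exact Continuous.continuousOn (by fun_prop)
    · exact Continuous.continuousOn (by fun_prop)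
    · exact fun q hq => inner_self_pow_ne_zero hc (h q hq) _)
  rw [intervalIntegral.integral_of_le zero_le_one] at this
  simpa [unitMeasure] using this

theorem integral_linkVar_param {u c : ℝ} (hc : 0 < c) {X ξ d δ y η : R4}
    (h : ∀ r ∈ Set.Icc (0 : ℝ) 1, c ≤ ‖joinPt u (X + r • d) y‖) :
    ∫ r, linkVar u (X + r • d) (ξ + r • δ) d δ y η ∂unitMeasure =
      linkForm u (X + d) (ξ + δ) y η - linkForm u X ξ y η := by
  have hl : ∀ (a b : R4) (r : ℝ), HasDerivAt (fun r : ℝ => a + r • b) b r := fun a b r => by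
    simpa using ((hasDerivAt_id r).smul_const b).const_add a
  have := intervalIntegral.integral_eq_sub_of_hasDerivAt (a := 0) (b := 1)
    (f := fun r => linkForm u (X + r • d) (ξ + r • δ) y η)
    (f' := fun r => linkVar u (X + r • d) (ξ + r • δ) d δ y η)
    (fun r hr => hasDerivAt_linkForm (u := u) (X := fun r => X + r • d)
      (ξ := fun r => ξ + r • δ) (y := y) (η := η) (hl X d r) (hl ξ δ r) (ne_zero_of_le_norm hc (h r (by
      rwa [Set.uIcc_of_le zero_le_one] at hr)))) (by
    apply ContinuousOn.intervalIntegrable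
    rw [Set.uIcc_of_le zero_le_one]
    unfold linkVar
    refine ContinuousOn.sub (ContinuousOn.div ?_ ?_ ?_) (ContinuousOn.div ?_ ?_ ?_)
    · exact Continuous.continuousOn (by fun_prop)
    · exact Continuous.continuousOn (by fun_prop)
    · exact fun q hq => inner_self_pow_ne_zero hc (h q hq) _
    · exact Continuous.continuousOn (by fun_prop)
    · exact Continuous.continuousOn (by fun_prop)
    · exact fun q hq => inner_self_pow_ne_zero hc (h q hq) _)
  rw [intervalIntegral.integral_of_le zero_le_one] at this
  simpa [unitMeasure] using this

theorem LipLoop.add_smul_sub {x₀ x₀' x₁ x₁' : ℝ → R4} (h₀ : LipLoop x₀ x₀') (h₁ : LipLoop x₁ x₁')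
    (a b : ℝ) : LipLoop (fun s => a • x₀ s + b • x₁ s) (fun s => a • x₀' s + b • x₁' s) where
  lip := by
    obtain ⟨K, hK⟩ := h₀.lip
    obtain ⟨L, hL⟩ := h₁.lip
    exact ⟨_, ((lipschitzWith_smul a).comp hK).add ((lipschitzWith_smul b).comp hL)⟩
  periodic s := by simp only [h₀.periodic, h₁.periodic]
  meas := (h₀.meas.const_smul a).add (h₁.meas.const_smul b)
  bdd := by
    obtain ⟨K, hK⟩ := h₀.bdd
    obtain ⟨L, hL⟩ := h₁.bdd
    refine ⟨|a| * K + |b| * L, fun s => (norm_add_le _ _).trans ?_⟩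
    rw [norm_smul, norm_smul, Real.norm_eq_abs, Real.norm_eq_abs]
    exact add_le_add (mul_le_mul_of_nonneg_left (hK s) (abs_nonneg _))
      (mul_le_mul_of_nonneg_left (hL s) (abs_nonneg _))
  hasDeriv := by
    filter_upwards [h₀.hasDeriv, h₁.hasDeriv] with s h1 h2
    exact (h1.const_smul a).add (h2.const_smul b)

set_option maxHeartbeats 1000000 in
/-- Invariance of the linking integral under a straight-line homotopy `x + r d` of the first
curve. -/
theorem linkInt_add {x x' d d' y y' : ℝ → R4} (hx : LipLoop x x')
    (hd : LipLoop d d') (hy : LipLoop y y') {c : ℝ} (hc : 0 < c)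
    (h : ∀ r ∈ Set.Icc (0 : ℝ) 1, ∀ u ∈ Set.Icc (0 : ℝ) 1, ∀ s t,
      c ≤ ‖joinPt u (x s + r • d s) (y t)‖) :
    linkInt (fun s => x s + d s) (fun s => x' s + d' s) y y' = linkInt x x' y y' := by
  have hX : ∀ r : ℝ, LipLoop (fun s => x s + r • d s) (fun s => x' s + r • d' s) := fun r => by
    simpa using hx.add_smul_sub hd 1 r
  obtain ⟨M₀, h₀⟩ := hx.exists_bound
  obtain ⟨M₁, h₁⟩ := hd.exists_bound
  obtain ⟨M₂, h₂⟩ := hy.exists_bound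
  have p₀ : 0 ≤ M₀ := (norm_nonneg _).trans (h₀ 0).1
  have p₁ : 0 ≤ M₁ := (norm_nonneg _).trans (h₁ 0).1
  have p₂ : 0 ≤ M₂ := (norm_nonneg _).trans (h₂ 0).1
  obtain ⟨C₁, hC₁⟩ := exists_bound_linkVar (M₀ + M₁ + M₂) hc
  obtain ⟨C₂, hC₂⟩ := exists_bound_linkSnd_linkThd (M₀ + M₁ + M₂) hc
  obtain ⟨K, hK⟩ := hx.lip
  obtain ⟨L, hL⟩ := hd.lip
  obtain ⟨K', hK'⟩ := hy.lip
  have m₀ := hx.meas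
  have m₁ := hd.meas
  have m₂ := hy.meas
  have n₀ := hK.continuous.measurable
  have n₁ := hL.continuous.measurable
  have n₂ := hK'.continuous.measurable
  have b₀ : ∀ s, ‖x s‖ ≤ M₀ + M₁ + M₂ := fun s => by linarith [(h₀ s).1]
  have b₁ : ∀ s, ‖d s‖ ≤ M₀ + M₁ + M₂ := fun s => by linarith [(h₁ s).1]
  have b₁' : ∀ s, ‖d' s‖ ≤ M₀ + M₁ + M₂ := fun s => by linarith [(h₁ s).2]
  have b₂ : ∀ s, ‖y s‖ ≤ M₀ + M₁ + M₂ := fun s => by linarith [(h₂ s).1]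
  have b₂' : ∀ s, ‖y' s‖ ≤ M₀ + M₁ + M₂ := fun s => by linarith [(h₂ s).2]
  have bX : ∀ r ∈ Set.Icc (0 : ℝ) 1, ∀ s, ‖x s + r • d s‖ ≤ M₀ + M₁ + M₂ ∧
      ‖x' s + r • d' s‖ ≤ M₀ + M₁ + M₂ := by
    intro r hr s
    have hn : ∀ v : R4, ‖r • v‖ ≤ ‖v‖ := fun v => by
      rw [norm_smul, Real.norm_eq_abs, abs_of_nonneg hr.1]
      exact mul_le_of_le_one_left (norm_nonneg _) hr.2
    constructor
    · linarith [norm_add_le (x s) (r • d s), hn (d s), (h₀ s).1, (h₁ s).1]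
    · linarith [norm_add_le (x' s) (r • d' s), hn (d' s), (h₀ s).2, (h₁ s).2]
  -- The variation is integrated over `(r, s, t, u)` in two ways. Split by `linkVar_eq`, it gives
  -- three terms, each of which vanishes when integrated first in its own variable: `s` and `t` by
  -- periodicity, `u` because of the factor `(1 - u)² u`. Integrated first in `r`, it gives the
  -- difference of the two linking integrals.
  set P := unitMeasure.prod joinMeasure with hP
  have hmem : ∀ᵐ q ∂P, q.1 ∈ Set.Icc (0 : ℝ) 1 ∧ q.2.2.2 ∈ Set.Icc (0 : ℝ) 1 :=
    (Measure.quasiMeasurePreserving_fst.ae ae_unitMeasure).and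
      (Measure.quasiMeasurePreserving_snd.ae ae_joinMeasure)
  let X : ℝ × ℝ × ℝ × ℝ → R4 := fun q => x q.2.1 + q.1 • d q.2.1
  let ξ : ℝ × ℝ × ℝ × ℝ → R4 := fun q => x' q.2.1 + q.1 • d' q.2.1
  have mX : Measurable X := by fun_prop
  have mξ : Measurable ξ := by fun_prop
  have iV : Integrable (fun q => linkVar q.2.2.2 (X q) (ξ q) (d q.2.1) (d' q.2.1) (y q.2.2.1)
      (y' q.2.2.1)) P := by
    refine Integrable.of_bound (C := C₁) (Measurable.aestronglyMeasurable
      (measurable_linkVar.comp (by fun_prop : Measurable fun q : ℝ × ℝ × ℝ × ℝ =>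
        (q.2.2.2, X q, ξ q, d q.2.1, d' q.2.1, y q.2.2.1, y' q.2.2.1)))) ?_
    filter_upwards [hmem] with q hq
    exact hC₁ _ hq.2 _ _ _ _ _ _ (bX _ hq.1 _).1 (bX _ hq.1 _).2 (b₁ _) (b₁' _) (b₂ _) (b₂' _)
      (h _ hq.1 _ hq.2 _ _)
  have iP : Integrable (fun q => linkVar q.2.2.2 (X q) (d q.2.1) (ξ q) (d' q.2.1) (y q.2.2.1)
      (y' q.2.2.1)) P := by
    refine Integrable.of_bound (C := C₁) (Measurable.aestronglyMeasurable
      (measurable_linkVar.comp (by fun_prop : Measurable fun q : ℝ × ℝ × ℝ × ℝ =>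
        (q.2.2.2, X q, d q.2.1, ξ q, d' q.2.1, y q.2.2.1, y' q.2.2.1)))) ?_
    filter_upwards [hmem] with q hq
    exact hC₁ _ hq.2 _ _ _ _ _ _ (bX _ hq.1 _).1 (b₁ _) (bX _ hq.1 _).2 (b₁' _) (b₂ _) (b₂' _)
      (h _ hq.1 _ hq.2 _ _)
  have iB : Integrable (fun q => linkSnd q.2.2.2 (X q) (ξ q) (d q.2.1) (y q.2.2.1)
      (y' q.2.2.1)) P := by
    refine Integrable.of_bound (C := C₂) (Measurable.aestronglyMeasurable
      (measurable_linkSnd.comp (by fun_prop : Measurable fun q : ℝ × ℝ × ℝ × ℝ =>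
        (q.2.2.2, X q, ξ q, d q.2.1, y q.2.2.1, y' q.2.2.1)))) ?_
    filter_upwards [hmem] with q hq
    exact (hC₂ _ hq.2 _ _ _ _ _ (bX _ hq.1 _).1 (bX _ hq.1 _).2 (b₁ _) (b₂ _) (b₂' _)
      (h _ hq.1 _ hq.2 _ _)).1
  have iC : Integrable (fun q => linkThd q.2.2.2 (X q) (ξ q) (d q.2.1) (y q.2.2.1)
      (y' q.2.2.1)) P := by
    refine Integrable.of_bound (C := C₂) (Measurable.aestronglyMeasurable
      (measurable_linkThd.comp (by fun_prop : Measurable fun q : ℝ × ℝ × ℝ × ℝ =>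
        (q.2.2.2, X q, ξ q, d q.2.1, y q.2.2.1, y' q.2.2.1)))) ?_
    filter_upwards [hmem] with q hq
    exact (hC₂ _ hq.2 _ _ _ _ _ (bX _ hq.1 _).1 (bX _ hq.1 _).2 (b₁ _) (b₂ _) (b₂' _)
      (h _ hq.1 _ hq.2 _ _)).2
  have zP : ∫ q, linkVar q.2.2.2 (X q) (d q.2.1) (ξ q) (d' q.2.1) (y q.2.2.1)
      (y' q.2.2.1) ∂P = 0 := by
    apply integral_prod_eq_zero_of_snd
    filter_upwards [ae_unitMeasure] with r hr
    apply integral_prod_eq_zero_of_fst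
    filter_upwards [Measure.quasiMeasurePreserving_snd.ae ae_unitMeasure] with p hp
    exact integral_linkVar_fst (u := p.2) (X := fun s => x s + r • d s) (d := d)
      (ξ := fun s => x' s + r • d' s) (δ := d') (y := y p.1) (η := y' p.1) hc (hX r) hd
      fun s => h r hr _ hp _ _
  have zB : ∫ q, linkSnd q.2.2.2 (X q) (ξ q) (d q.2.1) (y q.2.2.1) (y' q.2.2.1) ∂P = 0 := by
    apply integral_prod_eq_zero_of_snd
    filter_upwards [ae_unitMeasure] with r hr
    apply integral_prod_eq_zero_of_snd
    refine Filter.Eventually.of_forall fun s => ?_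
    apply integral_prod_eq_zero_of_fst
    filter_upwards [ae_unitMeasure] with u hu
    exact integral_linkSnd_snd (u := u) (X := x s + r • d s) (ξ := x' s + r • d' s) (d := d s)
      (y := y) (η := y') hc hy fun t => h r hr _ hu _ _
  have zC : ∫ q, linkThd q.2.2.2 (X q) (ξ q) (d q.2.1) (y q.2.2.1) (y' q.2.2.1) ∂P = 0 := by
    apply integral_prod_eq_zero_of_snd
    filter_upwards [ae_unitMeasure] with r hr
    apply integral_prod_eq_zero_of_snd
    refine Filter.Eventually.of_forall fun s => ?_
    apply integral_prod_eq_zero_of_snd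
    refine Filter.Eventually.of_forall fun t => ?_
    exact integral_linkThd_thd (X := x s + r • d s) (ξ := x' s + r • d' s) (d := d s)
      (y := y t) (η := y' t) hc fun u hu => h r hr _ hu _ _
  have hzero : ∫ q, linkVar q.2.2.2 (X q) (ξ q) (d q.2.1) (d' q.2.1) (y q.2.2.1)
      (y' q.2.2.1) ∂P = 0 := by
    rw [integral_congr_ae (g := ((fun q => linkVar q.2.2.2 (X q) (d q.2.1) (ξ q) (d' q.2.1)
      (y q.2.2.1) (y' q.2.2.1)) + fun q => linkSnd q.2.2.2 (X q) (ξ q) (d q.2.1) (y q.2.2.1)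
      (y' q.2.2.1)) - fun q => linkThd q.2.2.2 (X q) (ξ q) (d q.2.1) (y q.2.2.1) (y' q.2.2.1)),
      integral_sub' (iP.add iB) iC, integral_add' iP iB, zP, zB, zC]
    · simp
    · filter_upwards [hmem] with q hq
      simp only [Pi.sub_apply, Pi.add_apply]
      rw [linkVar_eq _ _ _ _ _ _ _ (ne_zero_of_le_norm hc (h _ hq.1 _ hq.2 _ _))]
  rw [hP, integral_prod_symm _ iV] at hzero
  have e0 : Integrable (fun p : ℝ × ℝ × ℝ => linkForm p.2.2 (x p.1) (x' p.1) (y p.2.1) (y' p.2.1))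
      joinMeasure := integrable_linkForm hx hy hc fun u hu s t => by
    simpa using h 0 (by simp) u hu s t
  have e1 : Integrable (fun p : ℝ × ℝ × ℝ => linkForm p.2.2 (x p.1 + d p.1) (x' p.1 + d' p.1)
      (y p.2.1) (y' p.2.1)) joinMeasure := by
    have h1 := hX 1
    simp only [one_smul] at h1
    exact integrable_linkForm (x := fun s => x s + d s) (x' := fun s => x' s + d' s) h1 hy hc
      fun u hu s t => by simpa using h 1 (by simp) u hu s t
  rw [← sub_eq_zero, linkInt, linkInt, ← integral_sub e1 e0]
  refine Eq.trans ?_ hzero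
  refine integral_congr_ae ?_
  filter_upwards [ae_joinMeasure] with p hp
  simp only [X, ξ]
  rw [integral_linkVar_param (u := p.2.2) (X := x p.1) (ξ := x' p.1) (d := d p.1)
    (δ := d' p.1) (y := y p.2.1) (η := y' p.2.1) hc fun r hr => h r hr p.2.2 hp p.1 p.2.1]

theorem measurePreserving_one_sub :
    MeasurePreserving (fun u : ℝ => 1 - u) unitMeasure unitMeasure := by
  have h := (MeasureTheory.Measure.measurePreserving_sub_left volume (1 : ℝ)).restrict_preimage
    (measurableSet_Ioc (a := (0 : ℝ)) (b := 1))
  rw [Set.preimage_const_sub_Ioc, sub_self, sub_zero,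
    Measure.restrict_congr_set Ico_ae_eq_Ioc] at h
  exact h

/-- The linking integral is symmetric. -/
theorem linkInt_symm (x x' y y' : ℝ → R4) : linkInt x x' y y' = linkInt y y' x x' := by
  have h1 : MeasurePreserving (MeasurableEquiv.prodAssoc : (ℝ × ℝ) × ℝ ≃ᵐ ℝ × ℝ × ℝ)
      ((perMeasure.prod perMeasure).prod unitMeasure) joinMeasure :=
    measurePreserving_prodAssoc _ _ _
  have h2 : MeasurePreserving (Prod.map Prod.swap fun u : ℝ => 1 - u)
      ((perMeasure.prod perMeasure).prod unitMeasure)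
      ((perMeasure.prod perMeasure).prod unitMeasure) :=
    Measure.measurePreserving_swap.prod measurePreserving_one_sub
  -- The substitution is `(s, t, u) ↦ (t, s, 1 - u)`. It changes the sign of the join point, which
  -- enters through its norm only, and exchanging two pairs of rows leaves the determinant
  -- unchanged.
  have h3 := h2.comp (h1.symm _)
  have e2 : MeasurableEmbedding (Prod.map (Prod.swap : ℝ × ℝ → ℝ × ℝ) fun u : ℝ => 1 - u) :=
    (MeasurableEquiv.prodCongr MeasurableEquiv.prodComm
      (MeasurableEquiv.subLeft (1 : ℝ))).measurableEmbedding
  unfold linkInt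
  rw [← (h1.comp h3).integral_comp (MeasurableEquiv.prodAssoc.measurableEmbedding.comp
    (e2.comp MeasurableEquiv.prodAssoc.symm.measurableEmbedding))]
  refine integral_congr_ae (Filter.Eventually.of_forall fun p => ?_)
  obtain ⟨s, t, u⟩ := p
  have hV : joinPt (1 - u) (x t) (y s) = -joinPt u (y s) (x t) := by
    simp only [joinPt, sub_sub_cancel]
    abel
  have hd : det4 (x t) (x' t) (y s) (y' s) = det4 (y s) (y' s) (x t) (x' t) := by
    simp only [det4_eq]
    ring
  change linkForm (1 - u) (x t) (x' t) (y s) (y' s) = linkForm u (y s) (y' s) (x t) (x' t)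
  simp only [linkForm, hV, hd, inner_neg_neg, sub_sub_cancel]
  ring

end

section

open MeasureTheory

/-! ### Homotopy invariance of the linking number -/

theorem joinPt_sub_le {u : ℝ} (hu : u ∈ Set.Icc (0 : ℝ) 1) {X X' y y' : R4} {η : ℝ}
    (hX : ‖X' - X‖ ≤ η) (hy : ‖y' - y‖ ≤ η) :
    ‖joinPt u X y‖ - η ≤ ‖joinPt u X' y'‖ := by
  have h : joinPt u X y = joinPt u X' y' - ((1 - u) • (X' - X) - u • (y' - y)) := by
    simp only [joinPt, smul_sub]
    abel
  have h1 : ‖(1 - u) • (X' - X) - u • (y' - y)‖ ≤ (1 - u) * η + u * η := by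
    refine (norm_sub_le _ _).trans (add_le_add ?_ ?_)
    · rw [norm_smul, Real.norm_eq_abs, abs_of_nonneg (by linarith [hu.2])]
      exact mul_le_mul_of_nonneg_left hX (by linarith [hu.2])
    · rw [norm_smul, Real.norm_eq_abs, abs_of_nonneg hu.1]
      exact mul_le_mul_of_nonneg_left hy hu.1
  have h2 := norm_sub_le (joinPt u X' y') ((1 - u) • (X' - X) - u • (y' - y))
  rw [← h] at h2
  linarith

/-- Balls are convex, so the segment between two loops within `c/2` of `X` stays within `c/2` of
`X`. The join points then have norm at least `c - c/2`, and `linkInt_add` applies. -/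
theorem linkInt_eq_of_near_fst {X Y : ℝ → R4} {c : ℝ} (hc : 0 < c)
    (h : ∀ u ∈ Set.Icc (0 : ℝ) 1, ∀ s t, c ≤ ‖joinPt u (X s) (Y t)‖)
    {x₀ x₀' x₁ x₁' y y' : ℝ → R4} (hx₀ : LipLoop x₀ x₀') (hx₁ : LipLoop x₁ x₁')
    (hy : LipLoop y y') (nx₀ : ∀ s, ‖x₀ s - X s‖ ≤ c / 2) (nx₁ : ∀ s, ‖x₁ s - X s‖ ≤ c / 2)
    (ny : ∀ s, ‖y s - Y s‖ ≤ c / 2) : linkInt x₀ x₀' y y' = linkInt x₁ x₁' y y' := by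
  have hd : LipLoop (fun s => x₁ s - x₀ s) (fun s => x₁' s - x₀' s) := by
    have := hx₀.add_smul_sub hx₁ (-1) 1
    simpa [neg_add_eq_sub] using this
  have key := linkInt_add hx₀ hd hy (half_pos hc) (fun r hr u hu s t => by
    have h1 : ‖x₀ s + r • (x₁ s - x₀ s) - X s‖ ≤ c / 2 := by
      have e : x₀ s + r • (x₁ s - x₀ s) - X s = (1 - r) • (x₀ s - X s) + r • (x₁ s - X s) := by
        module
      rw [e]
      refine (norm_add_le _ _).trans ?_
      rw [norm_smul, norm_smul, Real.norm_eq_abs, Real.norm_eq_abs, abs_of_nonneg hr.1,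
        abs_of_nonneg (by linarith [hr.2] : 0 ≤ 1 - r)]
      nlinarith [mul_le_mul_of_nonneg_left (nx₀ s) (by linarith [hr.2] : 0 ≤ 1 - r),
        mul_le_mul_of_nonneg_left (nx₁ s) hr.1]
    have h2 := joinPt_sub_le hu h1 (ny t)
    linarith [h u hu s t])
  simp only [add_sub_cancel] at key
  exact key.symm

theorem joinPt_symm (u : ℝ) (X y : R4) : joinPt (1 - u) y X = -joinPt u X y := by
  simp only [joinPt, sub_sub_cancel]
  abel

theorem linkInt_eq_of_near {X Y : ℝ → R4} {c : ℝ} (hc : 0 < c)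
    (h : ∀ u ∈ Set.Icc (0 : ℝ) 1, ∀ s t, c ≤ ‖joinPt u (X s) (Y t)‖)
    {x₀ x₀' x₁ x₁' y₀ y₀' y₁ y₁' : ℝ → R4} (hx₀ : LipLoop x₀ x₀') (hx₁ : LipLoop x₁ x₁')
    (hy₀ : LipLoop y₀ y₀') (hy₁ : LipLoop y₁ y₁') (nx₀ : ∀ s, ‖x₀ s - X s‖ ≤ c / 2)
    (nx₁ : ∀ s, ‖x₁ s - X s‖ ≤ c / 2) (ny₀ : ∀ s, ‖y₀ s - Y s‖ ≤ c / 2)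
    (ny₁ : ∀ s, ‖y₁ s - Y s‖ ≤ c / 2) : linkInt x₀ x₀' y₀ y₀' = linkInt x₁ x₁' y₁ y₁' := by
  rw [linkInt_eq_of_near_fst hc h hx₀ hx₁ hy₀ nx₀ nx₁ ny₀, linkInt_symm, linkInt_symm x₁]
  refine linkInt_eq_of_near_fst hc (fun u hu s t => ?_) hy₀ hy₁ hx₁ ny₀ ny₁ nx₁
  have h1 := joinPt_symm (1 - u) (Y s) (X t)
  rw [sub_sub_cancel] at h1
  have := h (1 - u) ⟨by linarith [hu.2], by linarith [hu.1]⟩ t s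
  rwa [joinPt_symm, norm_neg] at this

theorem uniformContinuous_of_periodic {X : ℝ → R4} (hX : Continuous X)
    (hp : ∀ s, X (s + 2 * Real.pi) = X s) : UniformContinuous X := by
  have : Fact (0 < 2 * Real.pi) := ⟨by positivity⟩
  have hp' : Function.Periodic X (2 * Real.pi) := hp
  have h1 : Continuous (hp'.lift : AddCircle (2 * Real.pi) → R4) := continuous_coinduced_dom.2 hX
  have h2 := CompactSpace.uniformContinuous_of_continuous h1
  have h3 : UniformContinuous ((↑) : ℝ → AddCircle (2 * Real.pi)) :=
    uniformContinuous_of_continuousAt_zero (QuotientAddGroup.mk' _)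
      (AddCircle.continuous_mk' _).continuousAt
  exact h2.comp h3

/-- The moving average `h⁻¹ ∫ X` over `[s, s + h]` is differentiable with bounded derivative and
periodic, and it is close to `X` by uniform continuity. -/
theorem exists_lipLoop_near {X : ℝ → R4} (hX : Continuous X)
    (hp : ∀ s, X (s + 2 * Real.pi) = X s) {η : ℝ} (hη : 0 < η) :
    ∃ x x' : ℝ → R4, LipLoop x x' ∧ ∀ s, ‖x s - X s‖ ≤ η := by
  obtain ⟨δ, hδ, hd⟩ := Metric.uniformContinuous_iff.1 (uniformContinuous_of_periodic hX hp) η hη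
  set h := δ / 2 with hh
  have h0 : 0 < h := by positivity
  obtain ⟨M, hM⟩ : ∃ M, ∀ s, ‖X s‖ ≤ M := by
    have hper : Function.Periodic (fun s => ‖X s‖) (2 * Real.pi) := fun s => by simp only [hp]
    obtain ⟨M, hM⟩ := isCompact_Icc (a := (0 : ℝ)) (b := 2 * Real.pi)
      |>.exists_bound_of_continuousOn hX.continuousOn
    refine ⟨M, fun s => ?_⟩
    obtain ⟨t, ht, hst⟩ := hper.exists_mem_Ico₀ (by positivity) s
    rw [hst]
    exact hM t ⟨ht.1, ht.2.le⟩
  have hi : ∀ a b, IntervalIntegrable X volume a b := fun a b => hX.intervalIntegrable a b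
  set x : ℝ → R4 := fun s => h⁻¹ • ((∫ t in (0 : ℝ)..(s + h), X t) - ∫ t in (0 : ℝ)..s, X t)
    with hx
  have hxe : ∀ s, x s = h⁻¹ • ∫ t in s..(s + h), X t := fun s => by
    simp only [hx, intervalIntegral.integral_interval_sub_left (hi _ _) (hi _ _)]
  have hderiv : ∀ s, HasDerivAt x (h⁻¹ • (X (s + h) - X s)) s := by
    intro s
    have h1 : HasDerivAt (fun s => ∫ t in (0 : ℝ)..s, X t) (X s) s :=
      intervalIntegral.integral_hasDerivAt_right (hi _ _) (hX.stronglyMeasurableAtFilter _ _)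
        hX.continuousAt
    have h2 : HasDerivAt (fun s => ∫ t in (0 : ℝ)..s, X t) (X (s + h)) (s + h) :=
      intervalIntegral.integral_hasDerivAt_right (hi _ _) (hX.stronglyMeasurableAtFilter _ _)
        hX.continuousAt
    exact ((h2.comp_add_const s h).fun_sub h1).fun_const_smul _
  have hper : ∀ s, x (s + 2 * Real.pi) = x s := fun s => by
    rw [hxe, hxe]
    congr 1
    have := intervalIntegral.integral_comp_add_right (a := s) (b := s + h) X (2 * Real.pi)
    simp only [hp] at this
    rw [this]
    congr 1
    ring
  have hlip : LipschitzWith (h⁻¹ * (M + M)).toNNReal x := by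
    refine lipschitzWith_of_nnnorm_deriv_le (fun s => (hderiv s).differentiableAt) fun s => ?_
    rw [(hderiv s).deriv, ← NNReal.coe_le_coe, coe_nnnorm, norm_smul, norm_inv, Real.norm_eq_abs,
      abs_of_pos h0]
    refine le_trans ?_ (Real.le_coe_toNNReal _)
    gcongr
    exact (norm_sub_le _ _).trans (add_le_add (hM _) (hM _))
  refine ⟨x, deriv x, LipLoop.of_lipschitz hlip hper, fun s => ?_⟩
  have e : x s - X s = h⁻¹ • ∫ t in s..(s + h), (X t - X s) := by
    rw [intervalIntegral.integral_sub (hi _ _) (by simp), intervalIntegral.integral_const,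
      smul_sub, ← hxe, add_sub_cancel_left, smul_smul, inv_mul_cancel₀ h0.ne', one_smul]
  rw [e, norm_smul, norm_inv, Real.norm_eq_abs, abs_of_pos h0]
  have := intervalIntegral.norm_integral_le_of_norm_le_const (a := s) (b := s + h)
    (f := fun t => X t - X s) (C := η) (fun t ht => by
      rw [Set.uIoc_of_le (by linarith)] at ht
      rw [← dist_eq_norm]
      refine (hd ?_).le
      rw [Real.dist_eq, abs_of_pos (by linarith [ht.1])]
      linarith [ht.2])
  rw [add_sub_cancel_left, abs_of_pos h0] at this
  rw [inv_mul_le_iff₀ h0]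
  linarith

/-- Intermediate stages of the homotopy are only continuous and need not have a linking integral, so
each is replaced by Lipschitz loops within `c/4`. For nearby times both approximations are within
`c/4 + c/4` of the same stage, so the resulting function of time is locally constant, and the unit
interval is connected. -/
theorem linkInt_eq_of_homotopy {X Y : unitInterval × ℝ → R4} (hX : Continuous X)
    (hY : Continuous Y) (pX : ∀ r s, X (r, s + 2 * Real.pi) = X (r, s))
    (pY : ∀ r s, Y (r, s + 2 * Real.pi) = Y (r, s)) {c : ℝ} (hc : 0 < c)
    (h : ∀ r, ∀ u ∈ Set.Icc (0 : ℝ) 1, ∀ s t, c ≤ ‖joinPt u (X (r, s)) (Y (r, t))‖)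
    {x₀' x₁' y₀' y₁' : ℝ → R4} (hx₀ : LipLoop (fun s => X (0, s)) x₀')
    (hx₁ : LipLoop (fun s => X (1, s)) x₁') (hy₀ : LipLoop (fun s => Y (0, s)) y₀')
    (hy₁ : LipLoop (fun s => Y (1, s)) y₁') :
    linkInt (fun s => X (0, s)) x₀' (fun s => Y (0, s)) y₀' =
      linkInt (fun s => X (1, s)) x₁' (fun s => Y (1, s)) y₁' := by
  have hη : 0 < c / 4 := by positivity
  have hcX : ∀ r, Continuous fun s => X (r, s) := fun r => by fun_prop
  have hcY : ∀ r, Continuous fun s => Y (r, s) := fun r => by fun_prop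
  choose x x' hx nx using fun r => exists_lipLoop_near (hcX r) (pX r) hη
  choose y y' hy ny using fun r => exists_lipLoop_near (hcY r) (pY r) hη
  have near : ∀ Z : unitInterval × ℝ → R4, Continuous Z →
      (∀ r s, Z (r, s + 2 * Real.pi) = Z (r, s)) → ∀ r, ∀ᶠ r' in 𝓝 r, ∀ s,
      ‖Z (r', s) - Z (r, s)‖ ≤ c / 4 := by
    intro Z hZ pZ r
    have := (isCompact_Icc (a := (0 : ℝ)) (b := 2 * Real.pi)).eventually_forall_of_forall_eventually
      (x₀ := r) (P := fun r' s => ‖Z (r', s) - Z (r, s)‖ < c / 4) (fun s _ => by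
        have hcont : Continuous fun z : unitInterval × ℝ => ‖Z (z.1, z.2) - Z (r, z.2)‖ := by
          fun_prop
        exact hcont.continuousAt.eventually_lt_const (by simpa using hη))
    filter_upwards [this] with r' hr' s
    have hper : Function.Periodic (fun s => ‖Z (r', s) - Z (r, s)‖) (2 * Real.pi) := fun s => by
      simp only [pZ]
    obtain ⟨t, ht, hst⟩ := hper.exists_mem_Ico₀ (by positivity) s
    rw [hst]
    exact (hr' t ⟨ht.1, ht.2.le⟩).le
  have loc : IsLocallyConstant fun r => linkInt (x r) (x' r) (y r) (y' r) := by
    rw [IsLocallyConstant.iff_eventually_eq]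
    intro r
    filter_upwards [near X hX pX r, near Y hY pY r] with r' h1 h2
    have tri : ∀ a b d : R4, ‖a - b‖ ≤ c / 4 → ‖b - d‖ ≤ c / 4 → ‖a - d‖ ≤ c / 2 :=
      fun a b d h h' => by linarith [norm_sub_le_norm_sub_add_norm_sub a b d]
    exact linkInt_eq_of_near hc (h r) (hx r') (hx r) (hy r') (hy r)
      (fun s => tri _ _ _ (nx r' s) (h1 s)) (fun s => (nx r s).trans (by linarith))
      (fun s => tri _ _ _ (ny r' s) (h2 s)) (fun s => (ny r s).trans (by linarith))
  have e0 := linkInt_eq_of_near hc (h 0) hx₀ (hx 0) hy₀ (hy 0) (fun s => by simp; linarith)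
    (fun s => (nx 0 s).trans (by linarith)) (fun s => by simp; linarith)
    (fun s => (ny 0 s).trans (by linarith))
  have e1 := linkInt_eq_of_near hc (h 1) hx₁ (hx 1) hy₁ (hy 1) (fun s => by simp; linarith)
    (fun s => (nx 1 s).trans (by linarith)) (fun s => by simp; linarith)
    (fun s => (ny 1 s).trans (by linarith))
  rw [e0, e1]
  exact loc.apply_eq_of_preconnectedSpace 0 1

/-- If `(1 - u) σ = u τ` with unit vectors, comparison of norms gives `u = 1/2` and then `σ = τ`. So
disjointness of the curves is all that the linking integral needs. -/
theorem joinPt_ne_zero {σ τ : S3} (h : σ ≠ τ) {u : ℝ} (hu : u ∈ Set.Icc (0 : ℝ) 1) :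
    joinPt u (σ : R4) τ ≠ 0 := by
  intro h0
  have h1 : (1 - u) • (σ : R4) = u • (τ : R4) := sub_eq_zero.1 h0
  have h2 := congrArg norm h1
  rw [norm_smul, norm_smul, S3.norm_coe, S3.norm_coe, Real.norm_eq_abs, Real.norm_eq_abs,
    abs_of_nonneg hu.1, abs_of_nonneg (by linarith [hu.2])] at h2
  have hu2 : u = 1 / 2 := by linarith
  subst hu2
  norm_num at h1
  exact h (Subtype.ext h1)

theorem exists_le_norm_joinPt {X Y : unitInterval × ℝ → S3} (hX : Continuous X)
    (hY : Continuous Y) (pX : ∀ r s, X (r, s + 2 * Real.pi) = X (r, s))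
    (pY : ∀ r s, Y (r, s + 2 * Real.pi) = Y (r, s)) (hd : ∀ r s t, X (r, s) ≠ Y (r, t)) :
    ∃ c, 0 < c ∧ ∀ r, ∀ u ∈ Set.Icc (0 : ℝ) 1, ∀ s t,
      c ≤ ‖joinPt u (X (r, s) : R4) (Y (r, t))‖ := by
  obtain ⟨P, hP⟩ : ∃ P : Set (unitInterval × ℝ × ℝ × ℝ), P = Set.univ ×ˢ Set.Icc (0 : ℝ) 1 ×ˢ
    Set.Icc 0 (2 * Real.pi) ×ˢ Set.Icc 0 (2 * Real.pi) := ⟨_, rfl⟩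
  have hK : IsCompact P := by
    rw [hP]
    exact isCompact_univ.prod (isCompact_Icc.prod (isCompact_Icc.prod isCompact_Icc))
  have hne : P.Nonempty := ⟨(0, 0, 0, 0), by
    have : 0 ≤ 2 * Real.pi := by positivity
    simp [hP, this]⟩
  obtain ⟨q, hq, hmin⟩ := hK.exists_isMinOn hne
    (f := fun q : unitInterval × ℝ × ℝ × ℝ =>
      ‖joinPt q.2.1 (X (q.1, q.2.2.1) : R4) (Y (q.1, q.2.2.2))‖) (by fun_prop)
  have hu' : q.2.1 ∈ Set.Icc (0 : ℝ) 1 := by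
    rw [hP] at hq
    exact hq.2.1
  refine ⟨_, norm_pos_iff.2 (joinPt_ne_zero (hd q.1 q.2.2.1 q.2.2.2) hu'), fun r u hu s t => ?_⟩
  have p1 : Function.Periodic (fun s => X (r, s)) (2 * Real.pi) := pX r
  have p2 : Function.Periodic (fun s => Y (r, s)) (2 * Real.pi) := pY r
  obtain ⟨s', hs', es⟩ := p1.exists_mem_Ico₀ (by positivity) s
  obtain ⟨t', ht', et⟩ := p2.exists_mem_Ico₀ (by positivity) t
  rw [es, et]
  have hm : (r, u, s', t') ∈ P := by
    rw [hP]
    exact ⟨trivial, hu, ⟨hs'.1, hs'.2.le⟩, ⟨ht'.1, ht'.2.le⟩⟩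
  have := isMinOn_iff.1 hmin _ hm
  simpa only using this

theorem linkingNumber_eq_linkInt {x y : ℝ → S3} (hx : LipLoop (fun s => (x s : R4)) (velocity x))
    (hy : LipLoop (fun s => (y s : R4)) (velocity y)) {c : ℝ} (hc : 0 < c)
    (h : ∀ u ∈ Set.Icc (0 : ℝ) 1, ∀ s t, c ≤ ‖joinPt u (x s : R4) (y t)‖) :
    linkingNumber x y = 1 / (2 * Real.pi ^ 2) *
      linkInt (fun s => (x s : R4)) (velocity x) (fun s => (y s : R4)) (velocity y) := by
  have hpi : (0 : ℝ) ≤ 2 * Real.pi := by positivity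
  have hint := integrable_linkForm hx hy hc h
  unfold linkingNumber linkInt
  congr 1
  unfold joinMeasure at hint ⊢
  rw [integral_prod _ hint, intervalIntegral.integral_of_le hpi]
  have h1 := hint.prod_right_ae
  refine integral_congr_ae (μ := perMeasure) ?_
  filter_upwards [h1] with s hs
  rw [integral_prod _ hs, intervalIntegral.integral_of_le hpi]
  refine integral_congr_ae (μ := perMeasure) (Filter.Eventually.of_forall fun t => ?_)
  simp only
  rw [intervalIntegral.integral_of_le zero_le_one]
  refine integral_congr_ae (μ := unitMeasure) (Filter.Eventually.of_forall fun u => ?_)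
  simp only [linkForm, real_inner_self_eq_norm_sq, joinPt]
  ring

theorem lipLoop_velocity {x : ℝ → S3} (hx : ∃ C, LipschitzWith C x)
    (hp : ∀ s, x (s + 2 * Real.pi) = x s) : LipLoop (fun s => (x s : R4)) (velocity x) := by
  obtain ⟨C, hC⟩ := hx
  have h1 : LipschitzWith C (fun s => (x s : R4)) := by
    exact LipschitzWith.of_dist_le_mul fun a b => hC.dist_le_mul a b
  exact LipLoop.of_lipschitz h1 fun s => by rw [hp]

/-- The linking number is invariant under homotopies through pairs of disjoint closed curves. -/
theorem linkingNumber_eq_of_homotopy {X Y : unitInterval × ℝ → S3} (hX : Continuous X)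
    (hY : Continuous Y) (pX : ∀ r s, X (r, s + 2 * Real.pi) = X (r, s))
    (pY : ∀ r s, Y (r, s + 2 * Real.pi) = Y (r, s)) (hd : ∀ r s t, X (r, s) ≠ Y (r, t))
    (hx₀ : ∃ C, LipschitzWith C fun s => X (0, s)) (hx₁ : ∃ C, LipschitzWith C fun s => X (1, s))
    (hy₀ : ∃ C, LipschitzWith C fun s => Y (0, s)) (hy₁ : ∃ C, LipschitzWith C fun s => Y (1, s)) :
    linkingNumber (fun s => X (0, s)) (fun s => Y (0, s)) =
      linkingNumber (fun s => X (1, s)) (fun s => Y (1, s)) := by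
  obtain ⟨c, hc, h⟩ := exists_le_norm_joinPt hX hY pX pY hd
  have lx₀ := lipLoop_velocity hx₀ (pX 0)
  have lx₁ := lipLoop_velocity hx₁ (pX 1)
  have ly₀ := lipLoop_velocity hy₀ (pY 0)
  have ly₁ := lipLoop_velocity hy₁ (pY 1)
  rw [linkingNumber_eq_linkInt lx₀ ly₀ hc (h 0), linkingNumber_eq_linkInt lx₁ ly₁ hc (h 1)]
  congr 1
  exact linkInt_eq_of_homotopy (X := fun p => (X p : R4)) (Y := fun p => (Y p : R4))
    (by fun_prop) (by fun_prop) (fun r s => by rw [pX]) (fun r s => by rw [pY]) hc h lx₀ lx₁ ly₀ ly₁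

end

/-! ### Linking numbers of toric curves, and the framing of the band -/

section

open MeasureTheory

theorem contDiff_coe_toS3 {E : Type*} [NormedAddCommGroup E] [NormedSpace ℝ E] {n : WithTop ℕ∞}
    {f : E → R4} (hf : ContDiff ℝ n f) (h : ∀ s, f s ≠ 0) :
    ContDiff ℝ n fun s => (toS3 (f s) : R4) := by
  have : (fun s => (toS3 (f s) : R4)) = fun s => ‖f s‖⁻¹ • f s := funext fun s => coe_toS3 (h s)
  rw [this]
  exact ((hf.norm ℝ h).inv fun s => norm_ne_zero_iff.2 (h s)).smul hf

theorem exists_lipschitzWith_of_contDiff {x : ℝ → S3} (h : ContDiff ℝ 1 fun s => (x s : R4))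
    (hp : ∀ s, x (s + 2 * Real.pi) = x s) : ∃ C, LipschitzWith C x := by
  have hd : Continuous (deriv fun s => (x s : R4)) := h.continuous_deriv le_rfl
  have hper : Function.Periodic (fun s => ‖deriv (fun s => (x s : R4)) s‖) (2 * Real.pi) := by
    intro s
    have := deriv_comp_add_const (fun s => (x s : R4)) (2 * Real.pi) s
    simp only [hp] at this
    simp only [← this]
  obtain ⟨M, hM⟩ := isCompact_Icc (a := (0 : ℝ)) (b := 2 * Real.pi) |>.exists_bound_of_continuousOn
    hd.continuousOn
  have hb : ∀ s, ‖deriv (fun s => (x s : R4)) s‖ ≤ M := fun s => by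
    obtain ⟨t, ht, hst⟩ := hper.exists_mem_Ico₀ (by positivity) s
    rw [hst]
    exact hM t ⟨ht.1, ht.2.le⟩
  have hl : LipschitzWith M.toNNReal (fun s => (x s : R4)) := by
    refine lipschitzWith_of_nnnorm_deriv_le (h.differentiable one_ne_zero) fun s => ?_
    rw [← NNReal.coe_le_coe, coe_nnnorm]
    exact (hb s).trans (Real.le_coe_toNNReal _)
  exact ⟨_, LipschitzWith.of_dist_le_mul fun a b => hl.dist_le_mul a b⟩

/-- An ambient isotopy does not change the linking number. -/
theorem linkingNumber_eq_of_isotopicOn {A : Type*} {S : Set A} {ψ ψ' : A → S3}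
    (h : IsotopicOn S ψ ψ') {a b : ℝ → A} (ha : ∀ s, a s ∈ S) (hb : ∀ s, b s ∈ S)
    (la : ∃ C, LipschitzWith C fun s => ψ (a s)) (lb : ∃ C, LipschitzWith C fun s => ψ (b s))
    (la' : ∃ C, LipschitzWith C fun s => ψ' (a s)) (lb' : ∃ C, LipschitzWith C fun s => ψ' (b s))
    (pa : ∀ s, ψ (a (s + 2 * Real.pi)) = ψ (a s)) (pb : ∀ s, ψ (b (s + 2 * Real.pi)) = ψ (b s))
    (hd : ∀ s t, ψ (a s) ≠ ψ (b t)) :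
    linkingNumber (fun s => ψ (a s)) (fun s => ψ (b s)) =
      linkingNumber (fun s => ψ' (a s)) (fun s => ψ' (b s)) := by
  obtain ⟨H, hc, h0, h1⟩ := h
  obtain ⟨C, hC⟩ := la
  obtain ⟨D, hD⟩ := lb
  have cC := hC.continuous
  have cD := hD.continuous
  have key := linkingNumber_eq_of_homotopy (X := fun p => H p.1 (ψ (a p.2)))
    (Y := fun p => H p.1 (ψ (b p.2))) (hc.comp (continuous_fst.prodMk (cC.comp continuous_snd)))
    (hc.comp (continuous_fst.prodMk (cD.comp continuous_snd))) (fun r s => by simp only [pa]) (fun r s => by simp only [pb])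
    (fun r s t e => hd s t ((H r).injective e)) (by simpa only [h0] using ⟨C, hC⟩)
    (by simpa only [h1 _ (ha _)] using la') (by simpa only [h0] using ⟨D, hD⟩)
    (by simpa only [h1 _ (hb _)] using lb')
  simpa only [h0, h1 _ (ha _), h1 _ (hb _)] using key

theorem integral_join_eq_half :
    ∫ u in (0 : ℝ)..1, u * (1 - u) / ((1 - u) ^ 2 + u ^ 2) ^ 2 = 1 / 2 := by
  have hpos : ∀ u : ℝ, 0 < (1 - u) ^ 2 + u ^ 2 := fun u => by
    nlinarith [sq_nonneg (1 - 2 * u)]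
  -- An explicit antiderivative, increasing from 0 to `1/2`.
  have hd : ∀ u : ℝ, HasDerivAt (fun u : ℝ => u ^ 2 / (2 * ((1 - u) ^ 2 + u ^ 2)))
      (u * (1 - u) / ((1 - u) ^ 2 + u ^ 2) ^ 2) u := by
    intro u
    have h1 : HasDerivAt (fun u : ℝ => u ^ 2) (2 * u) u := by simpa using hasDerivAt_pow 2 u
    have h2 : HasDerivAt (fun u : ℝ => (1 - u) ^ 2) (-(2 * (1 - u))) u := by
      simpa using ((hasDerivAt_id u).const_sub 1).fun_pow 2
    refine (h1.fun_div ((h2.fun_add h1).const_mul 2) (by have := hpos u; positivity)).congr_deriv ?_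
    have := (hpos u).ne'
    field_simp
    ring
  rw [intervalIntegral.integral_eq_sub_of_hasDerivAt (fun u _ => hd u)]
  · norm_num
  · apply Continuous.intervalIntegrable
    exact Continuous.div (by fun_prop) (by fun_prop) fun u => by have := hpos u; positivity

/-- The curve `s ↦ (p exp(iεs), q exp(iks))`. -/
def toricCurve (ε k p q s : ℝ) : R4 :=
  !₂[p * Real.cos (ε * s), p * Real.sin (ε * s), q * Real.cos (k * s), q * Real.sin (k * s)]

theorem contDiff_toricCurve (ε k p q : ℝ) : ContDiff ℝ ∞ (toricCurve ε k p q) := by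
  rw [contDiff_euclidean]
  intro i
  fin_cases i <;> simp [toricCurve] <;> fun_prop

theorem norm_toricCurve (ε k p q s : ℝ) : ‖toricCurve ε k p q s‖ = √(p ^ 2 + q ^ 2) := by
  rw [EuclideanSpace.norm_eq]
  congr 1
  simp only [toricCurve, Fin.sum_univ_four, Real.norm_eq_abs, sq_abs]
  simp
  linear_combination p ^ 2 * Real.cos_sq_add_sin_sq (ε * s) +
    q ^ 2 * Real.cos_sq_add_sin_sq (k * s)

theorem toricCurve_ne_zero {ε k p q s : ℝ} (h : 0 < p ^ 2 + q ^ 2) :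
    toricCurve ε k p q s ≠ 0 := by
  rw [← norm_pos_iff, norm_toricCurve]
  positivity

theorem toricCurve_periodic (ε k : ℤ) (p q s : ℝ) :
    toricCurve ε k p q (s + 2 * Real.pi) = toricCurve ε k p q s := by
  have h1 : (ε : ℝ) * (s + 2 * Real.pi) = ε * s + ε * (2 * Real.pi) := by ring
  have h2 : (k : ℝ) * (s + 2 * Real.pi) = k * s + k * (2 * Real.pi) := by ring
  simp only [toricCurve, h1, h2, Real.cos_add_int_mul_two_pi, Real.sin_add_int_mul_two_pi]

theorem exists_lipschitzWith_toricCurve (ε k : ℤ) {p q : ℝ} (h : 0 < p ^ 2 + q ^ 2) :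
    ∃ C, LipschitzWith C fun s => toS3 (toricCurve ε k p q s) :=
  exists_lipschitzWith_of_contDiff ((contDiff_coe_toS3 (contDiff_toricCurve ε k p q)
    fun s => toricCurve_ne_zero h).of_le (by norm_cast)) fun s => by
      rw [toricCurve_periodic]

theorem hasDerivAt_of_coord {f : ℝ → R4} {f' : R4} {x : ℝ}
    (h : ∀ i, HasDerivAt (fun s => f s i) (f' i) x) : HasDerivAt f f' x :=
  (PiLp.continuousLinearEquiv 2 ℝ fun _ : Fin 4 => ℝ).symm.hasFDerivAt.comp_hasDerivAt x
    (hasDerivAt_pi.2 h)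

/-- For great circles in orthogonal planes the determinant is the constant `ε k` and the norm of the
join point depends on `u` alone. The integral is `(2π)² · ε k · 1/2`, and division by `2π²` gives
the value. -/
theorem linkingNumber_great_circles (ε k : ℤ) :
    linkingNumber (fun s => toS3 (toricCurve ε k 0 1 s)) (fun s => toS3 (toricCurve ε k 1 0 s)) =
      ε * k := by
  have c1 : ∀ s, (toS3 (toricCurve ε k 0 1 s) : R4) = toricCurve ε k 0 1 s := fun s => by
    rw [coe_toS3 (toricCurve_ne_zero (by norm_num)), norm_toricCurve]; simp
  have c2 : ∀ s, (toS3 (toricCurve ε k 1 0 s) : R4) = toricCurve ε k 1 0 s := fun s => by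
    rw [coe_toS3 (toricCurve_ne_zero (by norm_num)), norm_toricCurve]; simp
  have dcos : ∀ (a s : ℝ), HasDerivAt (fun s => Real.cos (a * s)) (-(a * Real.sin (a * s))) s :=
    fun a s => by
      have := ((hasDerivAt_id s).const_mul a).cos
      simpa [mul_comm] using this
  have dsin : ∀ (a s : ℝ), HasDerivAt (fun s => Real.sin (a * s)) (a * Real.cos (a * s)) s :=
    fun a s => by
      have := ((hasDerivAt_id s).const_mul a).sin
      simpa [mul_comm] using this
  have d1 : ∀ s, velocity (fun s => toS3 (toricCurve ε k 0 1 s)) s =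
      !₂[0, 0, -(k * Real.sin (k * s)), k * Real.cos (k * s)] := fun s => by
    simp only [velocity, c1]
    refine HasDerivAt.deriv ?_
    refine hasDerivAt_of_coord fun i => ?_
    fin_cases i
    · simpa [toricCurve] using hasDerivAt_const s (0 : ℝ)
    · simpa [toricCurve] using hasDerivAt_const s (0 : ℝ)
    · simpa [toricCurve] using dcos k s
    · simpa [toricCurve] using dsin k s
  have d2 : ∀ s, velocity (fun s => toS3 (toricCurve ε k 1 0 s)) s =
      !₂[-(ε * Real.sin (ε * s)), ε * Real.cos (ε * s), 0, 0] := fun s => by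
    simp only [velocity, c2]
    refine HasDerivAt.deriv ?_
    refine hasDerivAt_of_coord fun i => ?_
    fin_cases i
    · simpa [toricCurve] using dcos ε s
    · simpa [toricCurve] using dsin ε s
    · simpa [toricCurve] using hasDerivAt_const s (0 : ℝ)
    · simpa [toricCurve] using hasDerivAt_const s (0 : ℝ)
  have hdet : ∀ s t, det4 (toricCurve ε k 0 1 s) !₂[0, 0, -(k * Real.sin (k * s)),
      k * Real.cos (k * s)] (toricCurve ε k 1 0 t) !₂[-(ε * Real.sin (ε * t)),
      ε * Real.cos (ε * t), 0, 0] = ε * k := fun s t => by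
    simp only [det4_eq, toricCurve]
    simp
    have e1 := Real.cos_sq_add_sin_sq (k * s)
    have e2 := Real.cos_sq_add_sin_sq (ε * t)
    linear_combination (ε * k * (Real.cos (ε * t) ^ 2 + Real.sin (ε * t) ^ 2)) * e1 + ε * k * e2
  have hnorm : ∀ u s t, ‖(1 - u) • toricCurve ε k 0 1 s - u • toricCurve ε k 1 0 t‖ ^ 4 =
      ((1 - u) ^ 2 + u ^ 2) ^ 2 := fun u s t => by
    rw [show ∀ a : ℝ, a ^ 4 = (a ^ 2) ^ 2 from fun a => by ring, EuclideanSpace.norm_sq_eq]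
    congr 1
    simp only [Fin.sum_univ_four, Real.norm_eq_abs, sq_abs, toricCurve]
    simp
    linear_combination (1 - u) ^ 2 * Real.cos_sq_add_sin_sq (k * s) +
      u ^ 2 * Real.cos_sq_add_sin_sq (ε * t)
  unfold linkingNumber
  simp only [c1, c2, d1, d2, hdet, hnorm]
  have : ∀ u : ℝ, u * (1 - u) * (ε * k) / ((1 - u) ^ 2 + u ^ 2) ^ 2 =
      (ε * k : ℝ) * (u * (1 - u) / ((1 - u) ^ 2 + u ^ 2) ^ 2) := fun u => by ring
  simp only [this, intervalIntegral.integral_const_mul, integral_join_eq_half,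
    intervalIntegral.integral_const, sub_zero, smul_eq_mul]
  field_simp

/-- If the points agree up to a positive factor `c`, comparing moduli of the two complex coordinates
gives `1 - r = c` and `c (1 - r) = 1`, hence `c = 1` and `r = 0`. There the first coordinates fix
the parameter modulo `2π`, as `ε = ±1`, and the second coordinates are opposite and nonzero. -/
theorem toS3_toricCurve_ne {ε k : ℤ} (hε : ε = 1 ∨ ε = -1) {p q : ℝ} (hp : 0 < p) (hq : 0 < q)
    {r : ℝ} (hr : r ≤ 1) (s t : ℝ) :
    toS3 (toricCurve ε k (p * (1 - r)) q s) ≠ toS3 (toricCurve ε k p (-q * (1 - r)) t) := by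
  intro e
  have n1 : 0 < (p * (1 - r)) ^ 2 + q ^ 2 := by positivity
  have n2 : 0 < p ^ 2 + (-q * (1 - r)) ^ 2 := by positivity
  have e1 := eq_smul_of_toS3_eq (toricCurve_ne_zero (n1)) (toricCurve_ne_zero (n2)) e
  have hc : 0 < ‖toricCurve ε k (p * (1 - r)) q s‖ *
      ‖toricCurve ε k p (-q * (1 - r)) t‖⁻¹ :=
    mul_pos (norm_pos_iff.2 (toricCurve_ne_zero (n1)))
      (inv_pos.2 (norm_pos_iff.2 (toricCurve_ne_zero (n2))))
  generalize ‖toricCurve ε k (p * (1 - r)) q s‖ *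
      ‖toricCurve ε k p (-q * (1 - r)) t‖⁻¹ = c at e1 hc
  have i0 := congrArg (fun v : R4 => v 0) e1
  have i1 := congrArg (fun v : R4 => v 1) e1
  have i2 := congrArg (fun v : R4 => v 2) e1
  have i3 := congrArg (fun v : R4 => v 3) e1
  simp [toricCurve] at i0 i1 i2 i3
  have hr0 : (0 : ℝ) ≤ 1 - r := by linarith
  have a1 : (1 - r) = c := by
    have : (p * (1 - r)) ^ 2 = (c * p) ^ 2 := by
      linear_combination -(p * (1 - r)) ^ 2 * Real.cos_sq_add_sin_sq (ε * s) +
        (c * p) ^ 2 * Real.cos_sq_add_sin_sq (ε * t) +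
        (p * (1 - r) * Real.cos (ε * s) + c * (p * Real.cos (ε * t))) * i0 +
        (p * (1 - r) * Real.sin (ε * s) + c * (p * Real.sin (ε * t))) * i1
    have := (sq_eq_sq₀ (by positivity) (by positivity)).1 this
    exact mul_left_cancel₀ hp.ne' (by linarith)
  have a2 : c * (1 - r) = 1 := by
    have : q ^ 2 = (c * (q * (1 - r))) ^ 2 := by
      linear_combination -q ^ 2 * Real.cos_sq_add_sin_sq (k * s) +
        (c * (q * (1 - r))) ^ 2 * Real.cos_sq_add_sin_sq (k * t) +
        (q * Real.cos (k * s) - c * (q * (1 - r) * Real.cos (k * t))) * i2 +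
        (q * Real.sin (k * s) - c * (q * (1 - r) * Real.sin (k * t))) * i3
    have := (sq_eq_sq₀ hq.le (by positivity)).1 this
    exact mul_left_cancel₀ hq.ne' (by linarith)
  have a3 : c = 1 := by
    rw [a1] at a2
    nlinarith
  rw [a1, a3] at i0 i1 i2 i3
  have j0 : Real.cos (ε * s) = Real.cos (ε * t) := mul_left_cancel₀ hp.ne' (by linarith)
  have j1 : Real.sin (ε * s) = Real.sin (ε * t) := mul_left_cancel₀ hp.ne' (by linarith)
  obtain ⟨j, hj⟩ := eq_add_of_cos_sin_eq j0 j1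
  have hts : (k : ℝ) * t = k * s + ((k * ε * j : ℤ) : ℝ) * (2 * Real.pi) := by
    have hε2 : (ε : ℝ) * ε = 1 := by rcases hε with rfl | rfl <;> norm_num
    push_cast
    linear_combination k * ε * hj - k * t * hε2 + k * s * hε2
  rw [hts, Real.cos_add_int_mul_two_pi] at i2
  rw [hts, Real.sin_add_int_mul_two_pi] at i3
  have b2 : Real.cos (k * s) = 0 := by
    have : q * Real.cos (k * s) = 0 := by linarith
    exact (mul_eq_zero.1 this).resolve_left hq.ne'
  have b3 : Real.sin (k * s) = 0 := by
    have : q * Real.sin (k * s) = 0 := by linarith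
    exact (mul_eq_zero.1 this).resolve_left hq.ne'
  have := Real.cos_sq_add_sin_sq (k * s)
  rw [b2, b3] at this
  norm_num at this

/-- Shrinking the first coordinate of one curve and the second coordinate of the other keeps them
disjoint and ends at the two orthogonal great circles. -/
theorem linkingNumber_toricCurve {ε k : ℤ} (hε : ε = 1 ∨ ε = -1) {p q : ℝ} (hp : 0 < p)
    (hq : 0 < q) : linkingNumber (fun s => toS3 (toricCurve ε k p q s))
      (fun s => toS3 (toricCurve ε k p (-q) s)) = ε * k := by
  have n1 : ∀ r : unitInterval, 0 < (p * (1 - (r : ℝ))) ^ 2 + q ^ 2 := fun r => by positivity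
  have n2 : ∀ r : unitInterval, 0 < p ^ 2 + (-q * (1 - (r : ℝ))) ^ 2 := fun r => by positivity
  have cont : ∀ f g : unitInterval → ℝ, Continuous f → Continuous g →
      (∀ r, 0 < f r ^ 2 + g r ^ 2) →
      Continuous fun z : unitInterval × ℝ => toS3 (toricCurve ε k (f z.1) (g z.1) z.2) := by
    intro f g hf hg hfg
    rw [continuous_iff_continuousAt]
    intro z
    refine (continuousAt_toS3 (toricCurve_ne_zero (hfg z.1))).comp (f := fun z : unitInterval × ℝ =>
      toricCurve ε k (f z.1) (g z.1) z.2) (Continuous.continuousAt ?_)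
    unfold toricCurve
    fun_prop
  have lX : ∀ r : unitInterval, ∃ C, LipschitzWith C fun s =>
      toS3 (toricCurve ε k (p * (1 - (r : ℝ))) q s) := fun r =>
    exists_lipschitzWith_toricCurve ε k (n1 r)
  have lY : ∀ r : unitInterval, ∃ C, LipschitzWith C fun s =>
      toS3 (toricCurve ε k p (-q * (1 - (r : ℝ))) s) := fun r =>
    exists_lipschitzWith_toricCurve ε k (n2 r)
  have cX := cont (fun r => p * (1 - (r : ℝ))) (fun _ => q) (by fun_prop) (by fun_prop) n1
  have cY := cont (fun _ => p) (fun r => -q * (1 - (r : ℝ))) (by fun_prop) (by fun_prop) n2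
  have key := linkingNumber_eq_of_homotopy
    (X := fun z => toS3 (toricCurve ε k (p * (1 - (z.1 : ℝ))) q z.2))
    (Y := fun z => toS3 (toricCurve ε k p (-q * (1 - (z.1 : ℝ))) z.2))
    cX cY
    (fun r s => by rw [toricCurve_periodic]) (fun r s => by rw [toricCurve_periodic])
    (fun r s t => toS3_toricCurve_ne hε hp hq r.2.2 s t)
    (lX 0) (lX 1) (lY 0) (lY 1)
  simp only [Set.Icc.coe_zero, Set.Icc.coe_one, sub_zero, sub_self, mul_one,
    mul_zero] at key
  rw [key, ← linkingNumber_great_circles]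
  have s1 : ∀ s, toS3 (toricCurve ε k 0 q s) = toS3 (toricCurve ε k 0 1 s) := fun s => by
    rw [← toS3_smul hq (toricCurve ε k 0 1 s)]
    congr 1
    ext i
    fin_cases i <;> simp [toricCurve]
  have s2 : ∀ s, toS3 (toricCurve ε k p 0 s) = toS3 (toricCurve ε k 1 0 s) := fun s => by
    rw [← toS3_smul hp (toricCurve ε k 1 0 s)]
    congr 1
    ext i
    fin_cases i <;> simp [toricCurve]
  simp only [s1, s2]

/-- A solid torus about a characteristic band of a trivial knot is, up to an ambient isotopy, the
untwisted standard solid torus. -/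
theorem exists_isotopicOn_standard_untwisted {K : Set S3} (hK : IsTrivialKnot K)
    {F : CharacteristicBand K} (N : Thickening F) : ∃ ε : ℤ, (ε = 1 ∨ ε = -1) ∧
      ∃ δ : ℝ, 0 < δ ∧ IsotopicOn (tube 1) (fun p => N.coord p.1 p.2)
        (fun p => toS3 (framed ε (fun ρ => ε * ρ) (fun _ => 0) (p.1, δ * p.2))) := by
  obtain ⟨ε, m, hε, δ, hδ, h⟩ := exists_isotopicOn_standard hK N
  refine ⟨ε, hε, δ, hδ, ?_⟩
  suffices hm : m = 0 by
    subst hm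
    simpa using h
  have t1 : ∀ s : ℝ, ((s, (1 : ℂ)) : ℝ × ℂ) ∈ tube 1 := fun s => by simp [tube]
  have t2 : ∀ s : ℝ, ((s, (-1 : ℂ)) : ℝ × ℂ) ∈ tube 1 := fun s => by simp [tube]
  have c1 : ∀ s, N.coord s 1 = F.coord s 1 := fun s => by
    simpa using N.extends_band s 1 (by simp)
  have c2 : ∀ s, N.coord s (-1) = F.coord s (-1) := fun s => by
    simpa using N.extends_band s (-1) (by simp)
  have f1 : ∀ s, framed ε (fun ρ => ε * ρ) (fun ρ => m * ρ) (s, δ * 1) =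
      toricCurve ε m 1 δ s := fun s => by
    ext i
    fin_cases i <;> simp [framed, toricCurve]
  have f2 : ∀ s, framed ε (fun ρ => ε * ρ) (fun ρ => m * ρ) (s, δ * -1) =
      toricCurve ε m 1 (-δ) s := fun s => by
    ext i
    fin_cases i <;> simp [framed, toricCurve]
  have smooth : ∀ v : ℂ, ContDiff ℝ 1 fun s => (N.coord s v : R4) := fun v =>
    (N.smooth.comp (by fun_prop : ContDiff ℝ ∞ fun s : ℝ => (s, v))).of_le
      (by norm_cast)
  have p1 : ∀ s, N.coord (s + 2 * Real.pi) 1 = N.coord s 1 := fun s => N.periodic s 1 (by simp)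
  have p2 : ∀ s, N.coord (s + 2 * Real.pi) (-1) = N.coord s (-1) := fun s =>
    N.periodic s (-1) (by simp)
  -- The edges `v = ±1` of the band go to the toric curves of parameters `(1, ±δ)`, of linking
  -- number `ε m`; the band prescribes zero.
  have key := linkingNumber_eq_of_isotopicOn h (a := fun s => (s, 1)) (b := fun s => (s, -1)) t1 t2
    (exists_lipschitzWith_of_contDiff (smooth 1) p1)
    (exists_lipschitzWith_of_contDiff (smooth (-1)) p2)
    (by simpa only [f1] using exists_lipschitzWith_toricCurve ε m (by positivity))
    (by simpa only [f2] using exists_lipschitzWith_toricCurve ε m (by positivity)) p1 p2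
    (fun s t e => by
      have := (N.injective s t 1 (by simp) (-1) (by simp) e).1
      norm_num at this)
  simp only [c1, c2, f1, f2, linkingNumber_toricCurve hε one_pos hδ] at key
  rw [F.linking] at key
  have : ε * m = 0 := by exact_mod_cast key.symm
  rcases hε with rfl | rfl <;> simpa using this

end

section

/-! ### Functions of the argument -/

section ArgFun

variable {g : ℝ → ℝ} (hp : Function.Periodic g (2 * Real.pi))

/-- The function of `z` whose value at `|z| exp(iφ)` is `g φ`. -/
def argFun (z : ℂ) : ℝ := hp.lift (Complex.arg z : Real.Angle)

theorem argFun_eq (z : ℂ) : argFun hp z = g (Complex.arg z) := rfl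

theorem argFun_smul {c : ℝ} (hc : 0 < c) (z : ℂ) : argFun hp (c * z) = argFun hp z := by
  rw [argFun, argFun, Complex.arg_real_mul z hc]

theorem argFun_circle (φ : ℝ) : argFun hp ⟨Real.cos φ, Real.sin φ⟩ = g φ := by
  have h : (⟨Real.cos φ, Real.sin φ⟩ : ℂ) = Real.Angle.cos φ + Real.Angle.sin φ * Complex.I := by
    rw [Real.Angle.cos_coe, Real.Angle.sin_coe, Complex.mk_eq_add_mul_I]
  rw [argFun, h, Complex.arg_cos_add_sin_mul_I_coe_angle]
  rfl

theorem continuousAt_argFun (hg : Continuous g) {z : ℂ} (hz : z ≠ 0) :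
    ContinuousAt (argFun hp) z := by
  have h1 : Continuous (hp.lift : Real.Angle → ℝ) := continuous_coinduced_dom.2 hg
  exact h1.continuousAt.comp (Complex.continuousAt_arg_coe_angle hz)

/-- The argument is discontinuous at the origin only, where boundedness of `g` and `k 0 = 0` force
the product to tend to zero. -/
theorem continuous_mul_argFun (hg : Continuous g) {M : ℝ} (hM : ∀ φ, |g φ| ≤ M) {k : ℂ → ℂ}
    (hk : Continuous k) (h0 : k 0 = 0) : Continuous fun z => k z * (argFun hp z : ℂ) := by
  rw [continuous_iff_continuousAt]
  intro z
  by_cases hz : z = 0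
  · subst hz
    rw [ContinuousAt, h0, zero_mul]
    have h1 : Filter.Tendsto (fun z => ‖k z‖ * M) (𝓝 0) (𝓝 0) := by
      have : Continuous fun z => ‖k z‖ * M := by fun_prop
      simpa [h0] using this.tendsto 0
    refine squeeze_zero_norm (fun w => ?_) h1
    rw [norm_mul, Complex.norm_real, Real.norm_eq_abs, argFun_eq]
    exact mul_le_mul_of_nonneg_left (hM _) (norm_nonneg _)
  · exact hk.continuousAt.mul
      (Complex.continuous_ofReal.continuousAt.comp (continuousAt_argFun hp hg hz))

end ArgFun

theorem Function.Periodic.exists_abs_le {g : ℝ → ℝ} (hp : Function.Periodic g (2 * Real.pi))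
    (hg : Continuous g) : ∃ M, ∀ φ, |g φ| ≤ M := by
  obtain ⟨M, hM⟩ := isCompact_Icc (a := (0 : ℝ)) (b := 2 * Real.pi)
    |>.exists_bound_of_continuousOn hg.continuousOn
  refine ⟨M, fun s => ?_⟩
  obtain ⟨t, ht, hst⟩ := hp.exists_mem_Ico₀ (by positivity) s
  rw [hst]
  exact hM t ⟨ht.1, ht.2.le⟩

/-! ### Complex coordinates on `R4` -/

/-- The point of `R4` with the given complex coordinates. -/
def ofPair (z w : ℂ) : R4 := !₂[z.re, z.im, w.re, w.im]

/-- The first complex coordinate. -/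
def fstC (x : R4) : ℂ := ⟨x 0, x 1⟩

/-- The second complex coordinate. -/
def sndC (x : R4) : ℂ := ⟨x 2, x 3⟩

@[simp] theorem fstC_ofPair (z w : ℂ) : fstC (ofPair z w) = z := by
  simp [fstC, ofPair]

@[simp] theorem sndC_ofPair (z w : ℂ) : sndC (ofPair z w) = w := by
  simp [sndC, ofPair]

theorem ofPair_fstC_sndC (x : R4) : ofPair (fstC x) (sndC x) = x := by
  ext i
  fin_cases i <;> simp [ofPair, fstC, sndC]

theorem fstC_smul (c : ℝ) (x : R4) : fstC (c • x) = c * fstC x := by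
  apply Complex.ext <;> simp [fstC]

theorem sndC_smul (c : ℝ) (x : R4) : sndC (c • x) = c * sndC x := by
  apply Complex.ext <;> simp [sndC]

theorem smul_ofPair (c : ℝ) (z w : ℂ) : c • ofPair z w = ofPair (c * z) (c * w) := by
  ext i
  fin_cases i <;> simp [ofPair]

theorem norm_ofPair (z w : ℂ) : ‖ofPair z w‖ = √(‖z‖ ^ 2 + ‖w‖ ^ 2) := by
  rw [EuclideanSpace.norm_eq]
  congr 1
  simp only [Fin.sum_univ_four, Real.norm_eq_abs, sq_abs, Complex.sq_norm, Complex.normSq_apply]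
  simp [ofPair]
  ring

@[fun_prop]
theorem continuous_fstC : Continuous fstC := by
  have : fstC = fun x : R4 => (x 0 : ℂ) + (x 1 : ℂ) * Complex.I := by
    funext x
    apply Complex.ext <;> simp [fstC]
  rw [this]
  fun_prop

@[fun_prop]
theorem continuous_sndC : Continuous sndC := by
  have : sndC = fun x : R4 => (x 2 : ℂ) + (x 3 : ℂ) * Complex.I := by
    funext x
    apply Complex.ext <;> simp [sndC]
  rw [this]
  fun_prop

theorem Continuous.ofPair {T : Type*} [TopologicalSpace T] {z w : T → ℂ} (hz : Continuous z)
    (hw : Continuous w) : Continuous fun t => ofPair (z t) (w t) := by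
  unfold MetricKnots.ofPair
  fun_prop

theorem toS3_homogeneous {f : R4 → R4} (h : ∀ c : ℝ, 0 < c → ∀ x, f (c • x) = c • f x) {x : R4}
    (hx : x ≠ 0) : toS3 (f (toS3 x)) = toS3 (f x) := by
  have hc : 0 < ‖x‖⁻¹ := inv_pos.2 (norm_pos_iff.2 hx)
  rw [coe_toS3 hx, h _ hc, toS3_smul hc]

/-- Rescaling the first complex coordinate by a positive function of its argument. -/
theorem isotopicOn_radial {g : ℝ → ℝ} (hp : Function.Periodic g (2 * Real.pi)) (hg : Continuous g)
    (hpos : ∀ φ, 0 < g φ) {A : Type*} (S : Set A) (V : A → R4) (hV : ∀ a, V a ≠ 0) :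
    IsotopicOn S (fun a => toS3 (V a))
      (fun a => toS3 (ofPair (fstC (V a) * argFun hp (fstC (V a))) (sndC (V a)))) := by
  obtain ⟨M, hM⟩ := Function.Periodic.exists_abs_le hp hg
  -- A convex combination of 1 and a positive function of the argument. It is unchanged by the
  -- rescaling it defines, so dividing by the same factor inverts the map.
  let m : ℝ → ℂ → ℝ := fun s z => 1 - s + s * argFun hp z
  have mpos : ∀ s ∈ Set.Icc (0 : ℝ) 1, ∀ z, 0 < m s z := fun s hs z => by
    have h1 : 0 < argFun hp z := hpos _
    rcases hs.1.eq_or_lt with rfl | h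
    · simp [m]
    · have := mul_pos h h1
      have := hs.2
      simp only [m]
      linarith
  have mhom : ∀ s z, ∀ c : ℝ, 0 < c → m s (c * z) = m s z := fun s z c hc => by
    simp only [m, argFun_smul hp hc]
  let f : ℝ → R4 → R4 := fun s x => ofPair (fstC x * m s (fstC x)) (sndC x)
  have hom : ∀ s, ∀ c : ℝ, 0 < c → ∀ x, f s (c • x) = c • f s x := fun s c hc x => by
    simp only [f, fstC_smul, sndC_smul, mhom s _ c hc, smul_ofPair, mul_assoc]
  have h := isotopicOn_of_homogeneous f ?_ (fun s _ => hom s) ?_ ?_ S (fun a => toS3 (V a))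
  · convert h using 2 with a
    rw [toS3_homogeneous (hom 1) (hV a)]
    simp [f, m]
  · apply Continuous.ofPair
    · have h1 := continuous_mul_argFun hp hg hM continuous_id rfl
      have h2 : Continuous fun p : unitInterval × S3 => fstC (p.2 : R4) := by fun_prop
      have h3 := h1.comp h2
      have h4 : (fun p : unitInterval × S3 => fstC (p.2 : R4) * (m p.1 (fstC (p.2 : R4)) : ℂ)) =
          fun p => fstC (p.2 : R4) * (1 - ((p.1 : ℝ) : ℂ)) + ((p.1 : ℝ) : ℂ) *
            ((fun z => id z * (argFun hp z : ℂ)) ∘ fun p : unitInterval × S3 =>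
              fstC (p.2 : R4)) p := by
        funext p
        simp only [m, Function.comp, id]
        push_cast
        ring
      rw [h4]
      fun_prop
    · fun_prop
  · intro s hs
    refine Function.bijective_iff_has_inverse.2
      ⟨fun x => ofPair (fstC x * (m s (fstC x))⁻¹) (sndC x), fun x => ?_, fun x => ?_⟩
    · have h0 : (m s (fstC x) : ℂ) ≠ 0 := Complex.ofReal_ne_zero.2 (mpos s hs _).ne'
      have h1 : m s (fstC x * m s (fstC x)) = m s (fstC x) := by
        rw [mul_comm, mhom s _ _ (mpos s hs _)]
      simp only [f, fstC_ofPair, sndC_ofPair, h1, Complex.ofReal_inv]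
      rw [mul_assoc, mul_inv_cancel₀ h0, mul_one, ofPair_fstC_sndC]
    · have h0 : (m s (fstC x) : ℂ) ≠ 0 := Complex.ofReal_ne_zero.2 (mpos s hs _).ne'
      have h1 : m s (fstC x * (m s (fstC x) : ℂ)⁻¹) = m s (fstC x) := by
        rw [mul_comm, ← Complex.ofReal_inv, mhom s _ _ (inv_pos.2 (mpos s hs _))]
      simp only [f, fstC_ofPair, sndC_ofPair, Complex.ofReal_inv, h1]
      rw [mul_assoc, inv_mul_cancel₀ h0, mul_one, ofPair_fstC_sndC]
  · intro x
    simp [f, m, ofPair_fstC_sndC]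

/-- Rotating the second complex coordinate by an angle which depends on the first one. -/
theorem isotopicOn_twist {g : ℝ → ℝ} (hp : Function.Periodic g (2 * Real.pi)) (hg : Continuous g)
    {A : Type*} (S : Set A) (V : A → R4) (hV : ∀ a, ‖fstC (V a)‖ = 1 ∧ ‖sndC (V a)‖ = 1) :
    IsotopicOn S (fun a => toS3 (V a)) (fun a => toS3 (ofPair (fstC (V a))
      (sndC (V a) * Complex.exp (argFun hp (fstC (V a)) * Complex.I)))) := by
  obtain ⟨M, hM⟩ := Function.Periodic.exists_abs_le hp hg
  -- The weight `√2 ‖z‖ / ‖x‖` is homogeneous of degree 0, removes the discontinuity on the circle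
  -- `z = 0`, and equals 1 where both coordinates have the same modulus. The rotation changes
  -- neither `z` nor `‖x‖`, so the opposite angle gives the inverse.
  let e : ℝ → R4 → ℂ := fun s x => s * (√2 * (‖fstC x‖ * argFun hp (fstC x)) / ‖x‖)
  let f : ℝ → R4 → R4 := fun s x => ofPair (fstC x) (sndC x * Complex.exp (e s x * Complex.I))
  have ehom : ∀ s x, ∀ c : ℝ, 0 < c → e s (c • x) = e s x := fun s x c hc => by
    simp only [e, fstC_smul, argFun_smul hp hc, norm_smul, norm_mul, Complex.norm_real,
      Real.norm_eq_abs, abs_of_pos hc]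
    have : (c : ℂ) ≠ 0 := Complex.ofReal_ne_zero.2 hc.ne'
    by_cases hx : x = 0
    · simp [hx]
    · have : (‖x‖ : ℂ) ≠ 0 := Complex.ofReal_ne_zero.2 (norm_ne_zero_iff.2 hx)
      push_cast
      field_simp
  have enorm : ∀ s x, ‖Complex.exp (e s x * Complex.I)‖ = 1 := fun s x => by
    have : e s x = ((s * (√2 * (‖fstC x‖ * argFun hp (fstC x)) / ‖x‖) : ℝ) : ℂ) := by
      simp only [e]; push_cast; ring
    rw [this, Complex.norm_exp_ofReal_mul_I]
  have hom : ∀ s, ∀ c : ℝ, 0 < c → ∀ x, f s (c • x) = c • f s x := fun s c hc x => by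
    simp only [f, ehom s x c hc, fstC_smul, sndC_smul, smul_ofPair, mul_assoc]
  have hnorm : ∀ x : R4, ‖x‖ = √(‖fstC x‖ ^ 2 + ‖sndC x‖ ^ 2) := fun x => by
    conv_lhs => rw [← ofPair_fstC_sndC x, norm_ofPair]
  have hV' : ∀ a, ‖V a‖ = √2 := fun a => by
    rw [hnorm, (hV a).1, (hV a).2]
    norm_num
  have h := isotopicOn_of_homogeneous f ?_ (fun s _ => hom s) ?_ ?_ S (fun a => toS3 (V a))
  · convert h using 2 with a
    have h2 : (√2 : ℂ) ≠ 0 := Complex.ofReal_ne_zero.2 (by positivity)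
    rw [toS3_homogeneous (hom 1) (norm_pos_iff.1 (by rw [hV']; positivity))]
    simp only [f, e, hV', (hV a).1]
    simp [h2]
  · apply Continuous.ofPair
    · fun_prop
    · have h1 := continuous_mul_argFun hp hg hM (k := fun z => (‖z‖ : ℂ)) (by fun_prop) (by simp)
      have h2 : Continuous fun p : unitInterval × S3 => fstC (p.2 : R4) := by fun_prop
      have h3 := h1.comp h2
      have h4 : (fun p : unitInterval × S3 => e p.1 p.2) = fun p => ((p.1 : ℝ) : ℂ) * ((√2 : ℂ) *
            ((fun z => (‖z‖ : ℂ) * (argFun hp z : ℂ)) ∘ fun p : unitInterval × S3 =>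
              fstC (p.2 : R4)) p) := by
        funext p
        simp [e]
      have h5 : Continuous fun p : unitInterval × S3 => e p.1 p.2 := by
        rw [h4]
        fun_prop
      have h6 : Continuous fun p : unitInterval × S3 => sndC (p.2 : R4) := by fun_prop
      exact h6.mul (Complex.continuous_exp.comp (h5.mul continuous_const))
  · intro s hs
    have finv : ∀ x v : R4, fstC v = fstC x → ‖v‖ = ‖x‖ → e s v = e s x := fun x v h1 h2 => by
      simp only [e, h1, h2]
    refine Function.bijective_iff_has_inverse.2
      ⟨fun x => ofPair (fstC x) (sndC x * Complex.exp (-(e s x * Complex.I))), fun x => ?_,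
        fun x => ?_⟩
    · have h1 : e s (f s x) = e s x := finv _ _ (by simp [f]) (by
        rw [hnorm (f s x), hnorm x]
        simp only [f, fstC_ofPair, sndC_ofPair, norm_mul, enorm, mul_one])
      simp only [h1]
      simp only [f, fstC_ofPair, sndC_ofPair]
      rw [mul_assoc, ← Complex.exp_add, add_neg_cancel, Complex.exp_zero, mul_one,
        ofPair_fstC_sndC]
    · have h1 : e s (ofPair (fstC x) (sndC x * Complex.exp (-(e s x * Complex.I)))) = e s x :=
        finv _ _ (by simp) (by
          rw [hnorm (ofPair _ _), hnorm x]
          simp only [fstC_ofPair, sndC_ofPair, norm_mul, Complex.exp_neg, norm_inv, enorm,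
            inv_one, mul_one])
      simp only [f, h1, fstC_ofPair, sndC_ofPair]
      rw [mul_assoc, ← Complex.exp_add, neg_add_cancel, Complex.exp_zero, mul_one,
        ofPair_fstC_sndC]
  · intro x
    simp [f, e, ofPair_fstC_sndC]

/-- Three isotopies in succession: the standard position of the solid torus, a radial rescaling that
absorbs `δ r`, and a rotation that replaces the angle by one in which the twist is linear in `ρ`. -/
theorem isotopicOn_torus {K : Set S3} (hK : IsTrivialKnot K) {F : CharacteristicBand K}
    (N : Thickening F) {n : ℤ} {r θ : ℝ → ℝ} (hr : Continuous r)
    (pr : ∀ ρ, r (ρ + 2 * Real.pi) = r ρ) (r0 : ∀ ρ, 0 < r ρ) (r1 : ∀ ρ, r ρ ≤ 1)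
    (hθ : Continuous θ) (pθ : ∀ ρ, θ (ρ + 2 * Real.pi) = θ ρ + 2 * Real.pi * n) :
    ∃ ε : ℤ, (ε = 1 ∨ ε = -1) ∧ IsotopicOn (Set.univ : Set (ℝ × ℝ))
      (fun p => N.coord p.1 (r p.1 * Complex.exp (p.2 * Complex.I)))
      (fun p => toS3 !₂[Real.cos (ε * p.1), Real.sin (ε * p.1),
        Real.cos (ε * (p.2 + n * p.1 - θ p.1)), Real.sin (ε * (p.2 + n * p.1 - θ p.1))]) := by
  obtain ⟨ε, hε, δ, hδ, h⟩ := exists_isotopicOn_standard_untwisted hK N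
  have hε2 : (ε : ℝ) * ε = 1 := by rcases hε with rfl | rfl <;> norm_num
  refine ⟨ε, hε, ?_⟩
  have perε : ∀ g : ℝ → ℝ, Function.Periodic g (2 * Real.pi) →
      Function.Periodic (fun φ => g (ε * φ)) (2 * Real.pi) := fun g hg φ => by
    have := hg.int_mul ε (ε * φ)
    simp only [mul_add]
    exact this
  have p1 : Function.Periodic (fun φ => δ * r (ε * φ)) (2 * Real.pi) := fun φ => by
    simp only [perε r pr φ]
  -- Although `θ` is not periodic, `nρ - θ(ρ)` is. Functions of `ρ` are read as functions of the
  -- argument `φ = ερ` of the first coordinate, with `ρ = εφ`.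
  have p2 : Function.Periodic (fun φ => ε * (n * (ε * φ) - θ (ε * φ))) (2 * Real.pi) :=
    perε (fun ρ => ε * (n * ρ - θ ρ)) fun ρ => by simp only [pθ]; ring
  have s1 := h.comp (R := (Set.univ : Set (ℝ × ℝ)))
    (fun p => (p.1, (r p.1 * Complex.exp (p.2 * Complex.I) : ℂ))) fun p _ => by
      simp only [tube, Set.mem_ofPred_eq, norm_mul, Complex.norm_exp_ofReal_mul_I, mul_one,
        Complex.norm_real, Real.norm_eq_abs, abs_of_pos (r0 _), r1]
  let V : ℝ × ℝ → R4 := fun p => ofPair ⟨Real.cos (ε * p.1), Real.sin (ε * p.1)⟩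
    ((δ * r p.1 : ℝ) * ⟨Real.cos (ε * p.2), Real.sin (ε * p.2)⟩)
  have hcirc : ∀ φ : ℝ, ‖(⟨Real.cos φ, Real.sin φ⟩ : ℂ)‖ = 1 := fun φ => by
    rw [Complex.norm_eq_sqrt_sq_add_sq, Real.cos_sq_add_sin_sq, Real.sqrt_one]
  have e1 : ∀ p : ℝ × ℝ, framed ε (fun ρ => ε * ρ) (fun _ => 0)
      (p.1, δ * (r p.1 * Complex.exp (p.2 * Complex.I))) = V p := fun p => by
    have hre : (Complex.exp (p.2 * Complex.I)).re = Real.cos p.2 := Complex.exp_ofReal_mul_I_re _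
    have him : (Complex.exp (p.2 * Complex.I)).im = Real.sin p.2 := Complex.exp_ofReal_mul_I_im _
    have c1 : Real.cos (ε * p.2) = Real.cos p.2 := by rcases hε with rfl | rfl <;> simp
    have c2 : Real.sin (ε * p.2) = ε * Real.sin p.2 := by rcases hε with rfl | rfl <;> simp
    ext i
    fin_cases i
    · simp [framed, V, ofPair]
    · simp [framed, V, ofPair]
    · simp [framed, V, ofPair, hre, c1, mul_assoc]
    · simp [framed, V, ofPair, him, c2]
      ring
  have hV0 : ∀ p, V p ≠ 0 := fun p hV => by
    have := congrArg fstC hV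
    have h1 := hcirc (ε * p.1)
    simp only [V, fstC_ofPair] at this
    rw [this] at h1
    simp [fstC, show (⟨0, 0⟩ : ℂ) = 0 from rfl] at h1
  have s2 := isotopicOn_radial p1 (by fun_prop) (fun φ => mul_pos hδ (r0 _))
    (Set.univ : Set (ℝ × ℝ)) V hV0
  let W : ℝ × ℝ → R4 := fun p => ofPair ⟨Real.cos (ε * p.1), Real.sin (ε * p.1)⟩
    ⟨Real.cos (ε * p.2), Real.sin (ε * p.2)⟩
  have e2 : ∀ p, toS3 (ofPair (fstC (V p) * argFun p1 (fstC (V p))) (sndC (V p))) =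
      toS3 (W p) := fun p => by
    have hc : 0 < δ * r p.1 := mul_pos hδ (r0 _)
    rw [← toS3_smul hc (W p)]
    simp only [V, W, fstC_ofPair, sndC_ofPair, argFun_circle, ← mul_assoc, hε2, one_mul,
      smul_ofPair]
    rw [mul_comm (_ : ℂ) ((δ * r p.1 : ℝ) : ℂ)]
  have s3 := isotopicOn_twist p2 (by fun_prop) (Set.univ : Set (ℝ × ℝ)) W fun p => by
    simp only [W, fstC_ofPair, sndC_ofPair, hcirc, and_self]
  have e3 : ∀ p, ofPair (fstC (W p)) (sndC (W p) *
      Complex.exp (argFun p2 (fstC (W p)) * Complex.I)) =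
      !₂[Real.cos (ε * p.1), Real.sin (ε * p.1),
        Real.cos (ε * (p.2 + n * p.1 - θ p.1)), Real.sin (ε * (p.2 + n * p.1 - θ p.1))] :=
    fun p => by
    simp only [W, fstC_ofPair, sndC_ofPair, argFun_circle, ← mul_assoc, hε2, one_mul]
    have ha : (ε : ℝ) * (p.2 + n * p.1 - θ p.1) = ε * p.2 + ε * (n * p.1 - θ p.1) := by ring
    have h1 : (ε : ℝ) * (n * ε * ε * p.1 - θ p.1) = ε * (n * p.1 - θ p.1) := by
      rw [mul_assoc (n : ℝ), hε2, mul_one]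
    generalize hb : (ε : ℝ) * (n * p.1 - θ p.1) = b at *
    rw [ha, Real.cos_add, Real.sin_add, h1]
    ext i
    fin_cases i
    · simp [ofPair]
    · simp [ofPair]
    · simp [ofPair, Complex.exp_ofReal_mul_I_re, Complex.exp_ofReal_mul_I_im]
    · simp [ofPair, Complex.exp_ofReal_mul_I_re, Complex.exp_ofReal_mul_I_im]
      ring
  have s1' : IsotopicOn (Set.univ : Set (ℝ × ℝ))
      (fun p => N.coord p.1 (r p.1 * Complex.exp (p.2 * Complex.I))) (fun p => toS3 (V p)) := by
    have : (fun p => toS3 (V p)) = (fun p : ℝ × ℂ => toS3 (framed ε (fun ρ => ε * ρ) (fun _ => 0)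
        (p.1, δ * p.2))) ∘ fun p : ℝ × ℝ =>
          (p.1, (r p.1 * Complex.exp (p.2 * Complex.I) : ℂ)) := by
      funext p
      simp only [Function.comp, e1]
    rw [this]
    exact s1
  simp only [e2] at s2
  simp only [e3] at s3
  exact (s1'.trans s2).trans s3

end

section

/-! ### The section of the saddle -/

/-- The profile of the saddle: the half-width of its section at distance `d` from the axis. -/
def profile (a b d : ℝ) : ℝ := min 1 (max a (a + (1 - a) / (1 - b) * (d - b)))

theorem profile_le_one (a b d : ℝ) : profile a b d ≤ 1 := min_le_left _ _

theorem le_profile {a : ℝ} (ha : a ≤ 1) (b d : ℝ) : a ≤ profile a b d :=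
  le_min ha (le_max_left _ _)

theorem profile_of_le {a b d : ℝ} (ha : a ≤ 1) (hb : b < 1) (hd : d ≤ b) : profile a b d = a := by
  have : (1 - a) / (1 - b) * (d - b) ≤ 0 :=
    mul_nonpos_of_nonneg_of_nonpos (div_nonneg (by linarith) (by linarith)) (by linarith)
  rw [profile, max_eq_left (by linarith), min_eq_right ha]

theorem profile_of_mem {a b d : ℝ} (ha : a ≤ 1) (hb : b < 1) (hd : b ≤ d) (hd1 : d ≤ 1) :
    profile a b d = a + (1 - a) / (1 - b) * (d - b) := by
  have h1 : 0 ≤ (1 - a) / (1 - b) * (d - b) :=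
    mul_nonneg (div_nonneg (by linarith) (by linarith)) (by linarith)
  have h2 : (1 - a) / (1 - b) * (d - b) ≤ 1 - a := by
    rw [div_mul_eq_mul_div, div_le_iff₀ (by linarith)]
    nlinarith
  rw [profile, max_eq_right (by linarith), min_eq_right (by linarith)]

theorem profile_of_one_le {a b d : ℝ} (ha : a ≤ 1) (hb : b < 1) (hd : 1 ≤ d) :
    profile a b d = 1 := by
  have h2 : 1 - a ≤ (1 - a) / (1 - b) * (d - b) := by
    rw [div_mul_eq_mul_div, le_div_iff₀ (by linarith)]
    nlinarith
  rw [profile, min_eq_left]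
  exact le_max_of_le_right (by linarith)

theorem lipschitzWith_profile (a b : ℝ) : ∃ C, LipschitzWith C (profile a b) := by
  have h : LipschitzWith (‖(1 - a) / (1 - b)‖₊) fun d : ℝ => a + (1 - a) / (1 - b) * (d - b) :=
    LipschitzWith.of_dist_le_mul fun d d' => by
      rw [Real.dist_eq, Real.dist_eq, coe_nnnorm, Real.norm_eq_abs, ← abs_mul]
      apply le_of_eq
      congr 1
      ring
  exact ⟨_, (h.const_max a).const_min 1⟩

/-- The signs `s₁` and `s₂` treat the four oblique segments of the section at once. -/
theorem mem_segment_oblique {t a b x y s₁ s₂ : ℝ} (ht : 0 < t) (hb : b < 1)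
    (h₁ : s₁ * s₁ = 1) (h₂ : s₂ * s₂ = 1) :
    (t * x, t * y) ∈ segment ℝ (s₁ * t, s₂ * t) (s₁ * (t * a), s₂ * (t * b)) ↔
      b ≤ s₂ * y ∧ s₂ * y ≤ 1 ∧ s₁ * x = a + (1 - a) / (1 - b) * (s₂ * y - b) := by
  have hb' : 0 < 1 - b := by linarith
  have ht' := ht.ne'
  rw [segment_eq_image]
  simp only [Set.mem_image, Prod.smul_mk, Prod.mk_add_mk, Prod.mk.injEq, smul_eq_mul]
  constructor
  · rintro ⟨c, ⟨c0, c1⟩, hx, hy⟩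
    have ex : x = s₁ * (1 - c + c * a) :=
      mul_left_cancel₀ ht' (by linear_combination -hx)
    have ey : y = s₂ * (1 - c + c * b) :=
      mul_left_cancel₀ ht' (by linear_combination -hy)
    have ey' : s₂ * y = 1 - c + c * b := by
      rw [ey]; linear_combination (1 - c + c * b) * h₂
    have ex' : s₁ * x = 1 - c + c * a := by
      rw [ex]; linear_combination (1 - c + c * a) * h₁
    rw [ey', ex']
    refine ⟨by nlinarith, by nlinarith, ?_⟩
    field_simp
    ring
  · rintro ⟨h, h', hx⟩
    refine ⟨(1 - s₂ * y) / (1 - b), ⟨div_nonneg (by linarith) hb'.le, ?_⟩, ?_, ?_⟩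
    · rw [div_le_one hb']
      linarith
    · have : x = s₁ * (a + (1 - a) / (1 - b) * (s₂ * y - b)) := by
        rw [← hx]; linear_combination -x * h₁
      rw [this]
      field_simp
      ring
    · have : y = s₂ * (s₂ * y) := by linear_combination -y * h₂
      conv_rhs => rw [this]
      field_simp
      ring

theorem mem_segment_vertical {t a b x y s : ℝ} (ht : 0 < t) (hb : 0 < b) (h : s * s = 1) :
    (t * x, t * y) ∈ segment ℝ (s * (t * a), t * b) (s * (t * a), -(t * b)) ↔
      |y| ≤ b ∧ s * x = a := by
  have ht' := ht.ne'
  rw [segment_eq_image]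
  simp only [Set.mem_image, Prod.smul_mk, Prod.mk_add_mk, Prod.mk.injEq, smul_eq_mul]
  constructor
  · rintro ⟨c, ⟨c0, c1⟩, hx, hy⟩
    have ex : x = s * a := mul_left_cancel₀ ht' (by linear_combination -hx)
    have ey : y = (1 - 2 * c) * b := mul_left_cancel₀ ht' (by linear_combination -hy)
    refine ⟨?_, ?_⟩
    · rw [ey, abs_le]
      constructor <;> nlinarith
    · rw [ex]; linear_combination a * h
  · rintro ⟨hy, hx⟩
    rw [abs_le] at hy
    refine ⟨(1 - y / b) / 2, ⟨?_, ?_⟩, ?_, ?_⟩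
    · have : y / b ≤ 1 := (div_le_one hb).2 hy.2
      linarith
    · have : -1 ≤ y / b := by rw [le_div_iff₀ hb]; linarith
      linarith
    · rw [← hx]; linear_combination (t * x) * h
    · field_simp
      ring

/-- The vertical segments are the constant part of the profile and the oblique ones its affine part.
This is what makes the new section two graphs over the coordinate along the band, that is, the edges
of a narrower band. -/
theorem mem_saddleSection_iff {β₁ β₂ t a b x y : ℝ} (ht : 0 < t) (ha : t ^ β₁ = t * a)
    (hb : t ^ β₂ = t * b) (a0 : 0 < a) (a1 : a ≤ 1) (b0 : 0 < b) (b1 : b < 1) :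
    (t * x, t * y) ∈ saddleSection β₁ β₂ t ↔ |y| ≤ 1 ∧ |x| = profile a b |y| := by
  have oo := fun s₁ s₂ h₁ h₂ => mem_segment_oblique (x := x) (y := y) (a := a) (s₁ := s₁)
    (s₂ := s₂) ht b1 h₁ h₂
  have vv := fun s h => mem_segment_vertical (x := x) (y := y) (a := a) (s := s) ht b0 h
  have o1 := oo (-1) 1 (by norm_num) (by norm_num)
  have o2 := oo (-1) (-1) (by norm_num) (by norm_num)
  have o3 := oo 1 1 (by norm_num) (by norm_num)
  have o4 := oo 1 (-1) (by norm_num) (by norm_num)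
  have v1 := vv (-1) (by norm_num)
  have v2 := vv 1 (by norm_num)
  simp only [neg_mul, one_mul] at o1 o2 o3 o4 v1 v2
  unfold saddleSection
  rw [ha, hb, segment_symm ℝ (-(t * a), -(t * b)) (-t, -t),
    segment_symm ℝ (t * a, -(t * b)) (t, -t)]
  simp only [Set.mem_union, o1, o2, o3, o4, v1, v2]
  constructor
  · have obl : ∀ X Y : ℝ, b ≤ Y → Y ≤ 1 → X = a + (1 - a) / (1 - b) * (Y - b) →
        |Y| ≤ 1 ∧ |X| = profile a b |Y| := by
      intro X Y h1 h2 h3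
      rw [abs_of_nonneg (by linarith : 0 ≤ Y), profile_of_mem a1 b1 h1 h2, ← h3]
      refine ⟨h2, abs_of_nonneg ?_⟩
      have : 0 ≤ (1 - a) / (1 - b) * (Y - b) :=
        mul_nonneg (div_nonneg (by linarith) (by linarith)) (by linarith)
      linarith
    have ver : ∀ X : ℝ, |y| ≤ b → X = a → |y| ≤ 1 ∧ |X| = profile a b |y| := by
      intro X h1 h2
      rw [profile_of_le a1 b1 h1, h2, abs_of_pos a0]
      exact ⟨by linarith, rfl⟩
    rintro (((⟨h1, h2, h3⟩ | ⟨h1, h2⟩) | ⟨h1, h2, h3⟩) | ((⟨h1, h2, h3⟩ | ⟨h1, h2⟩) | ⟨h1, h2, h3⟩))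
    · simpa only [abs_neg] using obl _ _ h1 h2 h3
    · simpa only [abs_neg] using ver _ h1 h2
    · simpa only [abs_neg] using obl _ _ h1 h2 h3
    · simpa only [abs_neg] using obl _ _ h1 h2 h3
    · simpa only [abs_neg] using ver _ h1 h2
    · simpa only [abs_neg] using obl _ _ h1 h2 h3
  · rintro ⟨h1, h2⟩
    rcases le_total |y| b with hy | hy
    · rw [profile_of_le a1 b1 hy] at h2
      rcases abs_choice x with hx | hx <;> rw [hx] at h2
      · exact Or.inr (Or.inl (Or.inr ⟨hy, h2⟩))
      · exact Or.inl (Or.inl (Or.inr ⟨hy, h2⟩))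
    · rw [profile_of_mem a1 b1 hy h1] at h2
      rcases abs_choice x with hx | hx <;> rcases abs_choice y with hy' | hy' <;>
        rw [hx, hy'] at h2 <;> rw [hy'] at hy h1
      · exact Or.inr (Or.inl (Or.inl ⟨hy, h1, h2⟩))
      · exact Or.inr (Or.inr ⟨hy, h1, h2⟩)
      · exact Or.inl (Or.inl (Or.inl ⟨hy, h1, h2⟩))
      · exact Or.inl (Or.inr ⟨hy, h1, h2⟩)

/-- All vertices lie in a square, which is convex. Hence the bridge lies over the slice, and its
removal does not affect the germ elsewhere. -/
theorem bridgeSection_subset {β₁ β₂ t : ℝ} (ht : 0 < t) (h1 : t ^ β₁ ≤ t) (h2 : t ^ β₂ ≤ t) :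
    bridgeSection β₁ β₂ t ⊆ Set.Icc (-t, -t) (t, t) := by
  have hc : Convex ℝ (Set.Icc ((-t, -t) : ℝ × ℝ) (t, t)) := convex_Icc _ _
  have p1 := Real.rpow_nonneg ht.le β₁
  have p2 := Real.rpow_nonneg ht.le β₂
  have key : ∀ p q : ℝ × ℝ, (|p.1| ≤ t ∧ |p.2| ≤ t) → (|q.1| ≤ t ∧ |q.2| ≤ t) →
      segment ℝ p q ⊆ Set.Icc ((-t, -t) : ℝ × ℝ) (t, t) := by
    intro p q hp hq
    simp only [abs_le] at hp hq
    exact hc.segment_subset ⟨⟨hp.1.1, hp.2.1⟩, ⟨hp.1.2, hp.2.2⟩⟩ ⟨⟨hq.1.1, hq.2.1⟩, ⟨hq.1.2, hq.2.2⟩⟩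
  unfold bridgeSection
  refine Set.union_subset (Set.union_subset (Set.union_subset ?_ ?_) ?_)
    (Set.union_subset (Set.union_subset ?_ ?_) ?_) <;> apply key <;>
    simp only [abs_neg, abs_of_pos ht, abs_of_nonneg p1, abs_of_nonneg p2] <;>
    exact ⟨by linarith, by linarith⟩

/-! ### The radius function -/

/-- The distance of `ρ` from `ρ₀` modulo `2π`, in units of `ε`. -/
def Slice.dist (Q : Slice) (ρ : ℝ) : ℝ := ‖((ρ - Q.ρ₀ : ℝ) : AddCircle (2 * Real.pi))‖ / Q.ε

theorem Slice.dist_add (Q : Slice) (ρ : ℝ) (k : ℤ) :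
    Q.dist (ρ + 2 * Real.pi * k) = Q.dist ρ := by
  have : ((ρ + 2 * Real.pi * k - Q.ρ₀ : ℝ) : AddCircle (2 * Real.pi)) = ((ρ - Q.ρ₀ : ℝ)) := by
    rw [show ρ + 2 * Real.pi * k - Q.ρ₀ = (ρ - Q.ρ₀) + k • (2 * Real.pi) by
      rw [zsmul_eq_mul]; ring, AddCircle.coe_add, AddCircle.coe_zsmul, AddCircle.coe_period,
      smul_zero, add_zero]
  rw [Slice.dist, Slice.dist, this]

/-- Since `ε < π`, such a `ρ` is its own closest representative modulo `2π`. -/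
theorem Slice.dist_of_mem (Q : Slice) {ρ : ℝ} (h : |ρ - Q.ρ₀| ≤ Q.ε) :
    Q.dist ρ = |ρ - Q.ρ₀| / Q.ε := by
  have hpi := Real.pi_pos
  rw [Slice.dist, (AddCircle.norm_coe_eq_abs_iff _ (by positivity)).2]
  rw [abs_of_pos (by positivity : 0 < 2 * Real.pi)]
  linarith [Q.ε_lt]

theorem Slice.exists_mem_of_dist_le (Q : Slice) {ρ : ℝ} (h : Q.dist ρ ≤ 1) :
    ∃ k : ℤ, |ρ + 2 * Real.pi * k - Q.ρ₀| ≤ Q.ε := by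
  rw [Slice.dist, div_le_one Q.ε_pos, AddCircle.norm_eq] at h
  refine ⟨-round ((2 * Real.pi)⁻¹ * (ρ - Q.ρ₀)), le_trans (le_of_eq ?_) h⟩
  congr 1
  push_cast
  ring

theorem Slice.lipschitzWith_dist (Q : Slice) : ∃ C, LipschitzWith C Q.dist := by
  refine ⟨⟨Q.ε⁻¹, (inv_pos.2 Q.ε_pos).le⟩, LipschitzWith.of_dist_le_mul fun x y => ?_⟩
  change _ ≤ Q.ε⁻¹ * Dist.dist x y
  rw [Real.dist_eq, Real.dist_eq, Slice.dist, Slice.dist, ← sub_div, abs_div, abs_of_pos Q.ε_pos,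
    div_eq_inv_mul]
  refine mul_le_mul_of_nonneg_left ?_ (inv_pos.2 Q.ε_pos).le
  refine (abs_norm_sub_norm_le _ _).trans ?_
  rw [← QuotientAddGroup.mk_sub]
  refine (QuotientAddGroup.norm_mk_le_norm).trans (le_of_eq ?_)
  rw [Real.norm_eq_abs]
  congr 1
  ring

end

section

/-! ### The link of the germ -/

theorem smul_coe_injective {t s : ℝ} (ht : 0 < t) (hs : 0 ≤ s) {σ τ : S3}
    (h : t • (σ : R4) = s • (τ : R4)) : t = s ∧ σ = τ := by
  have h1 := congrArg norm h
  rw [norm_smul, norm_smul, S3.norm_coe, S3.norm_coe, Real.norm_eq_abs, Real.norm_eq_abs,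
    abs_of_pos ht, abs_of_nonneg hs, mul_one, mul_one] at h1
  subst h1
  exact ⟨rfl, Subtype.ext (smul_right_injective R4 ht.ne' h)⟩

theorem smul_mem_cone {t : ℝ} (ht : 0 < t) {σ : S3} {A : Set S3} :
    t • (σ : R4) ∈ cone A ↔ σ ∈ A := by
  constructor
  · rintro ⟨s, hs, τ, hτ, h⟩
    rw [(smul_coe_injective ht hs h).2]
    exact hτ
  · exact fun h => ⟨t, ht.le, σ, h, rfl⟩

theorem smul_mem_image_sliceEmbedding {K : Set S3} (F : CharacteristicBand K) (Q : Slice)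
    {t : ℝ} (ht : 0 < t) {σ : S3} (S : ℝ → Set (ℝ × ℝ)) :
    t • (σ : R4) ∈ sliceEmbedding F Q '' {p | 0 ≤ p.2.2 ∧ (p.1, p.2.1) ∈ S p.2.2} ↔
      ∃ x y : ℝ, (t * x, t * y) ∈ S t ∧ σ = F.coord (Q.ρ₀ + Q.ε * y) x := by
  constructor
  · rintro ⟨⟨x, y, z⟩, ⟨hz, hS⟩, h⟩
    obtain ⟨rfl, e⟩ := smul_coe_injective ht hz h.symm
    refine ⟨x / t, y / t, ?_, e⟩
    rwa [mul_div_cancel₀ _ ht.ne', mul_div_cancel₀ _ ht.ne']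
  · rintro ⟨x, y, hS, rfl⟩
    refine ⟨(t * x, t * y, t), ⟨ht.le, hS⟩, ?_⟩
    simp only [sliceEmbedding, mul_div_cancel_left₀ _ ht.ne']

/-- The cone part of the germ misses the cone over the slice, whereas the bridge lies inside it. So
removing the bridge leaves exactly the cone part, and adding the saddle is the only other
contribution. -/
theorem mem_linkAt_iff {K : Set S3} {F : CharacteristicBand K} (N : Thickening F) {Q : Slice}
    {n : ℤ} (τ : TwistAngle Q n) {β₁ β₂ t a b : ℝ} (ht : 0 < t)
    (ha : t ^ β₁ = t * a) (hb : t ^ β₂ = t * b) (a0 : 0 < a) (a1 : a ≤ 1) (b0 : 0 < b) (b1 : b < 1)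
    (σ : S3) :
    σ ∈ linkAt (saddleMove (sliceEmbedding F Q) β₁ β₂ (twistedGerm N τ β₁ β₂)) t ↔
      (((∃ ρ, twistedBand N τ ρ 1 = σ) ∨ ∃ ρ, twistedBand N τ ρ (-1) = σ) ∧
        σ ∉ Q.carrier F) ∨
      ∃ x y : ℝ, (|y| ≤ 1 ∧ |x| = profile a b |y|) ∧ σ = F.coord (Q.ρ₀ + Q.ε * y) x := by
  have hbridge : t • (σ : R4) ∈ sliceEmbedding F Q '' bridge β₁ β₂ → σ ∈ Q.carrier F := by
    intro h
    obtain ⟨x, y, hS, rfl⟩ := (smul_mem_image_sliceEmbedding F Q ht (bridgeSection β₁ β₂)).1 h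
    have hS' := bridgeSection_subset ht (by rw [ha]; nlinarith) (by rw [hb]; nlinarith) hS
    obtain ⟨⟨h1, h2⟩, ⟨h3, h4⟩⟩ := hS'
    simp only at h1 h2 h3 h4
    have k1 : -1 ≤ x := by nlinarith
    have k2 : -1 ≤ y := by nlinarith
    have k3 : x ≤ 1 := by nlinarith
    have k4 : y ≤ 1 := by nlinarith
    refine ⟨_, x, ?_, ⟨k1, k3⟩, rfl⟩
    rw [add_sub_cancel_left, abs_mul, abs_of_pos Q.ε_pos]
    exact mul_le_of_le_one_right Q.ε_pos.le (abs_le.2 ⟨k2, k4⟩)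
  have hs := smul_mem_image_sliceEmbedding F Q ht (σ := σ) (saddleSection β₁ β₂)
  simp only [mem_saddleSection_iff ht ha hb a0 a1 b0 b1] at hs
  rw [← hs]
  change (t • (σ : R4) ∈ saddleMove (sliceEmbedding F Q) β₁ β₂ (twistedGerm N τ β₁ β₂)) ↔ _
  simp only [saddleMove, twistedGerm, Set.mem_union, Set.mem_sdiff, smul_mem_cone ht,
    Set.mem_range]
  change _ ∨ (t • (σ : R4) ∈ sliceEmbedding F Q '' saddleBridge β₁ β₂) ↔
    _ ∨ (t • (σ : R4) ∈ sliceEmbedding F Q '' saddleBridge β₁ β₂)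
  tauto

/-- The closed curve in the solid torus which makes an angle `θ ρ + φ` with the band, at distance
`r ρ` from the core. -/
def twistedCurve {K : Set S3} {F : CharacteristicBand K} (N : Thickening F) (r θ : ℝ → ℝ)
    (φ ρ : ℝ) : S3 :=
  N.coord ρ (r ρ * Complex.exp ((θ ρ + φ : ℝ) * Complex.I))

/-- `r` and `θ` are the distance and the angle of a closed curve in the solid torus that makes `n`
turns about the core. -/
structure IsTwist (r θ : ℝ → ℝ) (n : ℤ) : Prop where
  radius_periodic : ∀ ρ, r (ρ + 2 * Real.pi) = r ρ
  radius_pos : ∀ ρ, 0 < r ρ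
  radius_le : ∀ ρ, r ρ ≤ 1
  radius_lipschitz : ∃ C, LipschitzWith C r
  angle_turns : ∀ ρ, θ (ρ + 2 * Real.pi) = θ ρ + 2 * Real.pi * n
  angle_contDiff : ContDiff ℝ 1 θ

namespace IsTwist

variable {K : Set S3} {F : CharacteristicBand K} {N : Thickening F} {r θ : ℝ → ℝ} {n : ℤ}

theorem polar_mem (h : IsTwist r θ n) (ρ α : ℝ) :
    (r ρ * Complex.exp (α * Complex.I) : ℂ) ∈ Metric.closedBall (0 : ℂ) 1 := by
  rw [mem_closedBall_zero_iff, norm_mul, Complex.norm_exp_ofReal_mul_I, mul_one,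
    Complex.norm_real, Real.norm_eq_abs, abs_of_pos (h.radius_pos _)]
  exact h.radius_le ρ

theorem curve_periodic (h : IsTwist r θ n) (φ ρ : ℝ) :
    twistedCurve N r θ φ (ρ + 2 * Real.pi) = twistedCurve N r θ φ ρ := by
  have e : Complex.exp ((θ (ρ + 2 * Real.pi) + φ : ℝ) * Complex.I) =
      Complex.exp ((θ ρ + φ : ℝ) * Complex.I) := by
    rw [Complex.exp_eq_exp_iff_exists_int]
    refine ⟨n, ?_⟩
    rw [h.angle_turns]
    push_cast
    ring
  rw [twistedCurve, twistedCurve, e, h.radius_periodic]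
  exact N.periodic _ _ (h.polar_mem _ _)

theorem curve_lipschitz (h : IsTwist r θ n) (φ : ℝ) :
    ∃ C, LipschitzWith C (twistedCurve N r θ φ) := by
  obtain ⟨C, hC⟩ := h.radius_lipschitz
  have hθ := h.angle_contDiff
  have c1 : ContDiff ℝ 1 fun p : ℝ × ℝ => ((p.1, (p.2 * Complex.exp ((θ p.1 + φ : ℝ) *
      Complex.I) : ℂ)) : ℝ × ℂ) := by
    have hcast : ContDiff ℝ 1 (fun x : ℝ => (x : ℂ)) := Complex.ofRealCLM.contDiff
    have h1 : ContDiff ℝ 1 fun p : ℝ × ℝ => (p.2 : ℂ) := hcast.comp contDiff_snd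
    have h2 : ContDiff ℝ 1 fun p : ℝ × ℝ => ((θ p.1 + φ : ℝ) : ℂ) :=
      hcast.comp ((hθ.comp contDiff_fst).add contDiff_const)
    exact contDiff_fst.prodMk (h1.mul ((h2.mul contDiff_const).cexp))
  have c2 : ContDiff ℝ 1 fun p : ℝ × ℝ => (N.coord p.1 (p.2 * Complex.exp ((θ p.1 + φ : ℝ) *
      Complex.I)) : R4) := (N.smooth.of_le (by norm_cast)).comp c1
  have l1 : LocallyLipschitz fun ρ : ℝ => (twistedCurve N r θ φ ρ : R4) :=
    c2.locallyLipschitz.comp (g := fun ρ => (ρ, r ρ))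
      (LocallyLipschitz.id.prodMk hC.locallyLipschitz)
  -- Two periods are needed to hold both of two points at distance at most `2π` after a common
  -- shift. Points farther apart have images at distance at most 2, which the extra 1 in the
  -- constant covers.
  obtain ⟨D, hD⟩ := (l1.locallyLipschitzOn (s := Set.Icc 0 (4 * Real.pi))
    ).exists_lipschitzOnWith_of_compact isCompact_Icc
  have hpi := Real.pi_gt_three
  have hper : Function.Periodic (fun ρ => (twistedCurve N r θ φ ρ : R4)) (2 * Real.pi) :=
    fun ρ => by simp only [h.curve_periodic]
  have key : ∀ x y, x ≤ y → dist (twistedCurve N r θ φ x : R4) (twistedCurve N r θ φ y) ≤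
      (D + 1) * dist x y := by
    intro x y hxy
    rw [Real.dist_eq, abs_sub_comm, abs_of_nonneg (sub_nonneg.2 hxy)]
    by_cases hl : y - x ≤ 2 * Real.pi
    · obtain ⟨k, hk, -⟩ := existsUnique_add_zsmul_mem_Ico Real.two_pi_pos x 0
      have e := fun z => hper.int_mul k z
      rw [zsmul_eq_mul] at hk
      simp only at e
      rw [← e x, ← e y]
      refine (hD.dist_le_mul _ ⟨hk.1, by linarith [hk.2]⟩ _
        ⟨by linarith [hk.1], by linarith [hk.2]⟩).trans ?_
      rw [Real.dist_eq, add_sub_add_right_eq_sub, abs_sub_comm, abs_of_nonneg (sub_nonneg.2 hxy)]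
      nlinarith
    · have h1 : dist (twistedCurve N r θ φ x : R4) (twistedCurve N r θ φ y) ≤ 2 := by
        rw [dist_eq_norm]
        refine (norm_sub_le _ _).trans ?_
        rw [S3.norm_coe, S3.norm_coe]
        norm_num
      have h2 : 0 ≤ (D : ℝ) * (y - x) := mul_nonneg D.2 (by linarith)
      nlinarith
  refine ⟨D + 1, LipschitzWith.of_dist_le_mul fun x y => ?_⟩
  rcases le_total x y with hxy | hxy
  · exact key x y hxy
  · rw [dist_comm, dist_comm x]
    exact key y x hxy

theorem eq_of_coord_eq (h : IsTwist r θ n) {ρ ρ' α α' : ℝ}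
    (e : N.coord ρ (r ρ * Complex.exp (α * Complex.I)) =
      N.coord ρ' (r ρ' * Complex.exp (α' * Complex.I))) :
    (∃ k : ℤ, ρ' = ρ + 2 * Real.pi * k) ∧
      Complex.exp (α * Complex.I) = Complex.exp (α' * Complex.I) := by
  obtain ⟨e1, k, hk⟩ := N.injective _ _ _ (h.polar_mem _ _) _ (h.polar_mem _ _) e
  refine ⟨⟨k, hk⟩, ?_⟩
  have hr : r ρ' = r ρ := by
    have hper : Function.Periodic r (2 * Real.pi) := h.radius_periodic
    have := hper.int_mul k ρ
    rwa [mul_comm, ← hk] at this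
  rw [hr] at e1
  exact mul_left_cancel₀ (Complex.ofReal_ne_zero.2 (h.radius_pos ρ).ne') e1

theorem isSimpleClosedCurve (h : IsTwist r θ n) (φ : ℝ) :
    IsSimpleClosedCurve (twistedCurve N r θ φ) where
  periodic := h.curve_periodic φ
  injective _ _ e := (h.eq_of_coord_eq e).1
  lipschitz := h.curve_lipschitz φ

theorem exp_add_pi (x : ℝ) : Complex.exp ((x + Real.pi : ℝ) * Complex.I) =
    -Complex.exp (x * Complex.I) := by
  push_cast
  rw [add_mul, Complex.exp_add, Complex.exp_pi_mul_I, mul_neg_one]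

theorem curve_ne (h : IsTwist r θ n) (s t : ℝ) :
    twistedCurve N r θ 0 s ≠ twistedCurve N r θ Real.pi t := by
  intro e
  obtain ⟨⟨k, rfl⟩, e2⟩ := h.eq_of_coord_eq e
  have e3 : Complex.exp ((θ (s + 2 * Real.pi * k) : ℝ) * Complex.I) =
      Complex.exp ((θ s : ℝ) * Complex.I) := by
    have hper : Function.Periodic (fun ρ => Complex.exp ((θ ρ : ℝ) * Complex.I))
        (2 * Real.pi) := by
      intro ρ
      rw [Complex.exp_eq_exp_iff_exists_int]
      refine ⟨n, ?_⟩
      rw [h.angle_turns]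
      push_cast
      ring
    have := hper.int_mul k s
    rwa [mul_comm (k : ℝ)] at this
  rw [exp_add_pi, e3, add_zero] at e2
  have h0 := Complex.exp_ne_zero ((θ s : ℝ) * Complex.I)
  have : (2 : ℂ) * Complex.exp ((θ s : ℝ) * Complex.I) = 0 := by linear_combination e2
  simp at this

/-- Half a rotation of the solid torus about its core carries one curve to the other and stays on
the torus, which contains all angles at radius `r ρ`. -/
theorem freelyHomotopicIn (h : IsTwist r θ n) {T : Set S3}
    (hT : ∀ ρ α : ℝ, N.coord ρ (r ρ * Complex.exp (α * Complex.I)) ∈ T) :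
    FreelyHomotopicIn T (twistedCurve N r θ 0) (twistedCurve N r θ Real.pi) := by
  refine ⟨fun p => twistedCurve N r θ (Real.pi * p.1) p.2, ?_, fun p => hT _ _,
    fun s ρ => h.curve_periodic _ _, fun ρ => by simp, fun ρ => by simp⟩
  obtain ⟨C, hC⟩ := h.radius_lipschitz
  have hr := hC.continuous
  have hθ := h.angle_contDiff.continuous
  rw [continuous_induced_rng]
  have hN : Continuous fun p : ℝ × ℂ => (N.coord p.1 p.2 : R4) := N.smooth.continuous
  exact hN.comp (by fun_prop : Continuous fun p : unitInterval × ℝ =>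
    ((p.2, (r p.2 * Complex.exp ((θ p.2 + Real.pi * p.1 : ℝ) * Complex.I) : ℂ)) : ℝ × ℂ))

theorem exists_isotopicOn (h : IsTwist r θ n) (hK : IsTrivialKnot K) (N : Thickening F) :
    ∃ ε : ℤ, (ε = 1 ∨ ε = -1) ∧ IsotopicOn (Set.univ : Set (ℝ × ℝ))
      (fun p => N.coord p.1 (r p.1 * Complex.exp (p.2 * Complex.I)))
      (fun p => toS3 !₂[Real.cos (ε * p.1), Real.sin (ε * p.1),
        Real.cos (ε * (p.2 + n * p.1 - θ p.1)), Real.sin (ε * (p.2 + n * p.1 - θ p.1))]) := by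
  obtain ⟨C, hC⟩ := h.radius_lipschitz
  exact isotopicOn_torus hK N hC.continuous h.radius_periodic h.radius_pos h.radius_le
    h.angle_contDiff.continuous h.angle_turns

end IsTwist

theorem IsotopicOn.ambientIsotopic {A : Type*} {S : Set A} {ψ ψ' : A → S3}
    (h : IsotopicOn S ψ ψ') : AmbientIsotopic (ψ '' S) (ψ' '' S) := by
  obtain ⟨H, hc, h0, h1⟩ := h
  refine ⟨H, hc, h0, ?_⟩
  rw [Set.image_image]
  exact Set.image_congr h1

theorem coe_toS3_torusPoint (α β : ℝ) :
    (toS3 !₂[Real.cos α, Real.sin α, Real.cos β, Real.sin β] : R4) = torusPoint α β := by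
  have hn : ‖(!₂[Real.cos α, Real.sin α, Real.cos β, Real.sin β] : R4)‖ = √2 := by
    rw [EuclideanSpace.norm_eq]
    congr 1
    simp only [Fin.sum_univ_four, Real.norm_eq_abs, sq_abs]
    simp
    linear_combination Real.cos_sq_add_sin_sq β
  rw [coe_toS3, hn, torusPoint, one_div]
  rw [← norm_pos_iff, hn]
  positivity

theorem torusPoint_add_int (α β : ℝ) (k : ℤ) :
    torusPoint α (β + 2 * Real.pi * k) = torusPoint α β := by
  have : β + 2 * Real.pi * k = β + k * (2 * Real.pi) := by ring
  rw [torusPoint, torusPoint, this, Real.cos_add_int_mul_two_pi, Real.sin_add_int_mul_two_pi]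

namespace IsTwist

variable {K : Set S3} {F : CharacteristicBand K} {r θ : ℝ → ℝ} {n : ℤ}

theorem isUnknottedTorus (h : IsTwist r θ n) (hK : IsTrivialKnot K) (N : Thickening F) :
    IsUnknottedTorus (Set.range fun p : ℝ × ℝ =>
      N.coord p.1 (r p.1 * Complex.exp (p.2 * Complex.I))) := by
  obtain ⟨ε, hε, hi⟩ := h.exists_isotopicOn hK N
  have hε2 : (ε : ℝ) * ε = 1 := by rcases hε with rfl | rfl <;> norm_num
  have := hi.ambientIsotopic
  rw [Set.image_univ, Set.image_univ] at this
  unfold IsUnknottedTorus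
  convert this using 1
  ext σ
  constructor
  · rintro ⟨α, β, hσ⟩
    -- Obtained by solving `ε ρ = α` and `ε (φ + nρ - θ(ρ)) = β` with `ε² = 1`.
    refine ⟨(ε * α, ε * β - n * (ε * α) + θ (ε * α)), ?_⟩
    apply Subtype.ext
    simp only
    rw [coe_toS3_torusPoint, hσ]
    congr 1
    · linear_combination α * hε2
    · linear_combination β * hε2
  · rintro ⟨p, rfl⟩
    exact ⟨_, _, coe_toS3_torusPoint _ _⟩

/-- The torus link is given by `β = nα + πk`, and the parity of `k` decides which of the two curves
carries the point. -/
theorem isTorusLink (h : IsTwist r θ n) (hK : IsTrivialKnot K) (N : Thickening F) :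
    IsTorusLink (Set.range (twistedCurve N r θ 0) ∪ Set.range (twistedCurve N r θ Real.pi))
      2 (2 * n) := by
  obtain ⟨ε, hε, hi⟩ := h.exists_isotopicOn hK N
  have hε2 : (ε : ℝ) * ε = 1 := by rcases hε with rfl | rfl <;> norm_num
  have := (hi.mono (Set.subset_univ (Set.range (fun ρ => (ρ, θ ρ + 0)) ∪
    Set.range fun ρ => (ρ, θ ρ + Real.pi)))).ambientIsotopic
  rw [Set.image_union, Set.image_union, ← Set.range_comp, ← Set.range_comp, ← Set.range_comp,
    ← Set.range_comp] at this
  refine Eq.mp (congrArg (AmbientIsotopic (Set.range (twistedCurve N r θ 0) ∪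
    Set.range (twistedCurve N r θ Real.pi))) ?_) this
  symm
  ext σ
  constructor
  · rintro ⟨α, β, ⟨k, hk⟩, hσ⟩
    push_cast at hk
    have hβ : β = n * α + Real.pi * k := by linarith
    rcases Int.even_or_odd' k with ⟨j, rfl | rfl⟩
    · refine Or.inl ⟨ε * α, ?_⟩
      apply Subtype.ext
      simp only [Function.comp]
      rw [coe_toS3_torusPoint, hσ, hβ]
      push_cast
      rw [show (n : ℝ) * α + Real.pi * (2 * j) = n * α + 2 * Real.pi * j by ring,
        torusPoint_add_int]
      congr 1
      · linear_combination α * hε2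
      · linear_combination n * α * hε2
    · refine Or.inr ⟨ε * α, ?_⟩
      apply Subtype.ext
      simp only [Function.comp]
      rw [coe_toS3_torusPoint, hσ, hβ]
      push_cast
      -- For `ε = -1` the phase `π` becomes `-π`, which costs one further turn.
      have key : ∃ m : ℤ, (n : ℝ) * α + Real.pi * (2 * j + 1) =
          ε * (θ (ε * α) + Real.pi + n * (ε * α) - θ (ε * α)) + 2 * Real.pi * m := by
        rcases hε with rfl | rfl
        · exact ⟨j, by push_cast; ring⟩
        · exact ⟨j + 1, by push_cast; ring⟩
      obtain ⟨m, hm⟩ := key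
      rw [hm, torusPoint_add_int]
      congr 1
      linear_combination α * hε2
  · rintro (⟨ρ, rfl⟩ | ⟨ρ, rfl⟩)
    · refine ⟨_, _, ⟨0, ?_⟩, coe_toS3_torusPoint _ _⟩
      push_cast
      ring
    · refine ⟨_, _, ⟨ε, ?_⟩, coe_toS3_torusPoint _ _⟩
      push_cast
      ring

/-- In standard position the curves are toric with speeds `ε` and `ε n`, so the unknown direction of
the core cancels: `ε · ε n = n`. -/
theorem linkingNumber_eq (h : IsTwist r θ n) (hK : IsTrivialKnot K) (N : Thickening F) :
    linkingNumber (twistedCurve N r θ 0) (twistedCurve N r θ Real.pi) = n := by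
  obtain ⟨ε, hε, hi⟩ := h.exists_isotopicOn hK N
  have hε2 : (ε : ℝ) * ε = 1 := by rcases hε with rfl | rfl <;> norm_num
  have e1 : ∀ s : ℝ, (!₂[Real.cos (ε * s), Real.sin (ε * s), Real.cos (ε * (θ s + 0 + n * s - θ s)),
      Real.sin (ε * (θ s + 0 + n * s - θ s))] : R4) =
      toricCurve ε ((ε * n : ℤ) : ℝ) 1 1 s := fun s => by
    rw [show (ε : ℝ) * (θ s + 0 + n * s - θ s) = ((ε * n : ℤ) : ℝ) * s by push_cast; ring]
    simp [toricCurve]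
  have e2 : ∀ s : ℝ, (!₂[Real.cos (ε * s), Real.sin (ε * s),
      Real.cos (ε * (θ s + Real.pi + n * s - θ s)),
      Real.sin (ε * (θ s + Real.pi + n * s - θ s))] : R4) =
      toricCurve ε ((ε * n : ℤ) : ℝ) 1 (-1) s := fun s => by
    have h1 : Real.cos (ε * (θ s + Real.pi + n * s - θ s)) = -Real.cos (((ε * n : ℤ) : ℝ) * s) ∧
        Real.sin (ε * (θ s + Real.pi + n * s - θ s)) = -Real.sin (((ε * n : ℤ) : ℝ) * s) := by
      rcases hε with rfl | rfl
      · rw [show ((1 : ℤ) : ℝ) * (θ s + Real.pi + n * s - θ s) =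
          ((1 * n : ℤ) : ℝ) * s + Real.pi by push_cast; ring, Real.cos_add_pi, Real.sin_add_pi]
        exact ⟨rfl, rfl⟩
      · rw [show ((-1 : ℤ) : ℝ) * (θ s + Real.pi + n * s - θ s) =
          ((-1 * n : ℤ) : ℝ) * s - Real.pi by push_cast; ring, Real.cos_sub_pi, Real.sin_sub_pi]
        exact ⟨rfl, rfl⟩
    rw [h1.1, h1.2]
    simp [toricCurve]
  have key := linkingNumber_eq_of_isotopicOn hi (a := fun s => (s, θ s + 0))
    (b := fun s => (s, θ s + Real.pi)) (fun _ => trivial) (fun _ => trivial)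
    (h.curve_lipschitz (N := N) 0) (h.curve_lipschitz (N := N) Real.pi)
    (by simpa only [e1] using exists_lipschitzWith_toricCurve ε (ε * n) (by norm_num))
    (by simpa only [e2] using exists_lipschitzWith_toricCurve ε (ε * n) (by norm_num))
    (h.curve_periodic (N := N) 0) (h.curve_periodic (N := N) Real.pi) (h.curve_ne (N := N))
  simp only [e1, e2, linkingNumber_toricCurve hε one_pos one_pos] at key
  refine Eq.trans key ?_
  push_cast
  rw [← mul_assoc, hε2, one_mul]

end IsTwist

theorem isTwist_profile {Q : Slice} {n : ℤ} (τ : TwistAngle Q n) {a b : ℝ} (a0 : 0 < a)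
    (a1 : a ≤ 1) : IsTwist (fun ρ => profile a b (Q.dist ρ)) τ.angle n where
  radius_periodic ρ := by
    have := Q.dist_add ρ 1
    rw [Int.cast_one, mul_one] at this
    simp only [this]
  radius_pos ρ := a0.trans_le (le_profile a1 _ _)
  radius_le ρ := profile_le_one _ _ _
  radius_lipschitz := by
    obtain ⟨C, hC⟩ := lipschitzWith_profile a b
    obtain ⟨D, hD⟩ := Q.lipschitzWith_dist
    exact ⟨_, hC.comp hD⟩
  angle_turns := τ.turns
  angle_contDiff := τ.contDiff

/-- Over the slice the twist angle vanishes and the curves are `l = ± profile`, the section of the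
saddle; away from the slice the profile is 1 and they are the edges of the twisted band. -/
theorem linkAt_eq {K : Set S3} {F : CharacteristicBand K} (N : Thickening F) {Q : Slice}
    {n : ℤ} (τ : TwistAngle Q n) {β₁ β₂ t a b : ℝ} (ht : 0 < t)
    (ha : t ^ β₁ = t * a) (hb : t ^ β₂ = t * b) (a0 : 0 < a) (a1 : a ≤ 1) (b0 : 0 < b)
    (b1 : b < 1) :
    linkAt (saddleMove (sliceEmbedding F Q) β₁ β₂ (twistedGerm N τ β₁ β₂)) t =
      Set.range (twistedCurve N (fun ρ => profile a b (Q.dist ρ)) τ.angle 0) ∪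
      Set.range (twistedCurve N (fun ρ => profile a b (Q.dist ρ)) τ.angle Real.pi) := by
  have h := isTwist_profile τ (b := b) a0 a1
  have per : ∀ φ ρ (k : ℤ), twistedCurve N (fun ρ => profile a b (Q.dist ρ)) τ.angle φ
      (ρ + 2 * Real.pi * k) = twistedCurve N (fun ρ => profile a b (Q.dist ρ)) τ.angle φ ρ := by
    intro φ ρ k
    have hper : Function.Periodic (twistedCurve N (fun ρ => profile a b (Q.dist ρ)) τ.angle φ)
      (2 * Real.pi) := h.curve_periodic φ
    have := hper.int_mul k ρ
    rwa [mul_comm (k : ℝ)] at this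
  have inside : ∀ ρ, |ρ - Q.ρ₀| ≤ Q.ε →
      twistedCurve N (fun ρ => profile a b (Q.dist ρ)) τ.angle 0 ρ =
        F.coord ρ (profile a b (Q.dist ρ)) ∧
      twistedCurve N (fun ρ => profile a b (Q.dist ρ)) τ.angle Real.pi ρ =
        F.coord ρ (-profile a b (Q.dist ρ)) := by
    intro ρ hρ
    have h0 := h.radius_pos ρ
    have h1 := h.radius_le ρ
    constructor
    · rw [← N.extends_band _ _ ⟨by linarith, h1⟩, twistedCurve, τ.zero_on_slice ρ hρ]
      simp
    · rw [← N.extends_band _ _ ⟨by linarith, by linarith⟩, twistedCurve, τ.zero_on_slice ρ hρ,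
        IsTwist.exp_add_pi]
      simp
  have outside : ∀ ρ, 1 ≤ Q.dist ρ →
      twistedCurve N (fun ρ => profile a b (Q.dist ρ)) τ.angle 0 ρ = twistedBand N τ ρ 1 ∧
      twistedCurve N (fun ρ => profile a b (Q.dist ρ)) τ.angle Real.pi ρ =
        twistedBand N τ ρ (-1) := by
    intro ρ hρ
    constructor
    · simp [twistedCurve, twistedBand, profile_of_one_le a1 b1 hρ]
    · rw [twistedCurve, twistedBand, profile_of_one_le a1 b1 hρ, IsTwist.exp_add_pi]
      simp
  -- The edges of the twisted band are themselves twisted curves, of radius 1, and inherit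
  -- periodicity from there.
  have unit : IsTwist (fun _ => 1) τ.angle n :=
    ⟨fun _ => rfl, fun _ => one_pos, fun _ => le_rfl, ⟨0, LipschitzWith.const 1⟩, τ.turns,
      τ.contDiff⟩
  have band : ∀ ρ, twistedCurve N (fun _ => 1) τ.angle 0 ρ = twistedBand N τ ρ 1 ∧
      twistedCurve N (fun _ => 1) τ.angle Real.pi ρ = twistedBand N τ ρ (-1) := by
    intro ρ
    constructor
    · simp [twistedCurve, twistedBand]
    · rw [twistedCurve, twistedBand, IsTwist.exp_add_pi]
      simp
  have band_per : ∀ ρ (k : ℤ), twistedBand N τ (ρ + 2 * Real.pi * k) 1 = twistedBand N τ ρ 1 ∧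
      twistedBand N τ (ρ + 2 * Real.pi * k) (-1) = twistedBand N τ ρ (-1) := by
    intro ρ k
    rw [← (band _).1, ← (band _).1, ← (band _).2, ← (band _).2]
    have h1 : Function.Periodic (twistedCurve N (fun _ => 1) τ.angle 0) (2 * Real.pi) :=
      unit.curve_periodic 0
    have h2 : Function.Periodic (twistedCurve N (fun _ => 1) τ.angle Real.pi) (2 * Real.pi) :=
      unit.curve_periodic Real.pi
    rw [mul_comm (2 * Real.pi)]
    exact ⟨h1.int_mul k ρ, h2.int_mul k ρ⟩
  have band_slice : ∀ ρ, Q.dist ρ ≤ 1 → twistedBand N τ ρ 1 ∈ Q.carrier F ∧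
      twistedBand N τ ρ (-1) ∈ Q.carrier F := by
    intro ρ hρ
    obtain ⟨k, hk⟩ := Q.exists_mem_of_dist_le hρ
    rw [← (band_per ρ k).1, ← (band_per ρ k).2]
    constructor
    · refine ⟨_, 1, hk, by simp, ?_⟩
      rw [← N.extends_band _ _ (by simp), twistedBand, τ.zero_on_slice _ hk]
      simp
    · refine ⟨_, -1, hk, by simp, ?_⟩
      rw [← N.extends_band _ _ (by simp), twistedBand, τ.zero_on_slice _ hk]
      simp
  -- Injectivity of the thickening excludes that a part of the solid torus outside the angular range
  -- of the slice meets the slice.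
  have not_slice : ∀ ρ v, v ∈ Metric.closedBall (0 : ℂ) 1 → N.coord ρ v ∈ Q.carrier F →
      Q.dist ρ ≤ 1 := by
    rintro ρ v hv ⟨ρ', l, hρ', hl, e⟩
    rw [← N.extends_band _ _ hl] at e
    obtain ⟨-, k, hk⟩ := N.injective _ _ _ hv _ (by
      rw [mem_closedBall_zero_iff, Complex.norm_real, Real.norm_eq_abs]
      exact abs_le.2 hl) e
    rw [← Q.dist_add ρ k, ← hk, Q.dist_of_mem hρ', div_le_one Q.ε_pos]
    exact hρ'
  have slice_pt : ∀ y : ℝ, |y| ≤ 1 → |Q.ρ₀ + Q.ε * y - Q.ρ₀| ≤ Q.ε ∧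
      Q.dist (Q.ρ₀ + Q.ε * y) = |y| := by
    intro y hy
    have h1 : |Q.ρ₀ + Q.ε * y - Q.ρ₀| = Q.ε * |y| := by
      rw [add_sub_cancel_left, abs_mul, abs_of_pos Q.ε_pos]
    have h2 : |Q.ρ₀ + Q.ε * y - Q.ρ₀| ≤ Q.ε := by
      rw [h1]
      exact mul_le_of_le_one_right Q.ε_pos.le hy
    refine ⟨h2, ?_⟩
    rw [Q.dist_of_mem h2, h1, mul_div_cancel_left₀ _ Q.ε_pos.ne']
  ext σ
  rw [mem_linkAt_iff N τ ht ha hb a0 a1 b0 b1]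
  constructor
  · rintro (⟨⟨ρ, rfl⟩ | ⟨ρ, rfl⟩, hn⟩ | ⟨x, y, ⟨hy, hx⟩, rfl⟩)
    · have : 1 ≤ Q.dist ρ := le_of_not_ge fun hd => hn (band_slice ρ hd).1
      exact Or.inl ⟨ρ, (outside ρ this).1⟩
    · have : 1 ≤ Q.dist ρ := le_of_not_ge fun hd => hn (band_slice ρ hd).2
      exact Or.inr ⟨ρ, (outside ρ this).2⟩
    · obtain ⟨h1, h2⟩ := slice_pt y hy
      rcases abs_choice x with hc | hc
      · refine Or.inl ⟨Q.ρ₀ + Q.ε * y, ?_⟩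
        rw [(inside _ h1).1, h2, ← hx, hc]
      · refine Or.inr ⟨Q.ρ₀ + Q.ε * y, ?_⟩
        rw [(inside _ h1).2, h2, ← hx, hc, neg_neg]
  · have main : ∀ ρ, (∃ k : ℤ, |ρ + 2 * Real.pi * k - Q.ρ₀| ≤ Q.ε) ∨ 1 < Q.dist ρ := fun ρ =>
      (le_or_gt (Q.dist ρ) 1).imp_left Q.exists_mem_of_dist_le
    have inner : ∀ ρ, |ρ - Q.ρ₀| ≤ Q.ε → ∃ y : ℝ, |y| ≤ 1 ∧ ρ = Q.ρ₀ + Q.ε * y := by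
      intro ρ hρ
      refine ⟨(ρ - Q.ρ₀) / Q.ε, ?_, ?_⟩
      · rw [abs_div, abs_of_pos Q.ε_pos, div_le_one Q.ε_pos]
        exact hρ
      · rw [mul_div_cancel₀ _ Q.ε_pos.ne']
        ring
    have hprof : ∀ d, 0 < profile a b d := fun d => a0.trans_le (le_profile a1 _ _)
    rintro (⟨ρ, rfl⟩ | ⟨ρ, rfl⟩)
    · rcases main ρ with ⟨k, hk⟩ | hd
      · rw [← per 0 ρ k, (inside _ hk).1]
        obtain ⟨y, hy, e⟩ := inner _ hk
        rw [e, (slice_pt y hy).2]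
        exact Or.inr ⟨_, y, ⟨hy, abs_of_pos (hprof _)⟩, rfl⟩
      · refine Or.inl ⟨Or.inl ⟨ρ, ((outside ρ hd.le).1).symm⟩, fun hc => ?_⟩
        exact absurd (not_slice ρ _ (h.polar_mem _ _) hc) (not_le.2 hd)
    · rcases main ρ with ⟨k, hk⟩ | hd
      · rw [← per Real.pi ρ k, (inside _ hk).2]
        obtain ⟨y, hy, e⟩ := inner _ hk
        rw [e, (slice_pt y hy).2]
        exact Or.inr ⟨_, y, ⟨hy, by rw [abs_neg, abs_of_pos (hprof _)]⟩, rfl⟩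
      · refine Or.inl ⟨Or.inr ⟨ρ, ((outside ρ hd.le).2).symm⟩, fun hc => ?_⟩
        exact absurd (not_slice ρ _ (h.polar_mem _ _) hc) (not_le.2 hd)

end

end MetricKnots

end

open MetricKnots in
theorem proposition3p6 (K : Set S3) (hK : IsTrivialKnot K) (F : CharacteristicBand K)
    (N : Thickening F) (Q : Slice) (n : ℤ) (τ : TwistAngle Q n)
    (β₁ β₂ : ℝ) (hβ₁ : 1 < β₁) (hβ₂ : β₁ ≤ β₂) :
    ∀ᶠ t in 𝓝[>] (0 : ℝ),
      IsTorusLink (linkAt (saddleMove (sliceEmbedding F Q) β₁ β₂ (twistedGerm N τ β₁ β₂)) t)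
        2 (2 * n) ∧
      ∃ (T : Set S3) (γ₁ γ₂ : ℝ → S3),
        IsUnknottedTorus T ∧
        IsSimpleClosedCurve γ₁ ∧ IsSimpleClosedCurve γ₂ ∧
        Disjoint (Set.range γ₁) (Set.range γ₂) ∧
        linkAt (saddleMove (sliceEmbedding F Q) β₁ β₂ (twistedGerm N τ β₁ β₂)) t =
          Set.range γ₁ ∪ Set.range γ₂ ∧
        Set.range γ₁ ⊆ T ∧ Set.range γ₂ ⊆ T ∧
        FreelyHomotopicIn T γ₁ γ₂ ∧
        linkingNumber γ₁ γ₂ = n := by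
  -- Every `t` in `(0, 1)` is small enough: only `t ^ (β - 1) < 1` is needed for both exponents.
  filter_upwards [Ioo_mem_nhdsGT (zero_lt_one' ℝ)] with t ht
  have hβ₂' : 1 < β₂ := hβ₁.trans_le hβ₂
  have hpow : ∀ β : ℝ, t ^ β = t * t ^ (β - 1) := fun β => by
    rw [Real.rpow_sub_one ht.1.ne', mul_div_cancel₀ _ ht.1.ne']
  have a0 : 0 < t ^ (β₁ - 1) := Real.rpow_pos_of_pos ht.1 _
  have b0 : 0 < t ^ (β₂ - 1) := Real.rpow_pos_of_pos ht.1 _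
  have a1 : t ^ (β₁ - 1) < 1 := Real.rpow_lt_one ht.1.le ht.2 (sub_pos.2 hβ₁)
  have b1 : t ^ (β₂ - 1) < 1 := Real.rpow_lt_one ht.1.le ht.2 (sub_pos.2 hβ₂')
  have h := isTwist_profile τ (b := t ^ (β₂ - 1)) a0 a1.le
  rw [linkAt_eq N τ ht.1 (hpow β₁) (hpow β₂) a0 a1.le b0 b1]
  have hT : ∀ φ, Set.range (twistedCurve N (fun ρ => profile (t ^ (β₁ - 1)) (t ^ (β₂ - 1))
      (Q.dist ρ)) τ.angle φ) ⊆ Set.range fun p : ℝ × ℝ =>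
        N.coord p.1 (profile (t ^ (β₁ - 1)) (t ^ (β₂ - 1)) (Q.dist p.1) *
          Complex.exp (p.2 * Complex.I)) := by
    rintro φ _ ⟨ρ, rfl⟩
    exact ⟨(ρ, τ.angle ρ + φ), rfl⟩
  refine ⟨h.isTorusLink hK N, _, _, _, h.isUnknottedTorus hK N, h.isSimpleClosedCurve 0,
    h.isSimpleClosedCurve Real.pi, ?_, rfl, hT 0, hT Real.pi,
    h.freelyHomotopicIn fun ρ α => ⟨(ρ, α), rfl⟩, h.linkingNumber_eq hK N⟩
  rw [Set.disjoint_left]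
  rintro _ ⟨s, rfl⟩ ⟨s', hs⟩
  exact h.curve_ne s s' hs.symm
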